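/- **Setting.** Let $G=(L\cup R,E)$ be a finite bipartite graph with vertex set $V=L\sqcup R$ and maximum degree $d$, let $k\ge 1$, $\theta_L\ge 2k+1$, $\theta_R\ge 2k+1$ be integers. For a vertex $v$ and a set $A\subseteq V$ let $\delta(v,A)$ be the number of neighbours of $v$ in $A$ and $\overline\delta(v,A)$ the number of vertices of $A$ on the side opposite to $v$ that are not adjacent to $v$; write $A_L=A\cap L$, $A_R=A\cap R$. A set $A\subseteq V$ (or $G[A]$) is a $k$-biplex if $\overline\delta(v,A)\le k$ for all $v\in A$; it is maximal if no other $k$-biplex contains it. A MaxBP is a maximal $k$-biplex $H$ with $|H_L|\ge\theta_L$, $|H_R|\ge\theta_R$ that has the most edges among all such maximal $k$-biplexes. **Algorithm FastBB.** Set $H^*=\emptyset$ (global variable), call Rec$(\emptyset,V,\emptyset)$, return $H^*$. Rec$(S,C,D)$ does the following. 1. If $G[S\cup C]$ is a $k$-biplex: if $|S_L\cup C_L|\ge\theta_L$, $|S_R\cup C_R|\ge\theta_R$ and $|E(G[S\cup C])|>|E(G[H^*])|$, set $H^*=S\cup C$; return. 2. Let $\tau_L=\min_{u\in S_R}\delta(u,S\cup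 C)+k$ and $\tau_R=\min_{v\in S_L}\delta(v,S\cup C)+k$ (with $\min\emptyset=\infty$). Return if (1) $S$ is not a $k$-biplex; or (2) $\tau_L<\theta_L$ or $\tau_R<\theta_R$; or (3) $|E(G[S\cup C])|\le|E(G[H^*])|$ or $\tau_L\tau_R\le|E(G[H^*])|$; or (4) some $v\in D$ has $\overline\delta(v,S\cup C)\le k$ and is adjacent to every vertex $w\in S\cup C$ on the opposite side with $\overline\delta(w,S\cup C)\ge k$. 3. Call the vertices $v\in S\cup C$ with $\overline\delta(v,S\cup C)>k$ candidate pivots. The pivot $\hat v$ is a candidate pivot in $S$ with the largest $\overline\delta(\cdot,S\cup C)$ if $S$ contains a candidate pivot, and otherwise a candidate pivot in $C$ with the largest $\overline\delta(\cdot,S\cup C)$ (ties broken arbitrarily). Order $C$ as $v_1,\dots,v_{|C|}$: first $\hat v$ if $\hat v\in C$, then (in any order) the vertices of $C$ on the side opposite to $\hat v$ not adjacent to $\hat v$, then (in any order) the rest of $C$. Let $a=k-\overline\delta(\hat v,S)$, and $t=a+1$ if $\hat v\in S$, $t=a+2$ if $\hat v\in C$. 4. For $i=1,\dots,t$ call Rec$(S_i,C_i,D_i)$,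 where $S_i=S\cup\{v_1,\dots,v_{i-1}\}$ and $C_i$, $D_i$ are obtained from $C\setminus\{v_1,\dots,v_i\}$ and $D\cup\{v_i\}$ by removing the vertices that cannot be added to $S_i$ to form a $k$-biplex. **Theorem.** For every $k\ge1$ the equation $x^{k+4}-2x^{k+3}+x^2-x+1=0$ has a largest positive real root $\gamma_k$, and $\gamma_k<2$; to three decimals (truncated) $\gamma_1=1.754$, $\gamma_2=1.888$, $\gamma_3=1.947$. For all $G,k,\theta_L,\theta_R$ as above and all ways to break ties and to choose the free orders, FastBB returns a MaxBP if there is a maximal $k$-biplex with at least $\theta_L$ left and at least $\theta_R$ right vertices, and returns $\emptyset$ otherwise. If $G$ has at least one edge, then, with $G$ given by its vertex list and adjacency lists and with unit cost for array accesses, arithmetic operations, comparisons and list steps, FastBB takes time $O(|V|\cdot d\cdot\gamma_k^{|V|})$, where the constant in $O(\cdot)$ is absolute. -/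

import Mathlib

/-! ## `k`-biplexes of a bipartite graph -/

section Biplex

variable {V : Type} [DecidableEq V]

/-- The number of vertices of `Y` that are not adjacent to `v`. -/
def disconnections (G : SimpleGraph V) [DecidableRel G.Adj] (v : V) (Y : Finset V) : ℕ :=
  (Y.filter (fun u => ¬ G.Adj v u)).card

/-- `G[H]` is a `k`-biplex of the bipartite graph `G` with sides `L`, `R`: every vertex of `H`
misses at most `k` vertices of `H` on the other side. -/
def IsBiplex (G : SimpleGraph V) [DecidableRel G.Adj] (L R : Finset V) (k : ℕ)
    (H : Finset V) : Prop :=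
  (∀ v ∈ H ∩ L, disconnections G v (H ∩ R) ≤ k) ∧
    (∀ u ∈ H ∩ R, disconnections G u (H ∩ L) ≤ k)

/-- Maximal `k`-biplex: no other `k`-biplex contains it. -/
def IsMaximalBiplex (G : SimpleGraph V) [DecidableRel G.Adj] (L R : Finset V) (k : ℕ)
    (H : Finset V) : Prop :=
  IsBiplex G L R k H ∧ ∀ H' : Finset V, IsBiplex G L R k H' → H ⊆ H' → H' = H

/-- The number of edges of `G[H]`. -/
def inducedEdges (G : SimpleGraph V) [DecidableRel G.Adj] (L R : Finset V) (H : Finset V) : ℕ :=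
  (((H ∩ L) ×ˢ (H ∩ R)).filter (fun p => G.Adj p.1 p.2)).card

/-- The maximal `k`-biplexes that satisfy the two size constraints. -/
def IsFeasible (G : SimpleGraph V) [DecidableRel G.Adj] (L R : Finset V) (k θL θR : ℕ)
    (H : Finset V) : Prop :=
  IsMaximalBiplex G L R k H ∧ θL ≤ (H ∩ L).card ∧ θR ≤ (H ∩ R).card

/-- A maximum `k`-biplex: among the maximal `k`-biplexes that satisfy the size constraints, one
with the most edges. -/
def IsMaxBP (G : SimpleGraph V) [DecidableRel G.Adj] (L R : Finset V) (k θL θR : ℕ)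
    (H : Finset V) : Prop :=
  IsFeasible G L R k θL θR H ∧
    ∀ H' : Finset V, IsFeasible G L R k θL θR H' →
      inducedEdges G L R H' ≤ inducedEdges G L R H

end Biplex

/-! ## Programs with a step count -/

/-- The result of a computation together with the number of elementary steps it took. -/
structure Timed (α : Type) where
  val : α
  steps : ℕ

namespace Timed

instance : Monad Timed where
  pure a := ⟨a, 0⟩
  bind x f := ⟨(f x.val).val, x.steps + (f x.val).steps⟩

/-- One elementary step: a bounded number of array accesses (`f v` is a read at `v`,
`Function.update f v x` is a write in place), arithmetic operations, comparisons, and list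
operations at the head. -/
def op {α : Type} (a : α) : Timed α := ⟨a, 1⟩

/-- Traversal of a list with an accumulator: one step for every entry and one for the end of
the list, in addition to the steps of the body. -/
def loop {α β : Type} (body : β → α → Timed β) : β → List α → Timed β
  | acc, [] => op acc
  | acc, x :: xs => do
      let x ← op x
      let acc ← body acc x
      loop body acc xs

end Timed

open Timed in
/-- Allocation of an array indexed by `verts`, all of whose entries are `a`. -/
def newArray {V α : Type} (verts : List V) (a : α) : Timed (V → α) :=
  loop (fun f _ => op f) (fun _ => a) verts

/-! ## The algorithm -/

section Algorithm

/-- The input of the algorithm: the list of vertices, the side of each vertex (`true` is left),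
adjacency lists, and the parameters. -/
structure Input (V : Type) where
  verts : List V
  left : V → Bool
  adj : V → List V
  k : ℕ
  θL : ℕ
  θR : ℕ

/-- `I` encodes the bipartite graph `G` with left side `L` and the given parameters. -/
structure Input.Encodes {V : Type} (I : Input V) (G : SimpleGraph V) (L : Finset V)
    (k θL θR : ℕ) : Prop where
  verts_nodup : I.verts.Nodup
  mem_verts : ∀ v, v ∈ I.verts
  left_iff : ∀ v, I.left v = true ↔ v ∈ L
  adj_nodup : ∀ v, (I.adj v).Nodup
  mem_adj : ∀ v u, u ∈ I.adj v ↔ G.Adj v u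
  k_eq : I.k = k
  θL_eq : I.θL = θL
  θR_eq : I.θR = θR

/-- A branch `(S, C, D)`, stored as three bit arrays: the partial set, the candidate set and the
exclusion set. -/
structure Branch (V : Type) where
  S : V → Bool
  C : V → Bool
  D : V → Bool

/-- Membership in `S ∪ C`. -/
def Branch.SC {V : Type} (b : Branch V) (v : V) : Bool := b.S v || b.C v

/-- The best solution `H*` found so far: its vertex set and its number of edges. -/
structure Best (V : Type) where
  mem : V → Bool
  edges : ℕ

open Timed

variable {V : Type} [DecidableEq V] (I : Input V)

/-- `|{v | P v}|`, by one pass over the vertices. -/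
def countVerts (P : V → Bool) : Timed ℕ :=
  loop (fun c v => op (if P v then c + 1 else c)) 0 I.verts

/-- The number of neighbours `u` of `v` with `P u`, by one pass over the adjacency list. -/
def countNbrs (P : V → Bool) (v : V) : Timed ℕ :=
  loop (fun c u => op (if P u then c + 1 else c)) 0 (I.adj v)

/-- The array of the degrees `δ(v, A)`, for all vertices `v`. -/
def degrees (A : V → Bool) : Timed (V → ℕ) := do
  let deg ← newArray I.verts 0
  loop (fun deg v => do
    let c ← countNbrs I A v
    op (Function.update deg v c)) deg I.verts

/-- The array of the numbers of disconnections of all vertices `v` within `A`, that is, of the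
numbers of vertices of `A` on the other side that are not adjacent to `v`. -/
def missing (A : V → Bool) (deg : V → ℕ) : Timed (V → ℕ) := do
  let nL ← countVerts I (fun v => A v && I.left v)
  let nR ← countVerts I (fun v => A v && !I.left v)
  let miss ← newArray I.verts 0
  loop (fun miss v =>
    op (Function.update miss v ((if I.left v then nR else nL) - deg v))) miss I.verts

/-- Is `G[A]` a `k`-biplex?  `miss` holds the disconnections within `A`. -/
def testBiplex (A : V → Bool) (miss : V → ℕ) : Timed Bool :=
  loop (fun ok v => op (ok && (!A v || decide (miss v ≤ I.k)))) true I.verts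

/-- The number of edges of `G[A]`; `deg` holds the degrees within `A`. -/
def countEdges (A : V → Bool) (deg : V → ℕ) : Timed ℕ :=
  loop (fun e v => op (if A v && I.left v then e + deg v else e)) 0 I.verts

/-- The bound `τ_L` (for `side = true`) or `τ_R` (for `side = false`): the minimum of
`δ(u, S ∪ C) + k` over the vertices `u` of `S` on the side opposite to `side`.  The minimum over
the empty set is `∞`, represented by `none`. -/
def tau (b : Branch V) (degSC : V → ℕ) (side : Bool) : Timed (Option ℕ) :=
  loop (fun t u => op (
    if b.S u && (I.left u != side) then
      match t with
      | none => some (degSC u + I.k)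
      | some m => some (min m (degSC u + I.k))
    else t)) none I.verts

/-- `t < n`, where `none` is `∞`. -/
def tauLT : Option ℕ → ℕ → Bool
  | none, _ => false
  | some t, n => decide (t < n)

/-- `t₁ * t₂ ≤ n`, where `none` is `∞` (and `∞ * t = ∞`). -/
def tauMulLE : Option ℕ → Option ℕ → ℕ → Bool
  | some t₁, some t₂, n => decide (t₁ * t₂ ≤ n)
  | _, _, _ => false

/-- Pruning condition (4): some vertex `v` of `D` has at most `k` disconnections within `S ∪ C`
and is adjacent to all vertices of `S ∪ C` on the other side that have at least `k`
disconnections within `S ∪ C`. -/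
def testExtendable (b : Branch V) (missSC : V → ℕ) : Timed Bool := do
  let critL ← countVerts I (fun w => b.SC w && I.left w && decide (I.k ≤ missSC w))
  let critR ← countVerts I (fun w => b.SC w && !I.left w && decide (I.k ≤ missSC w))
  loop (fun found v =>
    if b.D v && decide (missSC v ≤ I.k) then do
      let c ← countNbrs I (fun w => b.SC w && decide (I.k ≤ missSC w)) v
      op (found || decide (c = if I.left v then critR else critL))
    else op found) false I.verts

/-- The disjunction of the four pruning conditions. -/
def testPrune (b : Branch V) (best : Best V) (missS degSC missSC : V → ℕ) : Timed Bool := do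
  let sBiplex ← testBiplex I b.S missS
  let τL ← tau I b degSC true
  let τR ← tau I b degSC false
  let e ← countEdges I b.SC degSC
  let extendable ← testExtendable I b missSC
  op (!sBiplex
    || (tauLT τL I.θL || tauLT τR I.θR)
    || (decide (e ≤ best.edges) || tauMulLE τL τR best.edges)
    || extendable)

/-- The first vertex in the list `scan` with the most disconnections among the vertices of `A`
with more than `k` disconnections. -/
def selectMax (scan : List V) (A : V → Bool) (miss : V → ℕ) : Timed (Option V) :=
  loop (fun p v => op (
    if A v && decide (I.k < miss v) then
      match p with
      | none => some v
      | some w => if miss w < miss v then some v else some w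
    else p)) none scan

/-- The pivot: a candidate pivot in `S` with the most disconnections within `S ∪ C` if `S`
contains a candidate pivot, and otherwise one in `C`. -/
def selectPivot (scan : List V) (b : Branch V) (missSC : V → ℕ) : Timed (Option V) := do
  let p ← selectMax I scan b.S missSC
  match p with
  | some v => op (some v)
  | none => selectMax I scan b.C missSC

/-- The ordering of `C` determined by the pivot `p`: first `p` itself if `p ∈ C`, then the
vertices of `C` on the other side that are not adjacent to `p`, then the rest of `C`. -/
def branchOrder (scan : List V) (b : Branch V) (p : V) : Timed (List V) := do
  let nb ← newArray I.verts false
  let nb ← loop (fun nb u => op (Function.update nb u true)) nb (I.adj p)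
  let first : V → Bool := fun u => b.C u && (I.left u != I.left p) && !nb u
  let rest ← loop (fun l u => op (
    if b.C u && !first u && decide (u ≠ p) then u :: l else l)) [] scan
  let l ← loop (fun l u => op (if first u then u :: l else l)) rest scan
  op (if b.C p then p :: l else l)

/-- A fresh copy of the branch `b` in which those vertices are removed from `C` and `D` that
cannot be added to `S` to form a `k`-biplex: a vertex `v` is kept if it has at most `k`
disconnections within `S` and is adjacent to all vertices of `S` on the other side that already
have `k` disconnections within `S`. -/
def refine (b : Branch V) : Timed (Branch V) := do
  let degS ← degrees I b.S
  let missS ← missing I b.S degS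
  let satL ← countVerts I (fun w => b.S w && I.left w && decide (I.k ≤ missS w))
  let satR ← countVerts I (fun w => b.S w && !I.left w && decide (I.k ≤ missS w))
  let S ← newArray I.verts false
  let C ← newArray I.verts false
  let D ← newArray I.verts false
  loop (fun b' v => do
    let c ← countNbrs I (fun w => b.S w && decide (I.k ≤ missS w)) v
    let keep ← op (decide (missS v ≤ I.k) && decide (c = if I.left v then satR else satL))
    op (Branch.mk (Function.update b'.S v (b.S v))
      (Function.update b'.C v (b.C v && keep))
      (Function.update b'.D v (b.D v && keep)))) (Branch.mk S C D) I.verts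

/-- If `G[S ∪ C]` (with `e` edges) satisfies the size constraints and has more edges than `H*`,
it becomes the new `H*`. -/
def updateBest (b : Branch V) (best : Best V) (e : ℕ) : Timed (Best V) := do
  let nL ← countVerts I (fun v => b.SC v && I.left v)
  let nR ← countVerts I (fun v => b.SC v && !I.left v)
  if decide (I.θL ≤ nL) && decide (I.θR ≤ nR) && decide (best.edges < e) then do
    let H ← newArray I.verts false
    let H ← loop (fun H v => op (Function.update H v (b.SC v))) H I.verts
    op (Best.mk H e)
  else op best

/-- The recursive procedure FastBB-Rec on a branch `b`, where `best` is the value of the global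
variable `H*` at the time of the call; the result is its value at the end of the call.
`scan b best` is the order in which the call goes through the vertices in order to select the
pivot and to arrange the vertices within the two blocks of the ordering (both choices are left
open by the algorithm).  The first argument bounds the depth of the recursion; as a child has a
smaller candidate set than its parent, the bound `|V| + 1` is never reached. -/
def fastBBRec (scan : Branch V → Best V → List V) : ℕ → Branch V → Best V → Timed (Best V)
  | 0, _, best => op best
  | fuel + 1, b, best => do
      let degS ← degrees I b.S
      let missS ← missing I b.S degS
      let degSC ← degrees I b.SC
      let missSC ← missing I b.SC degSC
      -- termination
      let biplex ← testBiplex I b.SC missSC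
      if biplex then do
        let e ← countEdges I b.SC degSC
        updateBest I b best e
      else do
        -- pruning
        let prune ← testPrune I b best missS degSC missSC
        if prune then op best
        else do
          -- branching
          let pivot ← selectPivot I (scan b best) b missSC
          match pivot with
          | none => op best
          | some p => do
              let order ← branchOrder I (scan b best) b p
              let a ← op (I.k - missS p)
              let t ← op (if b.S p then a + 1 else a + 2)
              -- the branches `B_1, ..., B_t`; when `v_i` is processed, `st.1` is
              -- `(S ∪ {v_1, ..., v_(i-1)}, C - {v_1, ..., v_(i-1)}, D)`
              let r ← loop (fun (st : Branch V × Best V) v => do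
                let C ← op (Function.update st.1.C v false)
                let child ← refine I ⟨st.1.S, C, Function.update st.1.D v true⟩
                let best ← fastBBRec scan fuel child st.2
                op (Branch.mk (Function.update st.1.S v true) C st.1.D, best))
                (b, best) (order.take t)
              op r.2

/-- FastBB: start with `H* = G[∅]` and the branch `(∅, V, ∅)`. -/
def fastBB (scan : Branch V → Best V → List V) : Timed (Best V) := do
  let n ← countVerts I (fun _ => true)
  let H ← newArray I.verts false
  let S ← newArray I.verts false
  let C ← newArray I.verts true
  let D ← newArray I.verts false
  fastBBRec I scan (n + 1) (Branch.mk S C D) (Best.mk H 0)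

end Algorithm

/-! ## The constant `γ_k` -/

/-- The positive real roots of `x^(k+4) - 2 x^(k+3) + x^2 - x + 1`. -/
def gammaRoots (k : ℕ) : Set ℝ :=
  {x : ℝ | 0 < x ∧ x ^ (k + 4) - 2 * x ^ (k + 3) + x ^ 2 - x + 1 = 0}

/-- `γ_k`, the largest positive real root. -/
noncomputable def gammaK (k : ℕ) : ℝ := sSup (gammaRoots k)

set_option linter.unusedSectionVars false

/-! Pass to the bipartite complement `B`, which joins vertices on opposite sides that are not
adjacent in `G`. A `k`-biplex is a set inducing degrees at most `k` in `B`, and candidate pivots are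
the vertices of degree above `k` in `B[S ∪ C]`.

Correctness is an invariant: after a call on `(S, C, D)`, `H*` has at least as many edges as every
maximal biplex of the required size between `S` and `S ∪ C` (`Covered`). Such a biplex misses an
entry of the branching list, which is the pivot or one of more `B`-neighbours than the pivot can
afford; the first missed entry names a child that still contains it (`IsBranchList.exists_child`).
Pruned branches contain only sets that are too small, not better than `H*`, or, in rule (4), not
maximal. `H*` itself is only stored as a large biplex. But sizes above `k` give every vertex of a
large biplex a neighbour in it, so larger ones have strictly more edges, and the final `H*` is
maximal (`fastBB_spec`).

For the time, each state gets a cost that dominates the sum of the costs of its children. A call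
does `O(|V| d)` work of its own and branches at least twofold, so the total is proportional to the
cost of the root. Now `γ_k` is the growth rate of the branching vector `(1, …, k+1, k+3)`
(`geo_gammaK`). Measured by `|C|`, lists of at most `k+1` entries are fine; a list with `k+2`
entries comes from a pivot in `C` without neighbours in `S`. If this pivot has at least `k+2`
neighbours, the last child saturates it and loses one more candidate (`coarse_step_last`). Otherwise
all degrees are at most `k+1`, and this thinness is inherited by the children. There the cost is a
product of weights: `γ` for vertices of degree `k+1`, an intermediate `n` for their neighbours, and
11/10 for candidates that are harmless or whose exclusion triggers rule (4). Excluding the pivot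
lowers the weights of its neighbours, and this pays for the surplus branch (`thin_step_open`). A
factor 100 before the product makes children that end at once almost free. A suitable `n` exists for
every `k` (`exists_admissible`). All bounds hold for arbitrary `H*`; of the pruning rules only (1)
and (4) enter them. -/

/-! ## Branching on the bipartite complement -/

section Search

variable {V : Type} [DecidableEq V]

/-- The number of `B`-neighbours of `v` in `A`. -/
def mis (B : SimpleGraph V) [DecidableRel B.Adj] (A : Finset V) (v : V) : ℕ :=
  (A.filter (B.Adj v)).card

/-- A branch of the search: partial set, candidate set, exclusion set. -/
structure SearchState (V : Type) where
  S : Finset V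
  C : Finset V
  D : Finset V

/-- The vertices `S ∪ C`. -/
def SearchState.U (s : SearchState V) : Finset V := s.S ∪ s.C

variable (B : SimpleGraph V) [DecidableRel B.Adj] (k : ℕ)

/-- Adding `v` to the bounded-degree set `A` keeps all degrees at most `k`. -/
def Addable (A : Finset V) (v : V) : Prop :=
  mis B A v ≤ k ∧ ∀ w ∈ A, B.Adj v w → mis B A w < k

open Classical in
/-- The child of `s` in which the vertices of `pre` are kept and `v` is excluded. -/
noncomputable def childState (s : SearchState V) (pre : List V) (v : V) : SearchState V where
  S := s.S ∪ pre.toFinset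
  C := ((s.C \ pre.toFinset).erase v).filter (Addable B k (s.S ∪ pre.toFinset))
  D := (insert v s.D).filter (Addable B k (s.S ∪ pre.toFinset))

/-- The children that exclude the successive entries of a list, after keeping `pre`. -/
noncomputable def childStates (s : SearchState V) : List V → List V → List (SearchState V)
  | _, [] => []
  | pre, v :: l => childState B k s pre v :: childStates s (pre ++ [v]) l

/-- Some excluded vertex can be added to the whole of `S ∪ C`. -/
def Extendable (s : SearchState V) : Prop := ∃ v ∈ s.D, Addable B k s.U v

/-- The invariant established by the removal of vertices in step 4. -/
structure Refined (s : SearchState V) : Prop where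
  disj : Disjoint s.S s.C
  add : ∀ v ∈ s.C, Addable B k s.S v

/-- `l` consists of candidates adjacent to `p`, one more than `p` can still miss. -/
structure IsBlock (s : SearchState V) (p : V) (l : List V) : Prop where
  nodup : l.Nodup
  mem : ∀ u ∈ l, u ∈ s.C ∧ B.Adj p u
  len : l.length + mis B s.S p = k + 1

/-- The branching list of a pivot that lies in `S`. -/
structure IsKeptPivot (s : SearchState V) (p : V) (l : List V) : Prop where
  mem : p ∈ s.S
  lt_mis : k < mis B s.U p
  block : IsBlock B k s p l

/-- `p :: l` is the branching list of a pivot `p` that lies in `C`. -/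
structure IsOpenPivot (s : SearchState V) (p : V) (l : List V) : Prop where
  mem : p ∈ s.C
  lt_mis : k < mis B s.U p
  kept_le : ∀ v ∈ s.S, mis B s.U v ≤ k
  open_le : ∀ v ∈ s.C, mis B s.U v ≤ mis B s.U p
  block : IsBlock B k s p l

variable {B k}

theorem mis_mono {A A' : Finset V} (h : A ⊆ A') (v : V) : mis B A v ≤ mis B A' v :=
  Finset.card_le_card (Finset.filter_subset_filter _ h)

theorem mis_lt_mis {A A' : Finset V} (h : A ⊆ A') {v u : V} (hu : u ∈ A') (hu' : u ∉ A)
    (hvu : B.Adj v u) : mis B A v < mis B A' v := by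
  refine Finset.card_lt_card ⟨Finset.filter_subset_filter _ h, fun h' => hu' ?_⟩
  exact (Finset.mem_filter.1 (h' (Finset.mem_filter.2 ⟨hu, hvu⟩))).1

theorem one_le_mis {A : Finset V} {v u : V} (hu : u ∈ A) (hvu : B.Adj v u) : 1 ≤ mis B A v :=
  Finset.card_pos.2 ⟨u, Finset.mem_filter.2 ⟨hu, hvu⟩⟩

theorem childState_U_subset {s : SearchState V} {pre : List V} {v : V}
    (hpre : ∀ u ∈ pre, u ∈ s.C) : (childState B k s pre v).U ⊆ s.U := by
  intro x hx
  simp only [SearchState.U, childState, Finset.mem_union, Finset.mem_filter, Finset.mem_erase,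
    Finset.mem_sdiff, List.mem_toFinset] at hx ⊢
  rcases hx with (hx | hx) | hx
  · exact .inl hx
  · exact .inr (hpre x hx)
  · exact .inr hx.1.2.1

theorem childState_C_subset {s : SearchState V} {pre : List V} {v : V} :
    (childState B k s pre v).C ⊆ s.C \ (pre ++ [v]).toFinset := by
  intro x hx
  simp only [childState, Finset.mem_filter, Finset.mem_erase, Finset.mem_sdiff,
    List.mem_toFinset] at hx
  simp only [Finset.mem_sdiff, List.mem_toFinset, List.mem_append, List.mem_singleton]
  tauto

theorem notMem_childState_U {s : SearchState V} (hs : Disjoint s.S s.C) {pre : List V} {v : V}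
    (hv : v ∈ s.C) (hvp : v ∉ pre) : v ∉ (childState B k s pre v).U := by
  simp only [SearchState.U, childState, Finset.mem_union, Finset.mem_filter, Finset.mem_erase,
    Finset.mem_sdiff, List.mem_toFinset]
  have := Finset.disjoint_right.1 hs hv
  tauto

theorem childState_refined {s : SearchState V} (hs : Disjoint s.S s.C) (pre : List V) (v : V) :
    Refined B k (childState B k s pre v) := by
  constructor
  · rw [Finset.disjoint_left]
    intro x hx hx'
    have hx' := childState_C_subset hx'
    simp only [childState, Finset.mem_union, List.mem_toFinset] at hx
    simp only [Finset.mem_sdiff, List.mem_toFinset, List.mem_append, not_or] at hx'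
    rcases hx with hx | hx
    · exact Finset.disjoint_left.1 hs hx hx'.1
    · exact hx'.2.1 hx
  · intro x hx
    simp only [childState, Finset.mem_filter] at hx
    exact hx.2

theorem Addable.mono {A A' : Finset V} {v : V} (hA : A ⊆ A') (h : Addable B k A' v) :
    Addable B k A v :=
  ⟨(mis_mono hA v).trans h.1, fun w hw hvw => (mis_mono hA w).trans_lt (h.2 w (hA hw) hvw)⟩

/-! ### Sums over the children -/

/-- The relative cost of a branching list, where `ρ v` is the cost of excluding `v` and `w v` the
factor gained by keeping it. -/
noncomputable def branchSum (ρ w : V → ℝ) : List V → ℝ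
  | [] => 0
  | v :: l => ρ v + (w v)⁻¹ * branchSum ρ w l

/-- The child that excludes `v` after keeping `pre` is charged `M * ρ v` divided by the weights of
`pre`; summed along the list this is the Horner form `branchSum`. `P` stays abstract so that the
same bookkeeping serves both measures. -/
theorem exists_childStates_bound (P : SearchState V → ℝ → Prop) (s : SearchState V)
    (ρ w : V → ℝ) (M : ℝ) (l : List V) : ∀ pre₀ : List V,
    (∀ pre v post, l = pre ++ v :: post →
      P (childState B k s (pre₀ ++ pre) v) (M * (pre.map fun u => (w u)⁻¹).prod * ρ v)) →
    ∃ xs, List.Forall₂ P (childStates B k s pre₀ l) xs ∧ xs.sum = M * branchSum ρ w l := by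
  induction l generalizing M with
  | nil => intro pre₀ _; exact ⟨[], by simp [childStates], by simp [branchSum]⟩
  | cons v l ih =>
    intro pre₀ h
    obtain ⟨xs, hxs, hsum⟩ := ih (M * (w v)⁻¹) (pre₀ ++ [v]) (by
      intro pre u post hl
      have := h (v :: pre) u post (by simp [hl])
      simpa [mul_assoc] using this)
    refine ⟨M * ρ v :: xs, ?_, ?_⟩
    · refine List.Forall₂.cons ?_ hxs
      simpa using h [] v l rfl
    · simp only [List.sum_cons, hsum, branchSum]; ring

/-- `q + q ^ 2 + ⋯ + q ^ m`. -/
noncomputable def geo (q : ℝ) : ℕ → ℝ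
  | 0 => 0
  | m + 1 => q * (1 + geo q m)

theorem geo_nonneg {q : ℝ} (hq : 0 ≤ q) (m : ℕ) : 0 ≤ geo q m := by
  induction m with
  | zero => simp [geo]
  | succ m ih => simp only [geo]; positivity

theorem geo_succ' (q : ℝ) (m : ℕ) : geo q (m + 1) = geo q m + q ^ (m + 1) := by
  induction m with
  | zero => simp [geo]
  | succ m ih =>
    have h : ∀ i, geo q (i + 1) = q * (1 + geo q i) := fun _ => rfl
    have h1 := h m
    rw [h, ih]
    linear_combination ih - h1

theorem geo_mono {q : ℝ} (hq : 0 ≤ q) : Monotone (geo q) :=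
  monotone_nat_of_le_succ fun m => by rw [geo_succ']; have := pow_nonneg hq (m + 1); linarith

theorem one_sub_mul_geo (q : ℝ) (m : ℕ) : (1 - q) * geo q m = q - q ^ (m + 1) := by
  induction m with
  | zero => simp [geo]
  | succ m ih => rw [geo_succ', mul_add, ih]; ring

theorem branchSum_const (q : ℝ) (l : List V) :
    branchSum (fun _ => q) (fun _ => q⁻¹) l = geo q l.length := by
  induction l with
  | nil => simp [branchSum, geo]
  | cons v l ih => simp [branchSum, geo, ih]; ring

theorem branchSum_congr {ρ ρ' w : V → ℝ} {l : List V} (h : ∀ v ∈ l, ρ v = ρ' v) :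
    branchSum ρ w l = branchSum ρ' w l := by
  induction l with
  | nil => rfl
  | cons v l ih =>
    simp only [branchSum, h v (by simp), ih fun u hu => h u (by simp [hu])]

theorem branchSum_append_singleton (ρ w : V → ℝ) (l : List V) (v : V) :
    branchSum ρ w (l ++ [v]) = branchSum ρ w l + (l.map fun u => (w u)⁻¹).prod * ρ v := by
  induction l with
  | nil => simp [branchSum]
  | cons u l ih => simp [branchSum, ih]; ring

/-! ### The coarse bound -/

theorem card_childState_C {s : SearchState V} {pre : List V} {v : V}
    (hnd : (pre ++ [v]).Nodup) (hmem : ∀ u ∈ pre ++ [v], u ∈ s.C) :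
    (childState B k s pre v).C.card + (pre.length + 1) ≤ s.C.card := by
  have h1 := Finset.card_le_card (childState_C_subset (B := B) (k := k) (s := s) (pre := pre)
    (v := v))
  have hsub : (pre ++ [v]).toFinset ⊆ s.C := fun u hu => hmem u (List.mem_toFinset.1 hu)
  have h3 : (pre ++ [v]).toFinset.card = pre.length + 1 := by
    rw [List.toFinset_card_of_nodup hnd]; simp
  rw [Finset.card_sdiff_of_subset hsub, h3] at h1
  have h2 := Finset.card_le_card hsub
  omega

/-- The child that excludes the `i`-th entry has lost at least `i` candidates, so the relative costs
are at most `γ⁻¹, γ⁻¹ ^ 2, …`. -/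
theorem coarse_step {γ M₀ : ℝ} (hγ : 1 ≤ γ) (hM₀ : 0 ≤ M₀) {P : SearchState V → ℝ → Prop}
    (hmono : ∀ s x y, x ≤ y → P s x → P s y)
    (hcoarse : ∀ s, Refined B k s → P s (M₀ * γ ^ s.C.card))
    {s : SearchState V} (hs : Refined B k s) {l : List V} (hnd : l.Nodup)
    (hmem : ∀ u ∈ l, u ∈ s.C) (hgeo : geo γ⁻¹ l.length ≤ 1) :
    ∃ xs, List.Forall₂ P (childStates B k s [] l) xs ∧ xs.sum ≤ M₀ * γ ^ s.C.card := by
  have hγ0 : 0 < γ := by linarith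
  obtain ⟨xs, h1, h2⟩ := exists_childStates_bound (B := B) (k := k) P s (fun _ => γ⁻¹)
    (fun _ => γ⁻¹⁻¹) (M₀ * γ ^ s.C.card) l [] (by
      rintro pre v post rfl
      refine hmono _ _ _ ?_ (hcoarse _ (childState_refined hs.disj _ _))
      have hc := card_childState_C (B := B) (k := k) (s := s) (pre := pre) (v := v)
        (hnd.sublist (by simp)) (fun u hu => hmem u (by simp at hu ⊢; tauto))
      simp only [List.nil_append, inv_inv, List.map_const', List.prod_replicate]
      rw [mul_assoc, mul_assoc, ← pow_succ, inv_pow]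
      refine mul_le_mul_of_nonneg_left ?_ hM₀
      rw [← div_eq_mul_inv, le_div_iff₀ (by positivity), ← pow_add]
      exact pow_le_pow_right₀ hγ hc)
  refine ⟨xs, h1, ?_⟩
  rw [h2, branchSum_const]
  exact mul_le_of_le_one_right (by positivity) hgeo

/-- An open pivot with more than `k + 1` missing neighbours: keeping all but the last entry of the
list saturates the pivot and removes its remaining neighbours. -/
theorem coarse_step_last {γ M₀ : ℝ} (hγ : 1 ≤ γ) (hM₀ : 0 ≤ M₀) {P : SearchState V → ℝ → Prop}
    (hmono : ∀ s x y, x ≤ y → P s x → P s y)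
    (hcoarse : ∀ s, Refined B k s → P s (M₀ * γ ^ s.C.card))
    {s : SearchState V} (hs : Refined B k s) {p : V} {l : List V}
    (hp : IsOpenPivot B k s p l) (hp0 : mis B s.S p = 0) (hover : k + 2 ≤ mis B s.U p)
    (hgeo : geo γ⁻¹ (k + 1) + γ⁻¹ ^ (k + 3) ≤ 1) :
    ∃ xs, List.Forall₂ P (childStates B k s [] (p :: l)) xs ∧
      xs.sum ≤ M₀ * γ ^ s.C.card := by
  have hγ0 : 0 < γ := by linarith
  have hlen : l.length = k + 1 := by have := hp.block.len; omega
  obtain ⟨l₀, v₀, rfl⟩ : ∃ l₀ v₀, l = l₀ ++ [v₀] :=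
    ⟨l.dropLast, l.getLast (by rintro rfl; simp at hlen), (List.dropLast_append_getLast _).symm⟩
  have hpl : p ∉ l₀ ++ [v₀] := fun h => B.loopless.irrefl _ (hp.block.mem p h).2
  have hnd : (p :: (l₀ ++ [v₀])).Nodup := List.nodup_cons.2 ⟨hpl, hp.block.nodup⟩
  have hmem : ∀ u ∈ p :: (l₀ ++ [v₀]), u ∈ s.C := by
    intro u hu
    rcases List.mem_cons.1 hu with rfl | hu
    · exact hp.mem
    · exact (hp.block.mem u hu).1
  have hlen0 : l₀.length = k := by simpa using hlen
  obtain ⟨xs, h1, h2⟩ := exists_childStates_bound (B := B) (k := k) P s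
    -- The extra factor at `v₀` turns the last term `γ⁻¹ ^ (k + 2)` into `γ⁻¹ ^ (k + 3)`.
    (fun u => if u = v₀ then γ⁻¹ ^ 2 else γ⁻¹)
    (fun _ => γ⁻¹⁻¹) (M₀ * γ ^ s.C.card) (p :: (l₀ ++ [v₀])) [] (by
      intro pre v post hl
      refine hmono _ _ _ ?_ (hcoarse _ (childState_refined hs.disj _ _))
      have hnd' := hnd
      have hmem' := hmem
      rw [hl] at hnd' hmem'
      have hc := card_childState_C (B := B) (k := k) (s := s) (pre := pre) (v := v)
        (hnd'.sublist (by simp)) (fun u hu => hmem' u (by simp at hu ⊢; tauto))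
      simp only [List.nil_append, inv_inv, List.map_const', List.prod_replicate]
      rw [mul_assoc]
      split_ifs with hv
      · subst hv
        have hpost : post = [] := by
          rcases List.eq_nil_or_concat post with h | ⟨post', y, rfl⟩
          · exact h
          have h4 : (p :: l₀) ++ [v] = (pre ++ v :: post') ++ [y] := by simpa using hl
          have h4 : v = y := by simpa using (List.append_inj' h4 rfl).2
          subst h4
          have := (List.nodup_append.1 hnd').2.1
          exact ((List.nodup_cons.1 this).1 (by simp)).elim
        subst hpost
        have hpre : pre = p :: l₀ := by
          have : (p :: l₀) ++ [v] = pre ++ [v] := by simpa using hl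
          exact (List.append_cancel_right this).symm
        subst hpre
        set s' := childState B k s (p :: l₀) v with hs'
        -- Here `p` and the `k` vertices of `l₀` are kept, so `p` is full and no remaining candidate
        -- can be its neighbour.
        have hall : ∀ u ∈ s'.C, ¬ B.Adj p u := by
          intro u hu hpu
          have hadd : Addable B k (s.S ∪ (p :: l₀).toFinset) u :=
            (childState_refined hs.disj _ _).add u hu
          have h5 := hadd.2 p (by simp) hpu.symm
          have h6 : l₀.toFinset.card ≤ mis B (s.S ∪ (p :: l₀).toFinset) p := by
            refine Finset.card_le_card fun x hx => ?_
            have hx' := List.mem_toFinset.1 hx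
            exact Finset.mem_filter.2 ⟨by simp [hx'], (hp.block.mem x (by simp [hx'])).2⟩
          rw [List.toFinset_card_of_nodup
            ((List.nodup_append.1 hp.block.nodup).1), hlen0] at h6
          omega
        have hsub : s'.C ⊆ (s.C.erase p) \ (s.C.filter (B.Adj p)) := by
          intro x hx
          have hx2 := childState_C_subset hx
          simp only [List.cons_append, List.toFinset_cons, Finset.mem_sdiff, Finset.mem_insert,
            not_or, Finset.mem_erase, Finset.mem_filter, not_and] at hx2 ⊢
          exact ⟨⟨hx2.2.1, hx2.1⟩, fun _ => hall x hx⟩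
        -- As `p` has no neighbour in `S`, its at least `k + 2` neighbours are all candidates; with
        -- `p` itself the child loses `k + 3`.
        have hcard : k + 2 ≤ (s.C.filter (B.Adj p)).card := by
          refine hover.trans ?_
          have : mis B s.U p ≤ mis B s.S p + mis B s.C p := by
            unfold mis SearchState.U
            rw [Finset.filter_union]; exact Finset.card_union_le _ _
          rw [hp0] at this
          simpa [mis] using this
        have hsub2 : s.C.filter (B.Adj p) ⊆ s.C.erase p := by
          intro x hx
          obtain ⟨hx1, hx2⟩ := Finset.mem_filter.1 hx
          exact Finset.mem_erase.2 ⟨hx2.ne', hx1⟩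
        have h7 := Finset.card_le_card hsub
        have h8 := Finset.card_le_card hsub2
        rw [Finset.card_sdiff_of_subset hsub2] at h7
        rw [Finset.card_erase_of_mem hp.mem] at h7 h8
        have hpos : 0 < s.C.card := Finset.card_pos.2 ⟨p, hp.mem⟩
        rw [mul_assoc, ← pow_add, inv_pow]
        refine mul_le_mul_of_nonneg_left ?_ hM₀
        rw [← div_eq_mul_inv, le_div_iff₀ (by positivity), ← pow_add]
        refine pow_le_pow_right₀ hγ ?_
        simp only [List.length_cons, hlen0]
        omega
      · rw [mul_assoc, ← pow_succ, inv_pow]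
        refine mul_le_mul_of_nonneg_left ?_ hM₀
        rw [← div_eq_mul_inv, le_div_iff₀ (by positivity), ← pow_add]
        exact pow_le_pow_right₀ hγ hc)
  refine ⟨xs, h1, ?_⟩
  rw [h2, ← List.cons_append, branchSum_append_singleton]
  have hne : ∀ u ∈ p :: l₀, (if u = v₀ then γ⁻¹ ^ 2 else γ⁻¹) = γ⁻¹ := by
    intro u hu
    rw [if_neg]
    rintro rfl
    rw [← List.cons_append] at hnd
    exact (List.nodup_append.1 hnd).2.2 u hu u (by simp) rfl
  rw [branchSum_congr (ρ' := fun _ => γ⁻¹) hne, branchSum_const]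
  refine mul_le_of_le_one_right (by positivity) (le_trans (le_of_eq ?_) hgeo)
  simp only [List.length_cons, hlen0, inv_inv, List.map_const', List.prod_replicate, if_true]
  ring

end Search

/-! ### Thin states and the weighted potential -/

section Thin

variable {V : Type} [DecidableEq V] (B : SimpleGraph V) [DecidableRel B.Adj] (k : ℕ)

/-- Some `B`-neighbour of `v` has more than `k` neighbours in `S ∪ C`. -/
def Relevant (s : SearchState V) (v : V) : Prop :=
  ∃ w ∈ s.U, k < mis B s.U w ∧ B.Adj v w

/-- An excluded vertex `x` could be added back as soon as `v` is excluded. -/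
def Forced (s : SearchState V) (v : V) : Prop :=
  ∃ x ∈ s.D, B.Adj x v ∧ mis B s.U x ≤ k + 1 ∧
    ∀ w ∈ s.U, w ≠ v → B.Adj x w → mis B s.U w < k

open Classical in
/-- The weight of a candidate. -/
noncomputable def weight (γ n : ℝ) (s : SearchState V) (v : V) : ℝ :=
  if k < mis B s.U v then γ else if Relevant B k s v ∧ ¬ Forced B k s v then n else 11 / 10

/-- The product of the weights of the candidates. -/
noncomputable def potential (γ n : ℝ) (s : SearchState V) : ℝ :=
  ∏ v ∈ s.C, weight B k γ n s v

/-- All degrees are at most `k + 1`, and the kept vertices of degree `k + 1` already have a kept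
neighbour. -/
structure Thin (s : SearchState V) : Prop where
  le : ∀ v ∈ s.U, mis B s.U v ≤ k + 1
  kept : ∀ v ∈ s.S, k < mis B s.U v → 1 ≤ mis B s.S v

/-- The inequalities between the growth rate `γ` and the weight `n` that the analysis needs. -/
structure Admissible (γ n : ℝ) : Prop where
  le_n : 11 / 10 ≤ n
  n_le : n ≤ γ
  le_γ : 17 / 10 ≤ γ
  γ_le : γ ≤ 2
  -- The last four inequalities pay, in this order, for a pivot in `S`, for an open pivot with two
  -- neighbours of degree above `k`, for an open pivot one of whose neighbours falls to weight
  -- 11/10, and for forced entries of a list.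
  geo_le : geo n⁻¹ k ≤ 1
  many : (n / γ) ^ 2 + n / γ * geo n⁻¹ (k + 1) ≤ γ
  drop : 11 / 10 * n⁻¹ + geo n⁻¹ (k + 1) ≤ γ
  force : γ / n / 100 + 10 / 11 ≤ 2 * n⁻¹

variable {B k} {γ n : ℝ}

theorem weight_ge (hn : 11 / 10 ≤ n) (hγ : n ≤ γ) (s : SearchState V) (v : V) :
    11 / 10 ≤ weight B k γ n s v := by
  unfold weight; split_ifs <;> linarith

theorem weight_le (hn : 11 / 10 ≤ n) (hγ : n ≤ γ) (s : SearchState V) (v : V) :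
    weight B k γ n s v ≤ γ := by
  unfold weight; split_ifs <;> linarith

theorem weight_of_lt {s : SearchState V} {v : V} (h : k < mis B s.U v) :
    weight B k γ n s v = γ := by
  simp [weight, h]

theorem weight_le_of_not_lt (hn : 11 / 10 ≤ n) {s : SearchState V} {v : V}
    (h : ¬ k < mis B s.U v) : weight B k γ n s v ≤ n := by
  unfold weight; split_ifs <;> linarith

theorem weight_of_forced {s : SearchState V} {v : V} (h : ¬ k < mis B s.U v)
    (h' : Forced B k s v) : weight B k γ n s v = 11 / 10 := by
  simp [weight, h, h']

theorem weight_of_not_relevant {s : SearchState V} {v : V} (h : ¬ k < mis B s.U v)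
    (h' : ¬ Relevant B k s v) : weight B k γ n s v = 11 / 10 := by
  simp [weight, h, h']

theorem weight_of_relevant {s : SearchState V} {v : V} (h : ¬ k < mis B s.U v)
    (h' : Relevant B k s v) (h'' : ¬ Forced B k s v) : weight B k γ n s v = n := by
  simp [weight, h, h', h'']

/-- Without `v`, the vertex `x` has at most `k` neighbours left, none of them full; passing to
subsets only lowers degrees. -/
theorem addable_of_witness {U A : Finset V} {x v : V} (hxv : B.Adj x v) (hv : v ∈ U)
    (hx : mis B U x ≤ k + 1) (hw : ∀ w ∈ U, w ≠ v → B.Adj x w → mis B U w < k)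
    (hA : A ⊆ U) (hvA : v ∉ A) : Addable B k A x := by
  refine ⟨?_, fun w hwA hxw => (mis_mono hA w).trans_lt (hw w (hA hwA) ?_ hxw)⟩
  · have := mis_lt_mis hA hv hvA hxv; omega
  · rintro rfl; exact hvA hwA

/-- The witness survives in the exclusion set of the child, which therefore ends without branching.
This makes excluding a forced vertex almost free. -/
theorem Forced.extendable {s : SearchState V} (hs : Disjoint s.S s.C) {pre : List V} {v : V}
    (hmem : ∀ u ∈ pre, u ∈ s.C) (hv : v ∈ s.C) (hvp : v ∉ pre) (h : Forced B k s v) :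
    Extendable B k (childState B k s pre v) := by
  obtain ⟨x, hxD, hxv, hx, hw⟩ := h
  have hvU : v ∈ s.U := Finset.mem_union_right _ hv
  have hsub := childState_U_subset (B := B) (k := k) (v := v) hmem
  have hadd := addable_of_witness hxv hvU hx hw hsub (notMem_childState_U hs hv hvp)
  refine ⟨x, ?_, hadd⟩
  have : Addable B k (s.S ∪ pre.toFinset) x := hadd.mono (Finset.subset_union_left)
  simp only [childState, Finset.mem_filter, Finset.mem_insert]
  exact ⟨.inr hxD, this⟩

theorem Forced.child {s : SearchState V} (hs : Disjoint s.S s.C) {pre : List V} {v u : V}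
    (hmem : ∀ u ∈ pre, u ∈ s.C) (hu : u ∈ (childState B k s pre v).C) (h : Forced B k s u) :
    Forced B k (childState B k s pre v) u := by
  obtain ⟨x, hxD, hxu, hx, hw⟩ := h
  have huC := childState_C_subset hu
  have huU : u ∈ s.U := Finset.mem_union_right _ (Finset.mem_sdiff.1 huC).1
  have hsub := childState_U_subset (B := B) (k := k) (v := v) hmem
  have huS := Finset.disjoint_right.1 (childState_refined (B := B) (k := k) hs pre v).disj hu
  have hadd : Addable B k (s.S ∪ pre.toFinset) x := by
    refine addable_of_witness hxu huU hx hw ?_ huS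
    exact (Finset.subset_union_left (s₂ := (childState B k s pre v).C)).trans hsub
  refine ⟨x, ?_, hxu, (mis_mono hsub x).trans hx, fun w hwU hne hxw =>
    (mis_mono hsub w).trans_lt (hw w (hsub hwU) hne hxw)⟩
  simp only [childState, Finset.mem_filter, Finset.mem_insert]
  exact ⟨.inr hxD, hadd⟩

theorem Relevant.of_child {s : SearchState V} {pre : List V} {v u : V}
    (hmem : ∀ u ∈ pre, u ∈ s.C) (h : Relevant B k (childState B k s pre v) u) :
    Relevant B k s u := by
  obtain ⟨w, hwU, hw, huw⟩ := h
  have hsub := childState_U_subset (B := B) (k := k) (v := v) hmem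
  exact ⟨w, hsub hwU, hw.trans_le (mis_mono hsub w), huw⟩

/-- Degrees only decrease, no vertex becomes relevant, and a forced candidate stays forced. -/
theorem weight_childState_le (hn : 11 / 10 ≤ n) (hγ : n ≤ γ) {s : SearchState V}
    (hs : Disjoint s.S s.C) {pre : List V} {v u : V} (hmem : ∀ u ∈ pre, u ∈ s.C)
    (hu : u ∈ (childState B k s pre v).C) :
    weight B k γ n (childState B k s pre v) u ≤ weight B k γ n s u := by
  have hsub := childState_U_subset (B := B) (k := k) (v := v) hmem
  by_cases h1 : k < mis B s.U u
  · rw [weight_of_lt h1]; exact weight_le hn hγ _ _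
  have h1' : ¬ k < mis B (childState B k s pre v).U u := fun h =>
    h1 (h.trans_le (mis_mono hsub u))
  by_cases h2 : Relevant B k s u ∧ ¬ Forced B k s u
  · rw [weight_of_relevant h1 h2.1 h2.2]; exact weight_le_of_not_lt hn h1'
  · refine le_trans (le_of_eq ?_) (weight_ge hn hγ _ _)
    by_cases h3 : Relevant B k s u
    · exact weight_of_forced h1' (.child hs hmem hu (by tauto))
    · exact weight_of_not_relevant h1' fun h => h3 (h.of_child hmem)

theorem list_prod_map_inv (w : V → ℝ) (l : List V) :
    (l.map fun u => (w u)⁻¹).prod = (l.map w).prod⁻¹ := by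
  induction l with
  | nil => simp
  | cons a l ih => simp [ih, mul_comm]

/-- `T` collects candidates whose weight shrinks by the factor `α`. A member of `T` that leaves `C`
altogether is at least as good, because `hT2` says that its reduced weight would still be at least
1. -/
theorem potential_childState_le (hn : 11 / 10 ≤ n) (hγ : n ≤ γ) {s : SearchState V}
    (hs : Disjoint s.S s.C) {pre : List V} {v : V} (hnd : (pre ++ [v]).Nodup)
    (hmem : ∀ u ∈ pre ++ [v], u ∈ s.C) {T : Finset V}
    (hT : T ⊆ s.C \ (pre ++ [v]).toFinset) {α : ℝ}
    (hT1 : ∀ u ∈ T, u ∈ (childState B k s pre v).C →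
      weight B k γ n (childState B k s pre v) u ≤ α * weight B k γ n s u)
    (hT2 : ∀ u ∈ T, 1 ≤ α * weight B k γ n s u) :
    potential B k γ n (childState B k s pre v) ≤ potential B k γ n s *
      (pre.map fun u => (weight B k γ n s u)⁻¹).prod * ((weight B k γ n s v)⁻¹ * α ^ T.card) := by
  set R := (pre ++ [v]).toFinset with hR
  set f : V → ℝ := fun u => if u ∈ T then α * weight B k γ n s u else weight B k γ n s u with hf
  have hw : ∀ u, 11 / 10 ≤ weight B k γ n s u := weight_ge hn hγ s
  have hf1 : ∀ u, 1 ≤ f u := by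
    intro u; simp only [hf]; split_ifs with h
    · exact hT2 u h
    · linarith [hw u]
  have h1 : potential B k γ n (childState B k s pre v) ≤ ∏ u ∈ (childState B k s pre v).C, f u := by
    refine Finset.prod_le_prod (fun u _ => ?_) (fun u hu => ?_)
    · linarith [weight_ge (B := B) (k := k) hn hγ (childState B k s pre v) u]
    · simp only [hf]; split_ifs with h
      · exact hT1 u h hu
      · exact weight_childState_le hn hγ hs (fun u hu => hmem u (by simp [hu])) hu
  have h2 : ∏ u ∈ (childState B k s pre v).C, f u ≤ ∏ u ∈ s.C \ R, f u := by
    rw [← Finset.prod_sdiff (childState_C_subset (B := B) (k := k) (s := s) (pre := pre) (v := v))]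
    refine le_mul_of_one_le_left (Finset.prod_nonneg fun u _ => zero_le_one.trans (hf1 u)) ?_
    calc (1 : ℝ) = ∏ u ∈ (s.C \ R) \ (childState B k s pre v).C, 1 := by simp
      _ ≤ _ := Finset.prod_le_prod (fun _ _ => zero_le_one) fun u _ => hf1 u
  have h3 : ∏ u ∈ s.C \ R, f u = α ^ T.card * ∏ u ∈ s.C \ R, weight B k γ n s u := by
    have : ∀ u, f u = (if u ∈ T then α else 1) * weight B k γ n s u := by
      intro u; simp only [hf]; split_ifs <;> simp
    simp_rw [this]
    rw [Finset.prod_mul_distrib, Finset.prod_ite_mem, Finset.inter_eq_right.2 hT,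
      Finset.prod_const]
  have h4 : (∏ u ∈ s.C \ R, weight B k γ n s u) * ∏ u ∈ R, weight B k γ n s u =
      potential B k γ n s :=
    Finset.prod_sdiff fun u hu => hmem u (List.mem_toFinset.1 hu)
  have h5 : ∏ u ∈ R, weight B k γ n s u =
      (pre.map fun u => weight B k γ n s u).prod * weight B k γ n s v := by
    rw [hR, List.prod_toFinset _ hnd]; simp
  have h6 : (pre.map fun u => (weight B k γ n s u)⁻¹).prod =
      (pre.map fun u => weight B k γ n s u).prod⁻¹ := by
    exact list_prod_map_inv _ _
  have h7 : 0 < (pre.map fun u => weight B k γ n s u).prod :=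
    List.prod_pos (by
      intro a ha
      obtain ⟨u, -, rfl⟩ := List.mem_map.1 ha
      linarith [hw u])
  have h8 : 0 < weight B k γ n s v := by linarith [hw v]
  rw [h5] at h4
  calc _ ≤ α ^ T.card * ∏ u ∈ s.C \ R, weight B k γ n s u := (h1.trans h2).trans h3.le
    _ = _ := by rw [h6, ← h4]; field_simp

/-- All weights exceed 1. Hence a child of cost 1 may be charged as the fraction 1/100 of `100 *
potential`, even after division by the weights of the kept vertices. -/
theorem potential_ge_one (hn : 11 / 10 ≤ n) (hγ : n ≤ γ) (s : SearchState V) {l : List V}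
    (hnd : l.Nodup) (hmem : ∀ u ∈ l, u ∈ s.C) :
    1 ≤ potential B k γ n s * (l.map fun u => (weight B k γ n s u)⁻¹).prod := by
  have hw : ∀ u, 11 / 10 ≤ weight B k γ n s u := weight_ge hn hγ s
  have h1 : (l.map fun u => (weight B k γ n s u)⁻¹).prod =
      (∏ u ∈ l.toFinset, weight B k γ n s u)⁻¹ := by
    rw [← Finset.prod_inv_distrib, List.prod_toFinset _ hnd]
  have hpos : 0 < ∏ u ∈ l.toFinset, weight B k γ n s u :=
    Finset.prod_pos fun u _ => by linarith [hw u]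
  rw [h1, ← div_eq_mul_inv, le_div_iff₀ hpos, one_mul, potential,
    ← Finset.prod_sdiff (fun u hu => hmem u (List.mem_toFinset.1 hu) : l.toFinset ⊆ s.C)]
  refine le_mul_of_one_le_left hpos.le ?_
  calc (1 : ℝ) = ∏ u ∈ s.C \ l.toFinset, 1 := by simp
    _ ≤ _ := Finset.prod_le_prod (fun _ _ => zero_le_one) fun u _ => by linarith [hw u]

theorem potential_le_pow (hn : 11 / 10 ≤ n) (hγ : n ≤ γ) (s : SearchState V) :
    potential B k γ n s ≤ γ ^ s.C.card := by
  rw [← Finset.prod_const]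
  exact Finset.prod_le_prod
    (fun u _ => by linarith [weight_ge (B := B) (k := k) hn hγ s u])
    (fun u _ => weight_le hn hγ s u)

/-- Only newly kept vertices could break the second condition; `hpre` gives each of them a kept
neighbour `p` or a degree of at most `k`. -/
theorem Thin.child {s : SearchState V} (ht : Thin B k s) {p : V} {pre : List V} {v : V}
    (hmem : ∀ u ∈ pre, u ∈ s.C)
    (hpre : ∀ u ∈ pre, (p ∈ s.S ∪ pre.toFinset ∧ B.Adj u p) ∨
      mis B (childState B k s pre v).U u ≤ k) :
    Thin B k (childState B k s pre v) := by
  have hsub := childState_U_subset (B := B) (k := k) (v := v) hmem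
  refine ⟨fun u hu => (mis_mono hsub u).trans (ht.le u (hsub hu)), fun u hu hlt => ?_⟩
  have hu' : u ∈ s.S ∪ pre.toFinset := hu
  rcases Finset.mem_union.1 hu' with h | h
  · exact (ht.kept u h (hlt.trans_le (mis_mono hsub u))).trans
      (mis_mono Finset.subset_union_left u)
  · rcases hpre u (List.mem_toFinset.1 h) with ⟨h1, h2⟩ | h1
    · exact one_le_mis h1 h2
    · omega

/-- A forced entry costs no more than an ordinary one. With `g` the geometric sum of the tail, the
claim `1/100 + (10/11) c g ≤ c q (1 + g)` is affine in `g ∈ [0, 1]`, and `hcq`, `hforce` are its two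
endpoints. A smallest weight of 1 would put `c` for `(10/11) c`, which fails when `q` is close to
1/2. -/
theorem branchSum_le {q c : ℝ} (hq : 0 ≤ q) (hc : 0 ≤ c) {m : ℕ} (hgeo : geo q m ≤ 1)
    (hcq : 1 / 100 ≤ c * q) (hforce : 1 / 100 + c * (10 / 11) ≤ c * (2 * q)) {ρ w : V → ℝ} :
    ∀ {l : List V}, l.length ≤ m + 1 →
    (∀ v ∈ l, 0 ≤ (w v)⁻¹ ∧ ((ρ v ≤ c * q ∧ (w v)⁻¹ ≤ q) ∨
      (ρ v ≤ 1 / 100 ∧ (w v)⁻¹ ≤ 10 / 11))) →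
    branchSum ρ w l ≤ c * geo q l.length := by
  intro l
  induction l with
  | nil => intro _ _; simp [branchSum, geo]
  | cons v l ih =>
    intro hl h
    have hl' : l.length ≤ m := by simpa using hl
    have ih := ih (by omega) fun u hu => h u (by simp [hu])
    have hg0 := geo_nonneg hq l.length
    have hg1 : geo q l.length ≤ 1 := (geo_mono hq hl').trans hgeo
    obtain ⟨h0, h⟩ := h v (by simp)
    have hcg : 0 ≤ c * geo q l.length := by positivity
    have hB : (w v)⁻¹ * branchSum ρ w l ≤ (w v)⁻¹ * (c * geo q l.length) :=
      mul_le_mul_of_nonneg_left ih h0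
    simp only [branchSum, List.length_cons, geo]
    rcases h with ⟨h1, h2⟩ | ⟨h1, h2⟩
    · have := mul_le_mul_of_nonneg_right h2 hcg
      linear_combination h1 + hB + this
    · have := mul_le_mul_of_nonneg_right h2 hcg
      have e1 := mul_le_mul_of_nonneg_left hforce hg0
      have e2 := mul_le_mul_of_nonneg_left hcq (sub_nonneg.2 hg1)
      linear_combination h1 + hB + this + e1 + e2

end Thin

/-! ### The cost recurrence for thin states -/

section ThinSteps

variable {V : Type} [DecidableEq V] {B : SimpleGraph V} [DecidableRel B.Adj] {k : ℕ} {γ n : ℝ}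

open Classical in
/-- The relative cost of excluding `v`, where `c` is the cost if `v` is not forced. -/
noncomputable def excludeCost (B : SimpleGraph V) [DecidableRel B.Adj] (k : ℕ)
    (s : SearchState V) (c : V → ℝ) (v : V) : ℝ :=
  if ¬ k < mis B s.U v ∧ Forced B k s v then 1 / 100 else c v

/-- A bound on subtrees that satisfies the induction hypothesis of the analysis of thin states. -/
structure ThinBound (B : SimpleGraph V) [DecidableRel B.Adj] (k : ℕ) (γ n : ℝ)
    (P : SearchState V → ℝ → Prop) : Prop where
  mono : ∀ s x y, x ≤ y → P s x → P s y
  leaf : ∀ s, Extendable B k s → P s 1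
  thin : ∀ s, Refined B k s → Thin B k s → P s (100 * potential B k γ n s)

theorem Admissible.force_one (h : Admissible k γ n) : 1 / 100 + 10 / 11 ≤ 2 * n⁻¹ := by
  have h1 := h.le_n
  have h2 : 1 ≤ γ / n := (one_le_div (by linarith)).2 h.n_le
  have := h.force
  linarith

/-- A light forced `v` yields a leaf of cost 1, any other `v` a thin child; so the estimates `hT1`
and `hc` are needed only in the second case. -/
theorem ThinBound.child {P : SearchState V → ℝ → Prop} (hP : ThinBound B k γ n P)
    (ha : Admissible k γ n) {s : SearchState V} (hs : Refined B k s) {pre : List V} {v : V}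
    (hnd : (pre ++ [v]).Nodup) (hmem : ∀ u ∈ pre ++ [v], u ∈ s.C)
    (ht : Thin B k (childState B k s pre v)) {c : V → ℝ}
    {T : Finset V} (hT : T ⊆ s.C \ (pre ++ [v]).toFinset) {α : ℝ}
    (hT1 : ¬ (¬ k < mis B s.U v ∧ Forced B k s v) →
      ∀ u ∈ T, u ∈ (childState B k s pre v).C →
      weight B k γ n (childState B k s pre v) u ≤ α * weight B k γ n s u)
    (hT2 : ∀ u ∈ T, 1 ≤ α * weight B k γ n s u)
    (hc : ¬ (¬ k < mis B s.U v ∧ Forced B k s v) →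
      (weight B k γ n s v)⁻¹ * α ^ T.card ≤ c v) :
    P (childState B k s pre v) (100 * potential B k γ n s *
      (pre.map fun u => (weight B k γ n s u)⁻¹).prod * excludeCost B k s c v) := by
  have hpre : ∀ u ∈ pre, u ∈ s.C := fun u hu => hmem u (by simp [hu])
  have hge := potential_ge_one (B := B) (k := k) ha.le_n ha.n_le s
    (List.nodup_append.1 hnd).1 hpre
  unfold excludeCost
  split_ifs with h
  · refine hP.mono _ _ _ ?_ (hP.leaf _ (h.2.extendable hs.disj hpre (hmem v (by simp)) ?_))
    · linarith
    · intro hv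
      exact (List.nodup_append.1 hnd).2.2 v hv v (by simp) rfl
  · refine hP.mono _ _ _ ?_ (hP.thin _ (childState_refined hs.disj _ _) ht)
    have h1 := potential_childState_le ha.le_n ha.n_le hs.disj hnd hmem hT (hT1 h) hT2
    have h2 := mul_le_mul_of_nonneg_left (hc h) (zero_le_one.trans hge)
    linarith

theorem IsBlock.relevant {s : SearchState V} {p : V} {l : List V} (h : IsBlock B k s p l)
    (hp : p ∈ s.U) (hlt : k < mis B s.U p) {u : V} (hu : u ∈ l) : Relevant B k s u :=
  ⟨p, hp, hlt, (h.mem u hu).2.symm⟩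

theorem branchSum_excludeCost_le (ha : Admissible k γ n) {s : SearchState V} {l : List V}
    (hl : l.length ≤ k + 1) (hrel : ∀ u ∈ l, Relevant B k s u) {c : V → ℝ} {a : ℝ}
    (haq : 1 / 100 ≤ a * n⁻¹) (ha0 : 0 ≤ a) (hforce : 1 / 100 + a * (10 / 11) ≤ a * (2 * n⁻¹))
    (hc : ∀ u ∈ l, ¬ (¬ k < mis B s.U u ∧ Forced B k s u) → c u ≤ a * n⁻¹) :
    branchSum (excludeCost B k s c) (weight B k γ n s) l ≤ a * geo n⁻¹ l.length := by
  have hn := ha.le_n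
  refine branchSum_le (by positivity) ha0 ha.geo_le haq hforce hl fun u hu => ⟨?_, ?_⟩
  · have := weight_ge (B := B) (k := k) hn ha.n_le s u
    positivity
  · by_cases h : ¬ k < mis B s.U u ∧ Forced B k s u
    · right
      rw [weight_of_forced h.1 h.2]
      simp [excludeCost, h]
    · left
      refine ⟨by simpa only [excludeCost, if_neg h] using hc u hu h, ?_⟩
      refine inv_anti₀ (by linarith) ?_
      by_cases h1 : k < mis B s.U u
      · rw [weight_of_lt h1]; exact ha.n_le
      · rw [weight_of_relevant h1 (hrel u hu) (by tauto)]

theorem inv_weight_le (ha : Admissible k γ n) {s : SearchState V} {u : V}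
    (hrel : Relevant B k s u) (h : ¬ (¬ k < mis B s.U u ∧ Forced B k s u)) :
    (weight B k γ n s u)⁻¹ ≤ n⁻¹ := by
  have hn := ha.le_n
  refine inv_anti₀ (by linarith) ?_
  by_cases h1 : k < mis B s.U u
  · rw [weight_of_lt h1]; exact ha.n_le
  · rw [weight_of_relevant h1 hrel (by tauto)]

theorem thin_step_kept {P : SearchState V → ℝ → Prop} (hP : ThinBound B k γ n P)
    (ha : Admissible k γ n) {s : SearchState V} (hs : Refined B k s) (ht : Thin B k s)
    {p : V} {l : List V} (hp : IsKeptPivot B k s p l) :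
    ∃ xs, List.Forall₂ P (childStates B k s [] l) xs ∧ xs.sum ≤ 100 * potential B k γ n s := by
  have hn := ha.le_n
  have hpS := ht.kept p hp.mem hp.lt_mis
  -- The kept neighbour of `p` supplied by thinness shortens the list by one, which is what allows
  -- the smaller weight `n` here.
  have hlen : l.length ≤ k := by have := hp.block.len; omega
  have hrel : ∀ u ∈ l, Relevant B k s u := fun u hu =>
    hp.block.relevant (Finset.mem_union_left _ hp.mem) hp.lt_mis hu
  obtain ⟨xs, h1, h2⟩ := exists_childStates_bound P s
    (excludeCost B k s fun v => (weight B k γ n s v)⁻¹) (weight B k γ n s)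
    (100 * potential B k γ n s) l [] (by
      rintro pre v post rfl
      have hmem : ∀ u ∈ pre ++ [v], u ∈ pre ++ v :: post := by simp; tauto
      refine hP.child ha hs (hp.block.nodup.sublist (by simp))
        (fun u hu => (hp.block.mem u (hmem u hu)).1) ?_ (T := ∅) (α := 1) (by simp) (by simp)
        (by simp) (by simp)
      refine ht.child (p := p) (fun u hu => (hp.block.mem u (by simp [hu])).1) fun u hu => .inl ?_
      exact ⟨Finset.mem_union_left _ hp.mem, (hp.block.mem u (by simp [hu])).2.symm⟩)
  refine ⟨xs, h1, ?_⟩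
  rw [h2]
  have hpot := potential_ge_one (B := B) (k := k) ha.le_n ha.n_le s (l := []) (by simp) (by simp)
  simp only [List.map_nil, List.prod_nil, mul_one] at hpot
  refine mul_le_of_le_one_right (by positivity) ?_
  have hf := ha.force_one
  have h3 := branchSum_excludeCost_le (a := 1) (c := fun v => (weight B k γ n s v)⁻¹) ha (by omega) hrel
    (by linarith) (by norm_num) (by linarith)
    (fun u hu h => by rw [one_mul]; exact inv_weight_le ha (hrel u hu) h)
  rw [one_mul] at h3
  exact h3.trans ((geo_mono (by positivity) hlen).trans ha.geo_le)

variable {s : SearchState V} {p : V} {l : List V}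

theorem IsOpenPivot.nodup (hp : IsOpenPivot B k s p l) : (p :: l).Nodup :=
  List.nodup_cons.2 ⟨fun h => B.loopless.irrefl _ (hp.block.mem p h).2, hp.block.nodup⟩

theorem IsOpenPivot.mem_C (hp : IsOpenPivot B k s p l) : ∀ u ∈ p :: l, u ∈ s.C := by
  intro u hu
  rcases List.mem_cons.1 hu with rfl | hu
  · exact hp.mem
  · exact (hp.block.mem u hu).1

theorem IsOpenPivot.relevant (hp : IsOpenPivot B k s p l) : ∀ u ∈ l, Relevant B k s u :=
  fun _ hu => hp.block.relevant (Finset.mem_union_right _ hp.mem) hp.lt_mis hu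

/-- In a thin state `p` has degree at most `k + 1`, so the list exhausts its candidate neighbours.
-/
theorem IsOpenPivot.mem_of_adj (hp : IsOpenPivot B k s p l) (hs : Refined B k s)
    (ht : Thin B k s) {w : V} (hw : w ∈ s.C) (hpw : B.Adj p w) : w ∈ l := by
  have hsub : l.toFinset ⊆ s.C.filter (B.Adj p) := fun u hu =>
    Finset.mem_filter.2 (hp.block.mem u (List.mem_toFinset.1 hu))
  have h1 : mis B s.U p = mis B s.S p + (s.C.filter (B.Adj p)).card := by
    unfold mis SearchState.U
    rw [Finset.filter_union, Finset.card_union_of_disjoint]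
    exact Finset.disjoint_filter_filter hs.disj
  have h2 := ht.le p (Finset.mem_union_right _ hp.mem)
  have h3 := hp.block.len
  have h4 := Finset.eq_of_subset_of_card_le hsub (by
    rw [List.toFinset_card_of_nodup hp.block.nodup]; omega)
  rw [← List.mem_toFinset, h4]
  exact Finset.mem_filter.2 ⟨hw, hpw⟩

/-- The excluded pivot is itself the witness: each of its neighbours other than `u` had degree at
most `k` and has just lost `p`. -/
theorem IsOpenPivot.forced_first (hp : IsOpenPivot B k s p l) (hs : Refined B k s)
    (ht : Thin B k s) {u : V} (hu : u ∈ l) (hothers : ∀ w ∈ l, w ≠ u → ¬ k < mis B s.U w) :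
    Forced B k (childState B k s [] p) u := by
  have hsub := childState_U_subset (B := B) (k := k) (s := s) (pre := []) (v := p) (by simp)
  have hpU := Finset.mem_union_right s.S hp.mem
  refine ⟨p, ?_, (hp.block.mem u hu).2, (mis_mono hsub p).trans (ht.le p hpU),
    fun w hw hwu hpw => ?_⟩
  · have hadd : Addable B k (s.S ∪ ([] : List V).toFinset) p := by simpa using hs.add p hp.mem
    simp only [childState, Finset.mem_filter, Finset.mem_insert]
    exact ⟨.inl trivial, hadd⟩
  · have h1 := mis_lt_mis hsub hpU (notMem_childState_U hs.disj hp.mem (by simp)) hpw.symm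
    have h2 : mis B s.U w ≤ k := by
      rcases Finset.mem_union.1 (hsub hw) with h | h
      · exact hp.kept_le w h
      · exact not_lt.1 (hothers w (hp.mem_of_adj hs ht h hpw) hwu)
    omega

theorem IsOpenPivot.not_lt_first (hp : IsOpenPivot B k s p l) (hs : Refined B k s)
    (ht : Thin B k s) {u : V} (hu : u ∈ l) : ¬ k < mis B (childState B k s [] p).U u := by
  have hsub := childState_U_subset (B := B) (k := k) (s := s) (pre := []) (v := p) (by simp)
  have hpU := Finset.mem_union_right s.S hp.mem
  have h1 := mis_lt_mis hsub hpU (notMem_childState_U hs.disj hp.mem (by simp))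
    (hp.block.mem u hu).2.symm
  have h2 := ht.le u (Finset.mem_union_right _ (hp.block.mem u hu).1)
  omega

/-- The list entries kept after `p` see `p`, and `p` falls to degree at most `k` because its
neighbour `v` is excluded. -/
theorem IsOpenPivot.thin_child (hp : IsOpenPivot B k s p l) (hs : Refined B k s)
    (ht : Thin B k s) {pre : List V} {v : V} {post : List V} (hl : l = pre ++ v :: post) :
    Thin B k (childState B k s (p :: pre) v) := by
  have hmem : ∀ u ∈ p :: pre, u ∈ s.C := fun u hu =>
    hp.mem_C u (by subst hl; simp at hu ⊢; tauto)
  have hv : v ∈ l := by simp [hl]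
  refine ht.child (p := p) hmem fun u hu => ?_
  rcases List.mem_cons.1 hu with rfl | hu
  · right
    have hsub := childState_U_subset (B := B) (k := k) (v := v) hmem
    have hvC := (hp.block.mem v hv).1
    have hnd := hp.nodup
    rw [hl, ← List.cons_append] at hnd
    have h1 := mis_lt_mis hsub (Finset.mem_union_right s.S hvC)
      (notMem_childState_U hs.disj hvC
        fun h => (List.nodup_append.1 hnd).2.2 v h v (by simp) rfl)
      (hp.block.mem v hv).2
    have h2 := ht.le u (Finset.mem_union_right _ hp.mem)
    omega
  · exact .inl ⟨by simp, (hp.block.mem u (by simp [hl, hu])).2.symm⟩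

/-- The pivot has weight `γ` and leaves `C` in every child, so all children share the factor `γ⁻¹`;
`d` is the remaining relative cost of the child that excludes the pivot. -/
theorem IsOpenPivot.combine (hp : IsOpenPivot B k s p l) (ha : Admissible k γ n)
    {P : SearchState V → ℝ → Prop} {d : ℝ} {ρ : V → ℝ}
    (h1 : P (childState B k s [] p) (100 * potential B k γ n s * (γ⁻¹ * d)))
    (h2 : ∀ pre v post, l = pre ++ v :: post → P (childState B k s (p :: pre) v)
      (100 * potential B k γ n s *
        ((p :: pre).map fun u => (weight B k γ n s u)⁻¹).prod * ρ v))
    (h3 : d + branchSum ρ (weight B k γ n s) l ≤ γ) :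
    ∃ xs, List.Forall₂ P (childStates B k s [] (p :: l)) xs ∧
      xs.sum ≤ 100 * potential B k γ n s := by
  have hγ := ha.le_γ
  have hpw := weight_of_lt (γ := γ) (n := n) hp.lt_mis
  obtain ⟨xs, h4, h5⟩ := exists_childStates_bound P s ρ (weight B k γ n s)
    (100 * potential B k γ n s * γ⁻¹) l [p] (by
      intro pre v post hl
      have := h2 pre v post hl
      simpa [hpw, mul_assoc] using this)
  refine ⟨_ :: xs, List.Forall₂.cons h1 h4, ?_⟩
  have hpot := potential_ge_one (B := B) (k := k) ha.le_n ha.n_le s (l := []) (by simp) (by simp)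
  simp only [List.map_nil, List.prod_nil, mul_one] at hpot
  rw [List.sum_cons, h5]
  have h6 : γ⁻¹ * (d + branchSum ρ (weight B k γ n s) l) ≤ 1 := by
    rw [inv_mul_le_iff₀ (by linarith)]; linarith
  have := mul_le_mul_of_nonneg_left h6 (by positivity : 0 ≤ 100 * potential B k γ n s)
  linarith

/-- The children of an open pivot other than the first one, with a bonus for vertices `bonus v`
whose weight drops to `n` when `v` is excluded. -/
theorem IsOpenPivot.child_of_mem (hp : IsOpenPivot B k s p l) (hs : Refined B k s)
    (ht : Thin B k s) {P : SearchState V → ℝ → Prop} (hP : ThinBound B k γ n P)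
    (ha : Admissible k γ n) :
    ∀ pre v post, l = pre ++ v :: post → P (childState B k s (p :: pre) v)
      (100 * potential B k γ n s * ((p :: pre).map fun u => (weight B k γ n s u)⁻¹).prod *
        excludeCost B k s (fun v => (weight B k γ n s v)⁻¹) v) := by
  intro pre v post hl
  have hmem : ∀ u ∈ (p :: pre) ++ [v], u ∈ p :: l := by subst hl; simp; tauto
  refine hP.child ha hs (hp.nodup.sublist (by simp [hl])) (fun u hu => hp.mem_C u (hmem u hu))
    (hp.thin_child hs ht hl) (T := ∅) (α := 1) (by simp) (by simp) (by simp) (by simp)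

theorem IsOpenPivot.first_child (hp : IsOpenPivot B k s p l) (hs : Refined B k s)
    (ht : Thin B k s) {P : SearchState V → ℝ → Prop} (hP : ThinBound B k γ n P)
    (ha : Admissible k γ n) {T : Finset V} (hT : ∀ u ∈ T, u ∈ l) {α : ℝ}
    (hT1 : ∀ u ∈ T, u ∈ (childState B k s [] p).C →
      weight B k γ n (childState B k s [] p) u ≤ α * weight B k γ n s u)
    (hT2 : ∀ u ∈ T, 1 ≤ α * weight B k γ n s u) :
    P (childState B k s [] p) (100 * potential B k γ n s * (γ⁻¹ * α ^ T.card)) := by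
  have hpw := weight_of_lt (γ := γ) (n := n) hp.lt_mis
  refine hP.mono _ _ _ ?_ (hP.thin _ (childState_refined hs.disj _ _)
    (ht.child (p := p) (by simp) (by simp)))
  have h1 := potential_childState_le ha.le_n ha.n_le hs.disj (pre := []) (v := p) (by simp)
    (by simpa using hp.mem) (T := T) (fun u hu => by
      have := hT u hu
      have hne : u ≠ p := by rintro rfl; exact (List.nodup_cons.1 hp.nodup).1 this
      simpa [hne] using (hp.block.mem u this).1) hT1 hT2
  rw [hpw] at h1
  simp only [List.map_nil, List.prod_nil, mul_one] at h1
  linarith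

theorem IsOpenPivot.length_le (hp : IsOpenPivot B k s p l) : l.length ≤ k + 1 := by
  have := hp.block.len; omega

/-- A single neighbour falling from at least `n` to 11/10 in the first child already pays for the
surplus branch. -/
theorem IsOpenPivot.step_of_drop (hp : IsOpenPivot B k s p l) (hs : Refined B k s)
    (ht : Thin B k s) {P : SearchState V → ℝ → Prop} (hP : ThinBound B k γ n P)
    (ha : Admissible k γ n) {u : V} (hu : u ∈ l) (hu1 : n ≤ weight B k γ n s u)
    (hu2 : u ∈ (childState B k s [] p).C →
      weight B k γ n (childState B k s [] p) u ≤ 11 / 10) :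
    ∃ xs, List.Forall₂ P (childStates B k s [] (p :: l)) xs ∧
      xs.sum ≤ 100 * potential B k γ n s := by
  have hn := ha.le_n
  have h1 : 11 / 10 ≤ 11 / 10 * n⁻¹ * weight B k γ n s u := by
    rw [mul_assoc, ← div_eq_inv_mul]
    have := (one_le_div (by linarith)).2 hu1
    linarith
  refine hp.combine ha (hp.first_child hs ht hP ha (T := {u}) (α := 11 / 10 * n⁻¹)
    (by simpa using hu) (by
      intro u' hu' hC
      rw [Finset.mem_singleton.1 hu'] at hC ⊢
      exact (hu2 hC).trans h1) (by
      intro u' hu'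
      rw [Finset.mem_singleton.1 hu']; linarith))
    (hp.child_of_mem hs ht hP ha) ?_
  have hf := ha.force_one
  have h3 := branchSum_excludeCost_le (a := 1) (c := fun v => (weight B k γ n s v)⁻¹) ha hp.length_le hp.relevant
    (by linarith) (by norm_num) (by linarith)
    (fun u hu h => by rw [one_mul]; exact inv_weight_le ha (hp.relevant u hu) h)
  have h4 := geo_mono (q := n⁻¹) (by positivity) hp.length_le
  have h5 := ha.drop
  simp only [Finset.card_singleton, pow_one]
  linarith

/-- 11/100 is the fixed point of `x ↦ 1/100 + (10/11) x`, so the bound does not depend on the length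
of the list. -/
theorem branchSum_le_of_forced (hall : ∀ u ∈ l, ¬ k < mis B s.U u ∧ Forced B k s u) (c : V → ℝ) :
    branchSum (excludeCost B k s c) (weight B k γ n s) l ≤ 11 / 100 := by
  induction l with
  | nil => simp [branchSum]; norm_num
  | cons v l ih =>
    have h := hall v (by simp)
    have ih := ih fun u hu => hall u (by simp [hu])
    simp only [branchSum, weight_of_forced h.1 h.2]
    simp only [excludeCost, h, not_false_eq_true, and_self, if_true]
    linarith

/-- Excluding the pivot lowers the degrees of its neighbours, so `a` and `b` fall from weight `γ` to
at most `n`. In a child that excludes a light unforced `v`, the vertex `w` of `hbonus` falls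
likewise, which improves the cost `n⁻¹` to `γ⁻¹`, the cost of a `v` of degree above `k`. -/
theorem IsOpenPivot.step_of_many (hp : IsOpenPivot B k s p l) (hs : Refined B k s)
    (ht : Thin B k s) {P : SearchState V → ℝ → Prop} (hP : ThinBound B k γ n P)
    (ha : Admissible k γ n) (hB : ∀ a b c, B.Adj a b → B.Adj b c → ¬ B.Adj a c)
    {a b : V} (hal : a ∈ l) (hbl : b ∈ l) (hab : a ≠ b) (hka : k < mis B s.U a)
    (hkb : k < mis B s.U b)
    (hbonus : ∀ u ∈ l, ¬ k < mis B s.U u → ¬ Forced B k s u →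
      ∃ w ∈ s.U, w ≠ p ∧ k < mis B s.U w ∧ B.Adj u w) :
    ∃ xs, List.Forall₂ P (childStates B k s [] (p :: l)) xs ∧
      xs.sum ≤ 100 * potential B k γ n s := by
  have hn := ha.le_n
  have hγ := ha.le_γ
  have hnγ := ha.n_le
  have hγ0 : (0 : ℝ) < γ := by linarith
  have hnn : n / γ * γ = n := div_mul_cancel₀ _ hγ0.ne'
  refine hp.combine ha (d := (n / γ) ^ 2) (ρ := excludeCost B k s fun _ => γ⁻¹) ?_ ?_ ?_
  · have hab2 : ({a, b} : Finset V).card = 2 := Finset.card_pair hab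
    rw [← hab2]
    have hT : ∀ u ∈ ({a, b} : Finset V), u ∈ l ∧ k < mis B s.U u := by
      intro u hu
      rcases Finset.mem_insert.1 hu with rfl | hu
      · exact ⟨hal, hka⟩
      · rw [Finset.mem_singleton.1 hu]; exact ⟨hbl, hkb⟩
    refine hp.first_child hs ht hP ha (fun u hu => (hT u hu).1) (fun u hu _ => ?_)
      (fun u hu => ?_)
    · rw [weight_of_lt (hT u hu).2, hnn]
      exact weight_le_of_not_lt hn (hp.not_lt_first hs ht (hT u hu).1)
    · rw [weight_of_lt (hT u hu).2, hnn]; linarith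
  · intro pre v post hl
    have hmem : ∀ u ∈ (p :: pre) ++ [v], u ∈ p :: l := by subst hl; simp; tauto
    have hnd : ((p :: pre) ++ [v]).Nodup := hp.nodup.sublist (by simp [hl])
    have hmemC : ∀ u ∈ (p :: pre) ++ [v], u ∈ s.C := fun u hu => hp.mem_C u (hmem u hu)
    have hv : v ∈ l := by simp [hl]
    have hthin := hp.thin_child hs ht hl
    by_cases h1 : ¬ k < mis B s.U v ∧ ¬ Forced B k s v
    · obtain ⟨w, hwU, hwp, hw, hvw⟩ := hbonus v hv h1.1 h1.2
      have hwC : w ∈ s.C := by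
        rcases Finset.mem_union.1 hwU with h | h
        · exact absurd (hp.kept_le w h) (by omega)
        · exact h
      -- Otherwise `p`, `v`, `w` would form a triangle; so `w` is not among the vertices whose
      -- weights are divided out.
      have hwl : w ∉ l := fun h => hB _ _ _ (hp.block.mem v hv).2 hvw (hp.block.mem w h).2
      have hwn : w ∉ (p :: pre) ++ [v] := fun h => by
        rcases List.mem_cons.1 (hmem w h) with h | h
        · exact hwp h
        · exact hwl h
      refine hP.child ha hs hnd hmemC hthin (T := {w}) (α := n / γ) ?_ ?_ ?_ ?_
      · intro u hu
        rw [Finset.mem_singleton.1 hu]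
        exact Finset.mem_sdiff.2 ⟨hwC, fun h => hwn (List.mem_toFinset.1 h)⟩
      · intro _ u hu _
        rw [Finset.mem_singleton.1 hu, weight_of_lt hw, hnn]
        refine weight_le_of_not_lt hn ?_
        have hpre : ∀ u ∈ p :: pre, u ∈ s.C := fun u hu => hmemC u (by simp at hu ⊢; tauto)
        have h2 := mis_lt_mis (childState_U_subset (B := B) (k := k) (v := v) hpre)
          (Finset.mem_union_right s.S (hp.block.mem v hv).1)
          (notMem_childState_U hs.disj (hp.block.mem v hv).1
            fun h => (List.nodup_append.1 hnd).2.2 v h v (by simp) rfl) hvw.symm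
        have h3 := ht.le w hwU
        omega
      · intro u hu
        rw [Finset.mem_singleton.1 hu, weight_of_lt hw, hnn]; linarith
      · intro _
        rw [weight_of_relevant h1.1 (hp.relevant v hv) h1.2, Finset.card_singleton, pow_one]
        have : n ≠ 0 := by linarith
        exact le_of_eq (by field_simp)
    · refine hP.child ha hs hnd hmemC hthin (T := ∅) (α := 1) (by simp) (by simp) (by simp)
        fun h => ?_
      rw [weight_of_lt (by tauto)]; simp
  -- The exclusion cost `γ⁻¹` is the ordinary cost `n⁻¹` scaled by `n / γ`, whence the choice of `a`
  -- below.
  · have hc : n / γ * n⁻¹ = γ⁻¹ := by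
      have : n ≠ 0 := by linarith
      field_simp
    have hγ2 : (1 : ℝ) / 2 ≤ γ⁻¹ := by
      rw [one_div]; exact inv_anti₀ hγ0 ha.γ_le
    have h3 := branchSum_excludeCost_le (a := n / γ) (c := fun _ => γ⁻¹) ha hp.length_le
      hp.relevant (by rw [hc]; linarith) (by positivity) (by
        have := mul_le_mul_of_nonneg_left ha.force (by positivity : 0 ≤ n / γ)
        refine le_trans (le_of_eq ?_) this
        have : n ≠ 0 := by linarith
        field_simp)
      (fun u _ _ => hc.ge)
    have h4 := mul_le_mul_of_nonneg_left (geo_mono (q := n⁻¹) (by positivity) hp.length_le)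
      (by positivity : 0 ≤ n / γ)
    have h5 := ha.many
    linarith

/-- A light unforced neighbour whose only neighbour of degree above `k` is the pivot becomes
irrelevant when the pivot is excluded. Otherwise, if at most one neighbour of the pivot has degree
above `k`, some neighbour becomes forced in that child, unless all entries are light and forced
already and their branches are almost free. With two neighbours of degree above `k`, the gains are
spread over the children. -/
theorem thin_step_open (hp : IsOpenPivot B k s p l) (hs : Refined B k s)
    (ht : Thin B k s) {P : SearchState V → ℝ → Prop} (hP : ThinBound B k γ n P)
    (ha : Admissible k γ n) (hB : ∀ a b c, B.Adj a b → B.Adj b c → ¬ B.Adj a c) :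
    ∃ xs, List.Forall₂ P (childStates B k s [] (p :: l)) xs ∧
      xs.sum ≤ 100 * potential B k γ n s := by
  have hn := ha.le_n
  by_cases h1 : ∀ u ∈ l, ¬ k < mis B s.U u → ¬ Forced B k s u →
      ∃ w ∈ s.U, w ≠ p ∧ k < mis B s.U w ∧ B.Adj u w
  · by_cases h2 : ∃ a ∈ l, k < mis B s.U a
    · obtain ⟨a, hal, hka⟩ := h2
      by_cases h3 : ∃ b ∈ l, b ≠ a ∧ k < mis B s.U b
      · obtain ⟨b, hbl, hab, hkb⟩ := h3
        exact hp.step_of_many hs ht hP ha hB hal hbl hab.symm hka hkb h1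
      · push Not at h3
        refine hp.step_of_drop hs ht hP ha hal (by rw [weight_of_lt hka]; exact ha.n_le)
          fun _ => ?_
        rw [weight_of_forced (hp.not_lt_first hs ht hal)
          (hp.forced_first hs ht hal fun w hw hwa => not_lt.2 (h3 w hw hwa))]
    · push Not at h2
      by_cases h3 : ∃ u ∈ l, ¬ Forced B k s u
      · obtain ⟨u, hul, hu⟩ := h3
        have hu' := not_lt.2 (h2 u hul)
        refine hp.step_of_drop hs ht hP ha hul
          (by rw [weight_of_relevant hu' (hp.relevant u hul) hu]) fun _ => ?_
        rw [weight_of_forced (hp.not_lt_first hs ht hul)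
          (hp.forced_first hs ht hul fun w hw _ => not_lt.2 (h2 w hw))]
      · push Not at h3
        refine hp.combine ha (hp.first_child hs ht hP ha (T := ∅) (α := 1) (by simp) (by simp)
          (by simp)) (hp.child_of_mem hs ht hP ha) ?_
        have h4 := branchSum_le_of_forced (γ := γ) (n := n) (s := s) (l := l)
          (fun u hu => ⟨not_lt.2 (h2 u hu), h3 u hu⟩) fun v => (weight B k γ n s v)⁻¹
        have := ha.le_γ
        simp only [one_pow]
        linarith
  · push Not at h1
    obtain ⟨u, hul, hu1, hu2, hu3⟩ := h1
    refine hp.step_of_drop hs ht hP ha hul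
      (by rw [weight_of_relevant (not_lt.2 hu1) (hp.relevant u hul) hu2]) fun _ => ?_
    rw [weight_of_not_relevant (hp.not_lt_first hs ht hul)]
    rintro ⟨w, hwU, hw, huw⟩
    have hsub := childState_U_subset (B := B) (k := k) (s := s) (pre := []) (v := p) (by simp)
    refine hu3 w (hsub hwU) ?_ (hw.trans_le (mis_mono hsub w)) huw
    rintro rfl
    exact notMem_childState_U hs.disj hp.mem (by simp) hwU

end ThinSteps

/-! ### The root `γ_k` and the choice of `n` -/

section GammaAnalysis

theorem gammaPoly_pos {k : ℕ} {x : ℝ} (hx : 2 ≤ x) :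
    0 < x ^ (k + 4) - 2 * x ^ (k + 3) + x ^ 2 - x + 1 := by
  have h : 0 ≤ x ^ (k + 3) * (x - 2) := mul_nonneg (by positivity) (by linarith)
  have h2 : x ^ (k + 4) = x ^ (k + 3) * x := pow_succ _ _
  nlinarith

theorem isGreatest_gammaK (k : ℕ) : IsGreatest (gammaRoots k) (gammaK k) := by
  have hb : BddAbove (gammaRoots k) := by
    refine ⟨2, fun x hx => ?_⟩
    by_contra h
    exact (gammaPoly_pos (k := k) (not_le.1 h).le).ne' hx.2
  refine ⟨IsClosed.csSup_mem ?_ ⟨1, ?_⟩ hb, fun x hx => le_csSup hb hx⟩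
  -- Since 0 is not a root, `0 < x` may be relaxed to `0 ≤ x`, which exhibits the set as closed.
  · have : gammaRoots k = Set.Ici 0 ∩
        (fun x : ℝ => x ^ (k + 4) - 2 * x ^ (k + 3) + x ^ 2 - x + 1) ⁻¹' {0} := by
      ext x
      simp only [gammaRoots, Set.mem_ofPred_eq, Set.mem_inter_iff, Set.mem_Ici, Set.mem_preimage,
        Set.mem_singleton_iff]
      refine ⟨fun h => ⟨h.1.le, h.2⟩, fun h => ⟨lt_of_le_of_ne h.1 ?_, h.2⟩⟩
      rintro rfl
      simp at h
    rw [this]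
    exact isClosed_Ici.inter (isClosed_singleton.preimage (by fun_prop))
  · constructor <;> norm_num

theorem gammaK_eq (k : ℕ) :
    gammaK k ^ (k + 4) - 2 * gammaK k ^ (k + 3) + gammaK k ^ 2 - gammaK k + 1 = 0 :=
  (isGreatest_gammaK k).1.2

theorem gammaK_lt_two (k : ℕ) : gammaK k < 2 := by
  by_contra h
  exact (gammaPoly_pos (k := k) (not_lt.1 h)).ne' (gammaK_eq k)

/-- The polynomial is positive at 2, so it has a root between `x` and 2. -/
theorem le_gammaK {k : ℕ} {x : ℝ} (hx0 : 0 < x) (hx2 : x ≤ 2)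
    (hx : x ^ (k + 4) - 2 * x ^ (k + 3) + x ^ 2 - x + 1 ≤ 0) : x ≤ gammaK k := by
  have hc : ContinuousOn (fun x : ℝ => x ^ (k + 4) - 2 * x ^ (k + 3) + x ^ 2 - x + 1)
      (Set.Icc x 2) := by fun_prop
  obtain ⟨y, hy, hy0⟩ := intermediate_value_Icc hx2 hc
    (show (0 : ℝ) ∈ Set.Icc _ _ from ⟨hx, (gammaPoly_pos le_rfl).le⟩)
  exact hy.1.trans ((isGreatest_gammaK k).2 ⟨hx0.trans_le hy.1, hy0⟩)

/-- Meant for points `a` at which the expansion in `t` has only positive coefficients. -/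
theorem gammaK_lt {k : ℕ} {a : ℝ}
    (h : ∀ t : ℝ, 0 ≤ t → 0 < (a + t) ^ (k + 4) - 2 * (a + t) ^ (k + 3) + (a + t) ^ 2 -
      (a + t) + 1) : gammaK k < a := by
  by_contra hlt
  have := h (gammaK k - a) (by linarith)
  simp only [add_sub_cancel] at this
  exact this.ne' (gammaK_eq k)

theorem gammaK_one_mem : gammaK 1 ∈ Set.Ico (1.754 : ℝ) 1.755 := by
  refine ⟨le_gammaK (by norm_num) (by norm_num) (by norm_num), gammaK_lt fun t ht => ?_⟩
  norm_num
  ring_nf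
  positivity

theorem gammaK_two_mem : gammaK 2 ∈ Set.Ico (1.888 : ℝ) 1.889 := by
  refine ⟨le_gammaK (by norm_num) (by norm_num) (by norm_num), gammaK_lt fun t ht => ?_⟩
  norm_num
  ring_nf
  positivity

theorem gammaK_three_mem : gammaK 3 ∈ Set.Ico (1.947 : ℝ) 1.948 := by
  refine ⟨le_gammaK (by norm_num) (by norm_num) (by norm_num), gammaK_lt fun t ht => ?_⟩
  norm_num
  ring_nf
  positivity

theorem le_gammaK_of_three_le {k : ℕ} (hk : 3 ≤ k) : 1.947 ≤ gammaK k := by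
  refine le_gammaK (by norm_num) (by norm_num) ?_
  -- With `x = 1.947` the claim is `x ^ 2 - x + 1 ≤ (2 - x) x ^ (k + 3)`; the left side is below
  -- 2.844, the right side at least `0.053 * 54 = 2.862`.
  have h1 : (1.947 : ℝ) ^ 6 ≤ 1.947 ^ (k + 3) := pow_le_pow_right₀ (by norm_num) (by omega)
  have h2 : (1.947 : ℝ) ^ (k + 4) = 1.947 ^ (k + 3) * 1.947 := pow_succ _ _
  have h3 : (54 : ℝ) ≤ 1.947 ^ 6 := by norm_num
  rw [h2]
  nlinarith

theorem le_gammaK_of_one_le {k : ℕ} (hk : 1 ≤ k) : 1.754 ≤ gammaK k := by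
  obtain rfl | rfl | h : k = 1 ∨ k = 2 ∨ 3 ≤ k := by omega
  · exact gammaK_one_mem.1
  · linarith [gammaK_two_mem.1]
  · linarith [le_gammaK_of_three_le h]

/-- Multiplied by `(1 - γ⁻¹) γ ^ (k + 4)` this becomes the defining equation of `γ_k`. -/
theorem geo_gammaK {k : ℕ} (hk : 1 ≤ k) :
    geo (gammaK k)⁻¹ (k + 1) + (gammaK k)⁻¹ ^ (k + 3) = 1 := by
  have hγ := le_gammaK_of_one_le hk
  have h0 : gammaK k ≠ 0 := by linarith
  have h1 : 1 - (gammaK k)⁻¹ ≠ 0 := by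
    have : (gammaK k)⁻¹ < 1 := inv_lt_one_of_one_lt₀ (by linarith)
    linarith
  refine mul_left_cancel₀ h1 ?_
  rw [mul_add, one_sub_mul_geo]
  have h := gammaK_eq k
  have e : ∀ m, gammaK k ^ m * (gammaK k)⁻¹ ^ m = 1 := fun m => by
    rw [← mul_pow, mul_inv_cancel₀ h0, one_pow]
  generalize (gammaK k)⁻¹ = i at *
  linear_combination (-i ^ (k + 4)) * h + e (k + 4) - 2 * i * e (k + 3) + i ^ (k + 2) * e 2 -
    i ^ (k + 3) * e 1

theorem geo_mono_left {q r : ℝ} (hq : 0 ≤ q) (hqr : q ≤ r) (m : ℕ) : geo q m ≤ geo r m := by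
  induction m with
  | zero => simp [geo]
  | succ m ih =>
    have := geo_nonneg hq m
    exact mul_le_mul hqr (by linarith) (by linarith) (hq.trans hqr)

theorem exists_geo_eq_one {k : ℕ} (hk : 1 ≤ k) : ∃ q : ℝ, 0 < q ∧ geo q k = 1 := by
  have hc : ∀ m, Continuous fun q : ℝ => geo q m := by
    intro m
    induction m with
    | zero => exact continuous_const
    | succ m ih => exact continuous_id.mul (continuous_const.add ih)
  have h0 : ∀ m, geo 0 m = 0 := by intro m; cases m <;> simp [geo]
  have h1 : ∀ m : ℕ, geo 1 m = m := by
    intro m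
    induction m with
    | zero => simp [geo]
    | succ m ih => simp [geo, ih, add_comm]
  obtain ⟨q, hq, hq1⟩ := intermediate_value_Icc (zero_le_one (α := ℝ)) (hc k).continuousOn
    (show (1 : ℝ) ∈ Set.Icc _ _ from ⟨by rw [h0]; norm_num, by rw [h1]; exact_mod_cast hk⟩)
  refine ⟨q, lt_of_le_of_ne hq.1 ?_, hq1⟩
  rintro rfl
  exact zero_ne_one ((h0 k).symm.trans hq1)

/-- Take `n = q⁻¹` with `geo q k = 1`: then `geo_le` is an equality and `geo q (k + 1) = 2 * q`. The
delicate condition is `many`, which becomes `n ^ 2 + 2 * γ ≤ γ ^ 3`; it holds because `n` lies below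
2 by at least 2.55 times as much as `γ` does. -/
theorem exists_admissible_of_three_le {k : ℕ} (hk : 3 ≤ k) :
    ∃ n, Admissible k (gammaK k) n := by
  obtain ⟨q, hq0, hq⟩ := exists_geo_eq_one (k := k) (by omega)
  have hγ := le_gammaK_of_three_le hk
  have hγ2 := gammaK_lt_two k
  have hgeo := geo_gammaK (k := k) (by omega)
  have heq := gammaK_eq k
  set γ := gammaK k with hγdef
  have hγ0 : 0 < γ := by linarith
  have h2q : 2 * q = 1 + q ^ (k + 1) := by
    have := one_sub_mul_geo q k
    rw [hq] at this; linarith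
  have hq2 : 1 / 2 < q := by
    have : 0 < q ^ (k + 1) := by positivity
    linarith
  have hq6 : q ≤ 0.6 := by
    have h3 := geo_mono hq0.le hk
    rw [hq] at h3
    simp only [geo] at h3
    by_contra h
    push Not at h
    nlinarith [mul_pos hq0 hq0, mul_pos (mul_pos hq0 hq0) hq0]
  have hqγ : γ⁻¹ ≤ q := by
    by_contra h
    push Not at h
    have h1 := geo_mono_left hq0.le h.le k
    have h2 : geo γ⁻¹ k ≤ geo γ⁻¹ (k + 1) := geo_mono (by positivity) (Nat.le_succ k)
    have h3 : 0 < γ⁻¹ ^ (k + 3) := by positivity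
    linarith
  have hn : q⁻¹ = 2 - q ^ k := by
    have : q * (2 - q ^ k) = 1 := by rw [mul_sub, ← pow_succ']; linarith
    rw [inv_eq_of_mul_eq_one_right this]
  have hg : γ⁻¹ ^ k ≤ q ^ k := pow_le_pow_left₀ (by positivity) hqγ k
  -- The equation for `γ` reads `(2 - γ) γ ^ (k + 3) = γ ^ 2 - γ + 1`, and `2.55 (γ ^ 2 - γ + 1) ≤ γ
  -- ^ 3` for `γ` between 1.947 and 2.
  have hδ : 2.55 * (2 - γ) ≤ γ⁻¹ ^ k := by
    rw [inv_pow, ← one_div, le_div_iff₀ (by positivity)]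
    have e : γ ^ k * ((2 - γ) * γ ^ 3) = γ ^ 2 - γ + 1 := by
      linear_combination (-1 : ℝ) * heq
    have e1 : 2.55 * (γ ^ 2 - γ + 1) ≤ γ ^ 3 := by nlinarith
    have e2 : 0 < γ ^ 3 := by positivity
    refine le_of_mul_le_mul_right ?_ e2
    linear_combination 2.55 * e + e1
  have hninv : q⁻¹ ≤ 2 - 2.55 * (2 - γ) := by linarith
  have hgeo1 : geo q (k + 1) = 2 * q := by rw [geo_succ', hq, h2q]
  refine ⟨q⁻¹, ?_⟩
  constructor
  · rw [le_inv_comm₀ (by norm_num) hq0]; norm_num; linarith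
  · exact inv_le_of_inv_le₀ hγ0 hqγ
  · linarith
  · exact hγ2.le
  · rw [inv_inv, hq]
  · rw [inv_inv, hgeo1]
    have hq' : 0 < q⁻¹ := by positivity
    have e1 : q⁻¹ ^ 2 ≤ (2 - 2.55 * (2 - γ)) ^ 2 := pow_le_pow_left₀ hq'.le hninv 2
    -- With `δ = 2 - γ ≤ 0.053`, the right side minus the left is `δ (0.2 - 0.5025 δ - δ ^ 2)`.
    have e2 : (2 - 2.55 * (2 - γ)) ^ 2 + 2 * γ ≤ γ ^ 3 := by
      have e4 : 0 ≤ 0.2 - 0.5025 * (2 - γ) - (2 - γ) ^ 2 := by nlinarith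
      have e5 := mul_nonneg (sub_nonneg.2 hγ2.le) e4
      linear_combination e5
    have e3 : (q⁻¹ / γ) ^ 2 + q⁻¹ / γ * (2 * q) = (q⁻¹ ^ 2 + 2 * γ) / γ ^ 2 := by
      field_simp
    rw [e3, div_le_iff₀ (by positivity)]
    linarith
  · rw [inv_inv, hgeo1]; linarith
  · rw [inv_inv, div_inv_eq_mul]
    nlinarith

/-- The general choice of `n` fails for small `k`: it would be 1 for `k = 1`, less than 11/10, and
the golden ratio for `k = 2`, which violates `drop`. Numerical values replace it there. -/
theorem exists_admissible {k : ℕ} (hk : 1 ≤ k) : ∃ n, Admissible k (gammaK k) n := by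
  obtain rfl | rfl | h : k = 1 ∨ k = 2 ∨ 3 ≤ k := by omega
  · have hγ := gammaK_one_mem.1
    have hγ2 := gammaK_lt_two 1
    set γ := gammaK 1
    refine ⟨1.58, by norm_num, by linarith, by linarith, hγ2.le, ?_, ?_, ?_, ?_⟩
    · norm_num [geo]
    · have hγ0 : 0 < γ := by linarith
      have e : (1.58 / γ) ^ 2 + 1.58 / γ * geo 1.58⁻¹ (1 + 1) =
          (1.58 ^ 2 + γ * (1.58 * geo 1.58⁻¹ (1 + 1))) / γ ^ 2 := by
        field_simp
      rw [e, div_le_iff₀ (by positivity)]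
      norm_num [geo]
      nlinarith [mul_pos hγ0 hγ0]
    · norm_num [geo]; linarith
    · norm_num; linarith
  · have hγ := gammaK_two_mem.1
    have hγ2 := gammaK_lt_two 2
    set γ := gammaK 2
    refine ⟨1.75, by norm_num, by linarith, by linarith, hγ2.le, ?_, ?_, ?_, ?_⟩
    · norm_num [geo]
    · have hγ0 : 0 < γ := by linarith
      have e : (1.75 / γ) ^ 2 + 1.75 / γ * geo 1.75⁻¹ (2 + 1) =
          (1.75 ^ 2 + γ * (1.75 * geo 1.75⁻¹ (2 + 1))) / γ ^ 2 := by
        field_simp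
      rw [e, div_le_iff₀ (by positivity)]
      norm_num [geo]
      nlinarith [mul_pos hγ0 hγ0]
    · norm_num [geo]; linarith
    · norm_num; linarith
  · exact exists_admissible_of_three_le h

end GammaAnalysis

/-! ### Values of timed programs and of folds -/

namespace Timed

theorem bind_val {α β : Type} (x : Timed α) (f : α → Timed β) :
    (x >>= f).val = (f x.val).val := rfl

theorem bind_steps {α β : Type} (x : Timed α) (f : α → Timed β) :
    (x >>= f).steps = x.steps + (f x.val).steps := rfl

theorem op_val {α : Type} (a : α) : (op a).val = a := rfl

theorem op_steps {α : Type} (a : α) : (op a).steps = 1 := rfl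

theorem loop_val {α β : Type} (body : β → α → Timed β) (acc : β) (l : List α) :
    (loop body acc l).val = l.foldl (fun b a => (body b a).val) acc := by
  induction l generalizing acc with
  | nil => rfl
  | cons a l ih => exact ih _

theorem loop_steps_cons {α β : Type} (body : β → α → Timed β) (acc : β) (a : α) (l : List α) :
    (loop body acc (a :: l)).steps =
      1 + ((body acc a).steps + (loop body (body acc a).val l).steps) := rfl

end Timed

section Folds

variable {V : Type} [DecidableEq V]

theorem foldl_count (P : V → Bool) (l : List V) (c : ℕ) :
    l.foldl (fun c v => if P v then c + 1 else c) c = c + l.countP P := by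
  induction l generalizing c with
  | nil => simp
  | cons v l ih =>
    rw [List.foldl_cons, ih, List.countP_cons]
    split_ifs <;> omega

theorem foldl_const {α β : Type} (b : β) (l : List α) : l.foldl (fun b _ => b) b = b := by
  induction l with
  | nil => rfl
  | cons v l ih => exact ih

theorem foldl_update {α : Type} (g : V → α) (l : List V) (f : V → α) :
    l.foldl (fun f v => Function.update f v (g v)) f = fun v => if v ∈ l then g v else f v := by
  induction l generalizing f with
  | nil => simp
  | cons u l ih =>
    rw [List.foldl_cons, ih]
    funext v
    by_cases h : v ∈ l
    · simp [h]
    · by_cases h' : v = u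
      · subst h'; simp
      · simp [h, h']

theorem foldl_and (P : V → Bool) (l : List V) (b : Bool) :
    l.foldl (fun b v => b && P v) b = (b && l.all P) := by
  induction l generalizing b with
  | nil => simp
  | cons v l ih => rw [List.foldl_cons, ih]; simp [Bool.and_assoc]

theorem foldl_or (P : V → Bool) (l : List V) (b : Bool) :
    l.foldl (fun b v => b || P v) b = (b || l.any P) := by
  induction l generalizing b with
  | nil => simp
  | cons v l ih => rw [List.foldl_cons, ih]; simp [Bool.or_assoc]

theorem foldl_cons_filter (P : V → Bool) (l r : List V) :
    l.foldl (fun r u => if P u then u :: r else r) r = (l.filter P).reverse ++ r := by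
  induction l generalizing r with
  | nil => simp
  | cons v l ih =>
    rw [List.foldl_cons, ih, List.filter_cons]
    split_ifs <;> simp

theorem foldl_sum (P : V → Bool) (d : V → ℕ) (l : List V) (e : ℕ) :
    l.foldl (fun e v => if P v then e + d v else e) e =
      e + (l.map fun v => if P v then d v else 0).sum := by
  induction l generalizing e with
  | nil => simp
  | cons v l ih =>
    rw [List.foldl_cons, ih, List.map_cons, List.sum_cons]
    split_ifs <;> omega

end Folds

/-! ### What the subroutines compute -/

section Values

variable {V : Type} [Fintype V] [DecidableEq V]

/-- The vertices stored in a bit array. -/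
def vertexSet (A : V → Bool) : Finset V := Finset.univ.filter fun v => A v = true

theorem mem_vertexSet {A : V → Bool} {v : V} : v ∈ vertexSet A ↔ A v = true := by
  simp [vertexSet]

/-- The state stored in a branch. -/
def Branch.state (b : Branch V) : SearchState V where
  S := vertexSet b.S
  C := vertexSet b.C
  D := vertexSet b.D

theorem vertexSet_SC (b : Branch V) : vertexSet b.SC = b.state.U := by
  ext v; simp [mem_vertexSet, Branch.SC, SearchState.U, Branch.state]

/-- The input encodes the graph `G`, and its edges join different sides. -/
structure Input.Models (I : Input V) (G : SimpleGraph V) : Prop where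
  verts_nodup : I.verts.Nodup
  mem_verts : ∀ v, v ∈ I.verts
  adj_nodup : ∀ v, (I.adj v).Nodup
  mem_adj : ∀ v u, u ∈ I.adj v ↔ G.Adj v u
  left_ne : ∀ v u, G.Adj v u → I.left v ≠ I.left u

/-- The bipartite complement. -/
def coGraph (I : Input V) (G : SimpleGraph V) : SimpleGraph V where
  Adj v u := I.left v ≠ I.left u ∧ ¬ G.Adj v u
  symm := ⟨fun _ _ h => ⟨h.1.symm, fun h' => h.2 h'.symm⟩⟩
  loopless := ⟨fun _ h => h.1 rfl⟩

instance (I : Input V) (G : SimpleGraph V) [DecidableRel G.Adj] :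
    DecidableRel (coGraph I G).Adj :=
  fun v u => inferInstanceAs (Decidable (I.left v ≠ I.left u ∧ ¬ G.Adj v u))

variable {I : Input V} {G : SimpleGraph V} [DecidableRel G.Adj] (hI : I.Models G)

theorem coGraph_adj {v u : V} :
    (coGraph I G).Adj v u ↔ I.left v ≠ I.left u ∧ ¬ G.Adj v u := Iff.rfl

theorem coGraph_triangle_free (a b c : V) (hab : (coGraph I G).Adj a b)
    (hbc : (coGraph I G).Adj b c) : ¬ (coGraph I G).Adj a c := by
  intro hac
  have h1 := hab.1
  have h2 := hbc.1
  have h3 := hac.1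
  revert h1 h2 h3
  cases I.left a <;> cases I.left b <;> cases I.left c <;> simp

include hI in
theorem verts_toFinset : I.verts.toFinset = Finset.univ := by
  ext v; simp [hI.mem_verts v]

include hI in
theorem countVerts_val (P : V → Bool) : (countVerts I P).val = (vertexSet P).card := by
  rw [countVerts, Timed.loop_val]
  simp only [Timed.op_val, foldl_count, zero_add, List.countP_eq_length_filter]
  rw [← List.toFinset_card_of_nodup (hI.verts_nodup.filter _)]
  congr 1
  ext v; simp [hI.mem_verts v, mem_vertexSet]

include hI in
theorem countNbrs_val (P : V → Bool) (v : V) :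
    (countNbrs I P v).val = ((vertexSet P).filter (G.Adj v)).card := by
  rw [countNbrs, Timed.loop_val]
  simp only [Timed.op_val, foldl_count, zero_add, List.countP_eq_length_filter]
  rw [← List.toFinset_card_of_nodup ((hI.adj_nodup v).filter _)]
  congr 1
  ext u; simp [hI.mem_adj, mem_vertexSet, and_comm]

theorem newArray_val {α : Type} (l : List V) (a : α) : (newArray l a).val = fun _ => a := by
  rw [newArray, Timed.loop_val]; exact foldl_const _ _

include hI in
theorem degrees_val (A : V → Bool) (v : V) :
    (degrees I A).val v = ((vertexSet A).filter (G.Adj v)).card := by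
  simp only [degrees, Timed.bind_val, Timed.loop_val, Timed.op_val]
  rw [foldl_update]
  simp [hI.mem_verts v, countNbrs_val hI]

include hI in
theorem card_nbrs_add_mis (A : Finset V) (v : V) :
    (A.filter (G.Adj v)).card + mis (coGraph I G) A v =
      (A.filter fun u => I.left v ≠ I.left u).card := by
  rw [mis, ← Finset.card_union_of_disjoint]
  · congr 1
    ext u
    simp only [Finset.mem_union, Finset.mem_filter, coGraph_adj]
    have := hI.left_ne v u
    tauto
  · rw [Finset.disjoint_left]
    intro u h1 h2
    exact (Finset.mem_filter.1 h2).2.2 (Finset.mem_filter.1 h1).2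

include hI in
theorem missing_val (A : V → Bool) :
    (missing I A (degrees I A).val).val = mis (coGraph I G) (vertexSet A) := by
  simp only [missing, Timed.bind_val, Timed.loop_val, Timed.op_val]
  rw [foldl_update]
  funext v
  simp only [hI.mem_verts v, if_true, countVerts_val hI, degrees_val hI]
  have h := card_nbrs_add_mis hI (vertexSet A) v
  have h1 : (if I.left v = true then (vertexSet fun v => A v && !I.left v).card
      else (vertexSet fun v => A v && I.left v).card) =
      ((vertexSet A).filter fun u => I.left v ≠ I.left u).card := by
    split_ifs with hv
    · congr 1; ext u; simp [mem_vertexSet, hv]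
    · congr 1; ext u; simp [mem_vertexSet, hv]
  rw [h1]; omega

include hI in
theorem testBiplex_val (A : V → Bool) (miss : V → ℕ) :
    (testBiplex I A miss).val = true ↔ ∀ v ∈ vertexSet A, miss v ≤ I.k := by
  simp only [testBiplex, Timed.loop_val, Timed.op_val, foldl_and, Bool.true_and, List.all_eq_true,
    hI.mem_verts, mem_vertexSet, true_implies, Bool.or_eq_true, Bool.not_eq_true',
    decide_eq_true_eq]
  refine forall_congr' fun v => ?_
  cases A v <;> simp

include hI in
theorem countEdges_val (A : V → Bool) :
    (countEdges I A (degrees I A).val).val =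
      ∑ v ∈ (vertexSet A).filter (fun v => I.left v = true),
        ((vertexSet A).filter (G.Adj v)).card := by
  simp only [countEdges, Timed.loop_val, Timed.op_val, foldl_sum, zero_add]
  rw [← List.sum_toFinset _ hI.verts_nodup, verts_toFinset hI, ← Finset.sum_filter]
  refine Finset.sum_congr ?_ fun v _ => degrees_val hI A v
  ext v; simp [mem_vertexSet]

/-- `v` is adjacent to all vertices of `Q` on the other side iff the counts agree. -/
theorem card_nbrs_eq_iff (hI : I.Models G) (Q : V → Bool) (v : V) :
    ((vertexSet Q).filter (G.Adj v)).card =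
      (if I.left v = true then (vertexSet fun w => Q w && !I.left w).card
        else (vertexSet fun w => Q w && I.left w).card) ↔
    ∀ w ∈ vertexSet Q, ¬ (coGraph I G).Adj v w := by
  have h := card_nbrs_add_mis hI (vertexSet Q) v
  have h1 : (if I.left v = true then (vertexSet fun v => Q v && !I.left v).card
      else (vertexSet fun v => Q v && I.left v).card) =
      ((vertexSet Q).filter fun u => I.left v ≠ I.left u).card := by
    split_ifs with hv
    · congr 1; ext u; simp [mem_vertexSet, hv]
    · congr 1; ext u; simp [mem_vertexSet, hv]
  rw [h1, ← h, left_eq_add, mis, Finset.card_eq_zero, Finset.filter_eq_empty_iff]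

/-- The program tests addability by comparing two counts: the full vertices adjacent to `v` in `G`,
and all full vertices on the other side. -/
theorem keep_iff (hI : I.Models G) (A : V → Bool) (v : V) :
    (mis (coGraph I G) (vertexSet A) v ≤ I.k ∧
      (countNbrs I (fun w => A w && decide (I.k ≤ mis (coGraph I G) (vertexSet A) w)) v).val =
        if I.left v = true then
          (countVerts I fun w => A w && !I.left w &&
            decide (I.k ≤ mis (coGraph I G) (vertexSet A) w)).val
        else (countVerts I fun w => A w && I.left w &&
          decide (I.k ≤ mis (coGraph I G) (vertexSet A) w)).val) ↔
    Addable (coGraph I G) I.k (vertexSet A) v := by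
  have e1 : (fun w => A w && !I.left w && decide (I.k ≤ mis (coGraph I G) (vertexSet A) w)) =
      fun w => (A w && decide (I.k ≤ mis (coGraph I G) (vertexSet A) w)) && !I.left w := by
    funext w; simp only [Bool.and_assoc, Bool.and_comm, Bool.and_left_comm]
  have e2 : (fun w => A w && I.left w && decide (I.k ≤ mis (coGraph I G) (vertexSet A) w)) =
      fun w => (A w && decide (I.k ≤ mis (coGraph I G) (vertexSet A) w)) && I.left w := by
    funext w; simp only [Bool.and_assoc, Bool.and_comm, Bool.and_left_comm]
  rw [countNbrs_val hI, countVerts_val hI, countVerts_val hI, e1, e2, card_nbrs_eq_iff hI,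
    Addable]
  refine and_congr_right fun _ => forall_congr' fun w => ?_
  simp only [mem_vertexSet, Bool.and_eq_true, decide_eq_true_eq]
  constructor
  · intro h h1 h2
    by_contra h3
    exact h ⟨h1, not_lt.1 h3⟩ h2
  · rintro h ⟨h1, h2⟩ h3
    exact absurd (h h1 h3) (not_lt.2 h2)

theorem foldl_branch (b : Branch V) (keep : V → Bool) (l : List V) (b' : Branch V) :
    l.foldl (fun b' v => Branch.mk (Function.update b'.S v (b.S v))
      (Function.update b'.C v (b.C v && keep v))
      (Function.update b'.D v (b.D v && keep v))) b' =
    Branch.mk (fun v => if v ∈ l then b.S v else b'.S v)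
      (fun v => if v ∈ l then b.C v && keep v else b'.C v)
      (fun v => if v ∈ l then b.D v && keep v else b'.D v) := by
  simp only [← foldl_update]
  induction l generalizing b' with
  | nil => rfl
  | cons v l ih => rw [List.foldl_cons, ih]; rfl

open Classical in
theorem refine_state (hI : I.Models G) (b : Branch V) :
    (refine I b).val.state =
      ⟨vertexSet b.S, (vertexSet b.C).filter (Addable (coGraph I G) I.k (vertexSet b.S)),
        (vertexSet b.D).filter (Addable (coGraph I G) I.k (vertexSet b.S))⟩ := by
  have hk := keep_iff hI b.S
  simp only [refine, Timed.bind_val, Timed.loop_val, Timed.op_val, missing_val hI]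
  rw [foldl_branch b fun v => decide (mis (coGraph I G) (vertexSet b.S) v ≤ I.k) && decide _]
  simp only [Branch.state, hI.mem_verts, if_true]
  refine congr (congr (congrArg _ rfl) ?_) ?_ <;>
  · ext v
    rw [mem_vertexSet, Finset.mem_filter, mem_vertexSet, ← hk v]
    simp only [Bool.and_eq_true, decide_eq_true_eq]

theorem testExtendable_val (hI : I.Models G) (b : Branch V) :
    (testExtendable I b (mis (coGraph I G) b.state.U)).val = true ↔
      Extendable (coGraph I G) I.k b.state := by
  have hk := keep_iff hI b.SC
  rw [vertexSet_SC] at hk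
  have hbody : ∀ (found : Bool) (v : V) (x y : ℕ) (miss : V → ℕ),
      (if b.D v && decide (miss v ≤ I.k) then do
        let c ← countNbrs I (fun w => b.SC w && decide (I.k ≤ miss w)) v
        Timed.op (found || decide (c = if I.left v then x else y))
      else Timed.op found).val = (found || (b.D v && decide (miss v ≤ I.k) &&
        decide ((countNbrs I (fun w => b.SC w && decide (I.k ≤ miss w)) v).val =
          if I.left v then x else y))) := by
    intro found v x y miss
    by_cases h : (b.D v && decide (miss v ≤ I.k)) = true
    · rw [if_pos h, h, Bool.true_and]; rfl
    · rw [if_neg h, Bool.eq_false_of_not_eq_true h]; simp [Timed.op_val]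
  simp only [testExtendable, Timed.bind_val, Timed.loop_val, hbody]
  simp only [foldl_or, Bool.false_or, List.any_eq_true, hI.mem_verts, true_and, Bool.and_eq_true, decide_eq_true_eq, Extendable,
    ← hk, and_assoc]
  simp only [Branch.state, mem_vertexSet]

/-- Minimality is not needed: every vertex of `S` on the proper side gives a valid bound, so it
suffices that the value comes from one. -/
theorem tau_attained (b : Branch V) (d : V → ℕ) (side : Bool) {t : ℕ}
    (h : (tau I b d side).val = some t) :
    ∃ u ∈ b.state.S, I.left u ≠ side ∧ d u + I.k = t := by
  have key : ∀ (l : List V) (o : Option ℕ),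
      (∀ t, o = some t → ∃ u ∈ b.state.S, I.left u ≠ side ∧ d u + I.k = t) →
      ∀ t, l.foldl (fun t u => if b.S u && (I.left u != side) then
          match t with
          | none => some (d u + I.k)
          | some m => some (min m (d u + I.k))
        else t) o = some t →
        ∃ u ∈ b.state.S, I.left u ≠ side ∧ d u + I.k = t := by
    intro l
    induction l with
    | nil => intro o ho t ht; exact ho t ht
    | cons v l ih =>
      intro o ho
      rw [List.foldl_cons]
      refine ih _ fun t ht => ?_
      split_ifs at ht with hv
      · simp only [Bool.and_eq_true, bne_iff_ne] at hv
        have hvS : v ∈ b.state.S := mem_vertexSet.2 hv.1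
        cases o with
        | none => simp only [Option.some.injEq] at ht; exact ⟨v, hvS, hv.2, ht⟩
        | some m =>
          simp only [Option.some.injEq] at ht
          rcases min_choice m (d v + I.k) with h1 | h1
          · exact ho t (by rw [← ht, h1])
          · exact ⟨v, hvS, hv.2, by rw [← ht, h1]⟩
      · exact ho t ht
  simp only [tau, Timed.loop_val, Timed.op_val] at h
  exact key _ none (by simp) t h

/-- `p` is a vertex of `A` with the most disconnections if some vertex of `A` has more than `k`. -/
def IsSelected (A : V → Bool) (miss : V → ℕ) (k : ℕ) (Q : V → Prop) : Option V → Prop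
  | none => ∀ v, Q v → A v = true → miss v ≤ k
  | some w => A w = true ∧ k < miss w ∧ ∀ v, Q v → A v = true → miss v ≤ miss w

theorem selectMax_val (scan : List V) (hscan : ∀ v, v ∈ scan) (A : V → Bool) (miss : V → ℕ) :
    IsSelected A miss I.k (fun _ => True) (selectMax I scan A miss).val := by
  -- `Q` describes the vertices scanned so far.
  have key : ∀ (l : List V) (p : Option V) (Q : V → Prop), IsSelected A miss I.k Q p →
      IsSelected A miss I.k (fun v => Q v ∨ v ∈ l)
        (l.foldl (fun p v => if A v && decide (I.k < miss v) then
          match p with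
          | none => some v
          | some w => if miss w < miss v then some v else some w
          else p) p) := by
    intro l
    induction l with
    | nil => intro p Q h; simpa using h
    | cons v l ih =>
      intro p Q h
      rw [List.foldl_cons]
      have h2 : (fun u => Q u ∨ u ∈ v :: l) = fun u => (Q u ∨ u = v) ∨ u ∈ l := by
        funext u; simp [or_assoc]
      rw [h2]
      refine ih _ _ ?_
      split_ifs with hv
      · simp only [Bool.and_eq_true, decide_eq_true_eq] at hv
        cases p with
        | none =>
          refine ⟨hv.1, hv.2, fun u hu hA => ?_⟩
          rcases hu with hu | rfl
          · have := h u hu hA; omega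
          · exact le_rfl
        | some w =>
          obtain ⟨h3, h4, h5⟩ := h
          dsimp only
          split_ifs with hw
          · refine ⟨hv.1, hv.2, fun u hu hA => ?_⟩
            rcases hu with hu | rfl
            · exact (h5 u hu hA).trans hw.le
            · exact le_rfl
          · refine ⟨h3, h4, fun u hu hA => ?_⟩
            rcases hu with hu | rfl
            · exact h5 u hu hA
            · omega
      · simp only [Bool.and_eq_true, decide_eq_true_eq, not_and, not_lt] at hv
        cases p with
        | none =>
          intro u hu hA
          rcases hu with hu | rfl
          · exact h u hu hA
          · exact hv hA
        | some w =>
          refine ⟨h.1, h.2.1, fun u hu hA => ?_⟩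
          rcases hu with hu | rfl
          · exact h.2.2 u hu hA
          · exact (hv hA).trans h.2.1.le
  have := key scan none (fun _ => False) (by intro v hv; exact hv.elim)
  simp only [selectMax, Timed.loop_val, Timed.op_val]
  have e : (fun v => False ∨ v ∈ scan) = fun _ => True := by
    funext v; simp [hscan v]
  rw [e] at this
  exact this

/-- The list of the candidates of `b` that come first in the ordering, besides the pivot. -/
def firstBlock (I : Input V) (G : SimpleGraph V) [DecidableRel G.Adj] (scan : List V)
    (b : Branch V) (p : V) : List V :=
  (scan.filter fun u => decide (u ∈ b.state.C ∧ (coGraph I G).Adj p u)).reverse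

theorem branchOrder_val (hI : I.Models G) (scan : List V) (b : Branch V) (p : V) :
    ∃ rest, (branchOrder I scan b p).val =
      (if b.C p then [p] else []) ++ (firstBlock I G scan b p ++ rest) := by
  have hfirst : (fun u => b.C u && (I.left u != I.left p) &&
      !(List.foldl (fun nb u => Function.update nb u true)
        (newArray I.verts false).val (I.adj p)) u) =
      fun u => decide (u ∈ b.state.C ∧ (coGraph I G).Adj p u) := by
    funext u
    rw [foldl_update (fun _ => true), newArray_val]
    have hm : u ∈ b.state.C ↔ b.C u = true := mem_vertexSet
    rw [Bool.eq_iff_iff]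
    simp only [hm, coGraph_adj, hI.mem_adj, Bool.and_eq_true, bne_iff_ne, decide_eq_true_eq,
      Bool.not_eq_true', and_assoc]
    by_cases h : G.Adj p u
    · simp [h]
    · simp only [h, if_false, not_false_eq_true, and_true, ne_comm]
  simp only [branchOrder, Timed.bind_val, Timed.loop_val, Timed.op_val]
  rw [foldl_cons_filter, hfirst]
  by_cases h : b.C p = true
  · simp only [h, if_true]; exact ⟨_, rfl⟩
  · simp only [if_neg h]; exact ⟨_, rfl⟩

end Values

/-! ### Step counts of the subroutines -/

section Steps

open Timed

theorem Timed.loop_steps_le {α β : Type} {body : β → α → Timed β} {c : ℕ} {l : List α}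
    (h : ∀ b, ∀ a ∈ l, (body b a).steps ≤ c) (acc : β) :
    (loop body acc l).steps ≤ l.length * (c + 1) + 1 := by
  induction l generalizing acc with
  | nil => simp [loop, op]
  | cons a l ih =>
    have h1 := ih (fun b a' ha' => h b a' (by simp [ha'])) (body acc a).val
    have h2 := h acc a (by simp)
    rw [loop_steps_cons, List.length_cons, Nat.succ_mul]
    omega

variable {V : Type} [Fintype V] [DecidableEq V]

/-- Bounds on the input size: `N` dominates the number of vertices times the maximum degree. -/
structure Input.Size (I : Input V) (N d : ℕ) : Prop where
  one_le : 1 ≤ N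
  one_le_d : 1 ≤ d
  length : I.verts.length * d ≤ N
  adj : ∀ v, (I.adj v).length ≤ d
  d_le : d ≤ N

variable {I : Input V} {N d : ℕ} (hN : I.Size N d)

include hN

theorem Input.Size.length_le : I.verts.length ≤ N :=
  (Nat.le_mul_of_pos_right _ hN.one_le_d).trans hN.length

theorem vertex_loop_steps {β : Type} {body : β → V → Timed β} (l : List V)
    (hl : l.length = I.verts.length) (h : ∀ b a, (body b a).steps ≤ 1) (acc : β) :
    (loop body acc l).steps ≤ 3 * N := by
  have h1 := loop_steps_le (c := 1) (l := l) (fun b a _ => h b a) acc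
  have h2 := hN.length_le
  have h3 := hN.one_le
  omega

/-- For bodies that walk one adjacency list: the `2 * d` parts sum to at most `2 * N`, everything
else to at most `(c + 2) * N`. -/
theorem vertex_loop_steps' {β : Type} {body : β → V → Timed β} {c : ℕ}
    (h : ∀ b a, (body b a).steps ≤ 2 * d + c) (acc : β) :
    (loop body acc I.verts).steps ≤ (c + 4) * N := by
  have h1 := loop_steps_le (c := 2 * d + c) (l := I.verts) (fun b a _ => h b a) acc
  have h2 := hN.length_le
  have h3 := hN.one_le
  have h4 := hN.length
  have h5 : I.verts.length * (c + 1) ≤ N * (c + 1) := Nat.mul_le_mul_right _ h2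
  nlinarith

theorem countVerts_steps (P : V → Bool) : (countVerts I P).steps ≤ 3 * N :=
  vertex_loop_steps hN _ rfl (fun _ _ => le_rfl) _

theorem newArray_steps {α : Type} (a : α) : (newArray I.verts a).steps ≤ 3 * N :=
  vertex_loop_steps hN _ rfl (fun _ _ => le_rfl) _

theorem adj_loop_steps {β : Type} {body : β → V → Timed β} (v : V)
    (h : ∀ b a, (body b a).steps ≤ 1) (acc : β) :
    (loop body acc (I.adj v)).steps ≤ 2 * d + 1 := by
  have h1 := loop_steps_le (c := 1) (l := I.adj v) (fun b a _ => h b a) acc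
  have h2 := hN.adj v
  omega

theorem countNbrs_steps (P : V → Bool) (v : V) : (countNbrs I P v).steps ≤ 2 * d + 1 :=
  adj_loop_steps hN v (fun _ _ => le_rfl) _

theorem degrees_steps (A : V → Bool) : (degrees I A).steps ≤ 9 * N := by
  simp only [degrees, bind_steps]
  have h1 := newArray_steps hN 0
  have h2 := vertex_loop_steps' hN (c := 2) (body := fun (deg : V → ℕ) v => do
    let c ← countNbrs I A v
    op (Function.update deg v c)) (fun b a => by
      have := countNbrs_steps hN A a
      simp only [bind_steps, op_steps]; omega) (newArray I.verts 0).val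
  omega

theorem missing_steps (A : V → Bool) (deg : V → ℕ) : (missing I A deg).steps ≤ 12 * N := by
  simp only [missing, bind_steps]
  have h1 := countVerts_steps hN fun v => A v && I.left v
  have h2 := countVerts_steps hN fun v => A v && !I.left v
  have h3 := newArray_steps hN 0
  refine (add_le_add h1 (add_le_add h2 (add_le_add h3
    (vertex_loop_steps hN _ rfl (fun _ _ => le_rfl) _)))).trans ?_
  omega

theorem testBiplex_steps (A : V → Bool) (miss : V → ℕ) : (testBiplex I A miss).steps ≤ 3 * N :=
  vertex_loop_steps hN _ rfl (fun _ _ => le_rfl) _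

theorem countEdges_steps (A : V → Bool) (deg : V → ℕ) : (countEdges I A deg).steps ≤ 3 * N :=
  vertex_loop_steps hN _ rfl (fun _ _ => le_rfl) _

theorem tau_steps (b : Branch V) (deg : V → ℕ) (side : Bool) :
    (tau I b deg side).steps ≤ 3 * N :=
  vertex_loop_steps hN _ rfl (fun _ _ => le_rfl) _

theorem testExtendable_steps (b : Branch V) (miss : V → ℕ) :
    (testExtendable I b miss).steps ≤ 12 * N := by
  simp only [testExtendable, bind_steps]
  refine (add_le_add (countVerts_steps hN _) (add_le_add (countVerts_steps hN _)
    (vertex_loop_steps' hN (c := 2) (fun found v => ?_) _))).trans (by omega)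
  have := countNbrs_steps hN (fun w => b.SC w && decide (I.k ≤ miss w)) v
  split_ifs <;> simp only [bind_steps, op_steps] <;> omega

theorem testPrune_steps (b : Branch V) (best : Best V) (missS degSC missSC : V → ℕ) :
    (testPrune I b best missS degSC missSC).steps ≤ 25 * N := by
  have h0 := hN.one_le
  have h1 := testBiplex_steps hN b.S missS
  have h2 := tau_steps hN b degSC true
  have h3 := tau_steps hN b degSC false
  have h4 := countEdges_steps hN b.SC degSC
  have h5 := testExtendable_steps hN b missSC
  simp only [testPrune, bind_steps, op_steps]
  omega

theorem selectMax_steps {scan : List V} (hscan : scan.length = I.verts.length) (A : V → Bool)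
    (miss : V → ℕ) : (selectMax I scan A miss).steps ≤ 3 * N :=
  vertex_loop_steps hN _ hscan (fun _ _ => le_rfl) _

theorem selectPivot_steps {scan : List V} (hscan : scan.length = I.verts.length) (b : Branch V)
    (miss : V → ℕ) : (selectPivot I scan b miss).steps ≤ 6 * N := by
  have h0 := hN.one_le
  have h1 := selectMax_steps hN hscan b.S miss
  have h2 := selectMax_steps hN hscan b.C miss
  simp only [selectPivot, bind_steps]
  cases (selectMax I scan b.S miss).val <;> simp only [op_steps] <;> omega

theorem branchOrder_steps {scan : List V} (hscan : scan.length = I.verts.length) (b : Branch V)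
    (p : V) : (branchOrder I scan b p).steps ≤ 13 * N := by
  have h0 := hN.one_le
  have h1 := hN.d_le
  simp only [branchOrder, bind_steps, op_steps]
  refine (add_le_add (newArray_steps hN _) (add_le_add
    (adj_loop_steps hN p (fun _ _ => le_rfl) _) (add_le_add
    (vertex_loop_steps hN _ hscan (fun _ _ => le_rfl) _) (add_le_add
    (vertex_loop_steps hN _ hscan (fun _ _ => le_rfl) _) le_rfl)))).trans ?_
  omega

theorem refine_steps (b : Branch V) : (refine I b).steps ≤ 43 * N := by
  have h0 := hN.one_le
  simp only [refine, bind_steps]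
  refine (add_le_add (degrees_steps hN _) (add_le_add (missing_steps hN _ _) (add_le_add
    (countVerts_steps hN _) (add_le_add (countVerts_steps hN _) (add_le_add
    (newArray_steps hN _) (add_le_add (newArray_steps hN _) (add_le_add (newArray_steps hN _)
    (vertex_loop_steps' hN (c := 3) (fun b' v => ?_) _)))))))).trans (by omega)
  refine (add_le_add (countNbrs_steps hN _ _) le_rfl).trans ?_
  simp only [bind_steps, op_steps]
  omega

theorem updateBest_steps (b : Branch V) (best : Best V) (e : ℕ) :
    (updateBest I b best e).steps ≤ 13 * N := by
  have h0 := hN.one_le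
  have h1 := countVerts_steps hN fun v => b.SC v && I.left v
  have h2 := countVerts_steps hN fun v => b.SC v && !I.left v
  have h3 := newArray_steps hN false
  have h4 := vertex_loop_steps hN (body := fun (H : V → Bool) v => op (Function.update H v (b.SC v)))
    I.verts rfl (fun _ _ => le_rfl) (newArray I.verts false).val
  simp only [updateBest, bind_steps]
  split_ifs <;> simp only [bind_steps, op_steps] <;> omega

end Steps

/-! ### The loop over the children -/

section Recursion

open Timed

variable {V : Type} [Fintype V] [DecidableEq V] (I : Input V)
  (scan : Branch V → Best V → List V)

/-- The loop over the branches in the body of `fastBBRec`. -/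
def branchLoop (fuel : ℕ) (st : Branch V × Best V) (l : List V) : Timed (Branch V × Best V) :=
  loop (fun (st : Branch V × Best V) v => do
    let C ← op (Function.update st.1.C v false)
    let child ← refine I ⟨st.1.S, C, Function.update st.1.D v true⟩
    let best ← fastBBRec I scan fuel child st.2
    op (Branch.mk (Function.update st.1.S v true) C st.1.D, best)) st l

/-- The branch `b` after the vertices of `l` have been moved from the candidates to the partial
set. -/
def HasState (s : SearchState V) (pre : List V) (b : Branch V) : Prop :=
  b.state = ⟨s.S ∪ pre.toFinset, s.C \ pre.toFinset, s.D⟩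

variable {I scan} {G : SimpleGraph V} [DecidableRel G.Adj]

theorem vertexSet_update_true (A : V → Bool) (v : V) :
    vertexSet (Function.update A v true) = insert v (vertexSet A) := by
  ext u
  by_cases h : u = v <;> simp [mem_vertexSet, h]

theorem vertexSet_update_false (A : V → Bool) (v : V) :
    vertexSet (Function.update A v false) = (vertexSet A).erase v := by
  ext u
  by_cases h : u = v <;> simp [mem_vertexSet, h]

theorem HasState.child (hI : I.Models G) {s : SearchState V} {pre : List V} {b : Branch V}
    (h : HasState s pre b) (v : V) :
    (refine I ⟨b.S, Function.update b.C v false, Function.update b.D v true⟩).val.state =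
      childState (coGraph I G) I.k s pre v := by
  have h1 : vertexSet b.S = s.S ∪ pre.toFinset := congrArg SearchState.S h
  have h2 : vertexSet b.C = s.C \ pre.toFinset := congrArg SearchState.C h
  have h3 : vertexSet b.D = s.D := congrArg SearchState.D h
  rw [refine_state hI]
  simp only [vertexSet_update_true, vertexSet_update_false, h2, h3]
  unfold childState
  rw [← h1]

theorem HasState.next {s : SearchState V} {pre : List V} {b : Branch V}
    (h : HasState s pre b) (v : V) :
    HasState s (pre ++ [v])
      ⟨Function.update b.S v true, Function.update b.C v false, b.D⟩ := by
  have h1 : vertexSet b.S = s.S ∪ pre.toFinset := congrArg SearchState.S h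
  have h2 : vertexSet b.C = s.C \ pre.toFinset := congrArg SearchState.C h
  have h3 : vertexSet b.D = s.D := congrArg SearchState.D h
  simp only [HasState, Branch.state, vertexSet_update_true, vertexSet_update_false, h1, h2, h3,
    SearchState.mk.injEq, and_true]
  constructor
  · ext u; simp
  · ext u; simp; tauto

theorem hasState_nil (b : Branch V) : HasState b.state [] b := by
  simp [HasState]

theorem branchLoop_cons (fuel : ℕ) (b : Branch V) (best : Best V) (v : V) (l : List V) :
    branchLoop I scan fuel (b, best) (v :: l) =
      (op v >>= fun x =>
        (op (Function.update b.C x false) >>= fun C =>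
          refine I ⟨b.S, C, Function.update b.D x true⟩ >>= fun child =>
          fastBBRec I scan fuel child best >>= fun best =>
          op (Branch.mk (Function.update b.S x true) C b.D, best)) >>= fun acc =>
        branchLoop I scan fuel acc l) := rfl

/-- `Q` is progress of the global variable, and `R c` a guarantee given by the call on `c` that
survives progress; hence all guarantees hold at the end of the loop. -/
theorem branchLoop_val (hI : I.Models G) (fuel : ℕ) {Q : Best V → Best V → Prop}
    (hQ : ∀ x, Q x x) (hQt : ∀ x y z, Q x y → Q y z → Q x z)
    {R : SearchState V → Best V → Prop} (hR : ∀ s x y, Q x y → R s x → R s y)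
    {s : SearchState V} : ∀ (l pre : List V) (b : Branch V) (best : Best V),
    HasState s pre b →
    (∀ c ∈ childStates (coGraph I G) I.k s pre l, ∀ b best, b.state = c →
      Q best (fastBBRec I scan fuel b best).val ∧ R c (fastBBRec I scan fuel b best).val) →
    Q best (branchLoop I scan fuel (b, best) l).val.2 ∧
      ∀ c ∈ childStates (coGraph I G) I.k s pre l,
        R c (branchLoop I scan fuel (b, best) l).val.2 := by
  intro l
  induction l with
  | nil =>
    intro pre b best _ _
    exact ⟨hQ _, by simp [childStates]⟩
  | cons v l ih =>
    intro pre b best hb h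
    simp only [childStates, List.mem_cons, forall_eq_or_imp] at h
    rw [branchLoop_cons]
    simp only [bind_val, op_val]
    set best' := (fastBBRec I scan fuel
      (refine I ⟨b.S, Function.update b.C v false, Function.update b.D v true⟩).val best).val
    obtain ⟨h1, h2⟩ := h.1 _ best (hb.child hI v)
    obtain ⟨h3, h4⟩ := ih (pre ++ [v]) _ best' (hb.next v) h.2
    refine ⟨hQt _ _ _ h1 h3, ?_⟩
    simp only [childStates, List.mem_cons, forall_eq_or_imp]
    exact ⟨hR _ _ _ h3 h2, h4⟩

/-- Besides its call, each child needs `43 * N` steps for the refinement and three single steps. The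
terms `-1` of the children add up to `-l.length`. -/
theorem branchLoop_steps (hI : I.Models G) {N d : ℕ} (hN : I.Size N d) (fuel : ℕ) {E : ℝ}
    {P : SearchState V → ℝ → Prop}
    (hP : ∀ s x, P s x → ∀ b best, b.state = s →
      ((fastBBRec I scan fuel b best).steps : ℝ) ≤ E * (2 * x - 1))
    {s : SearchState V} : ∀ (l pre : List V) (xs : List ℝ) (b : Branch V) (best : Best V),
    HasState s pre b → List.Forall₂ P (childStates (coGraph I G) I.k s pre l) xs →
    ((branchLoop I scan fuel (b, best) l).steps : ℝ) ≤
      E * (2 * xs.sum - l.length) + 46 * N * l.length + N := by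
  have h1N : (1 : ℝ) ≤ N := by exact_mod_cast hN.one_le
  intro l
  induction l with
  | nil =>
    intro pre xs b best _ h
    simp only [childStates, List.forall₂_nil_left_iff] at h
    subst h
    have : (branchLoop I scan fuel (b, best) []).steps = 1 := rfl
    simp [this, h1N]
  | cons v l ih =>
    intro pre xs b best hb h
    simp only [childStates] at h
    obtain ⟨x, ys, hx, hys, rfl⟩ := List.forall₂_cons_left_iff.1 h
    rw [branchLoop_cons]
    simp only [bind_steps, bind_val, op_steps, op_val]
    have h1 := hP _ _ hx _ best (hb.child hI v)
    have h2 := ih (pre ++ [v]) ys _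
      (fastBBRec I scan fuel
        (refine I ⟨b.S, Function.update b.C v false, Function.update b.D v true⟩).val best).val
      (hb.next v) hys
    have h3 : ((refine I ⟨b.S, Function.update b.C v false,
        Function.update b.D v true⟩).steps : ℝ) ≤ 43 * N := by
      exact_mod_cast refine_steps hN _
    rw [List.sum_cons, List.length_cons]
    push_cast
    linarith

end Recursion

/-! ### Branching lists -/

section BranchLists

variable {V : Type} [DecidableEq V]

/-- `l` is a list of candidates over which the algorithm branches in the state `s`. -/
def IsBranchList (B : SimpleGraph V) [DecidableRel B.Adj] (k : ℕ) (s : SearchState V)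
    (l : List V) : Prop :=
  ∃ p, IsKeptPivot B k s p l ∨ ∃ l', l = p :: l' ∧ IsOpenPivot B k s p l'

theorem mis_union {B : SimpleGraph V} [DecidableRel B.Adj] {A A' : Finset V}
    (h : Disjoint A A') (v : V) : mis B (A ∪ A') v = mis B A v + mis B A' v := by
  rw [mis, Finset.filter_union, Finset.card_union_of_disjoint
    (Finset.disjoint_filter_filter h), mis, mis]

variable {B : SimpleGraph V} [DecidableRel B.Adj] {k : ℕ} {s : SearchState V}

/-- The pivot exceeds `k` only through candidates, and an addable neighbour shows that it is not yet
full. Pruning rule (1) enters the time bound here, as `hS`. -/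
theorem IsKeptPivot.mis_lt {p : V} {l : List V} (hp : IsKeptPivot B k s p l)
    (hs : Refined B k s) (hS : ∀ v ∈ s.S, mis B s.S v ≤ k) : mis B s.S p < k := by
  have h1 := hS p hp.mem
  have h2 := hp.lt_mis
  rw [SearchState.U, mis_union hs.disj] at h2
  obtain ⟨u, hu⟩ : (s.C.filter (B.Adj p)).Nonempty := by
    rw [← Finset.card_pos]
    change 0 < mis B s.C p
    omega
  obtain ⟨huC, hpu⟩ := Finset.mem_filter.1 hu
  exact (hs.add u huC).2 p hp.mem hpu.symm

/-- Branching is at least twofold, so that the leaves can pay for the inner calls. -/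
theorem IsBranchList.two_le_length {l : List V} (hl : IsBranchList B k s l)
    (hs : Refined B k s) (hS : ∀ v ∈ s.S, mis B s.S v ≤ k) : 2 ≤ l.length := by
  obtain ⟨p, hp | ⟨l', rfl, hp⟩⟩ := hl
  · have h1 := hp.mis_lt hs hS
    have h2 := hp.block.len
    omega
  · have h1 := (hs.add p hp.mem).1
    have h2 := hp.block.len
    rw [List.length_cons]
    omega

theorem IsBranchList.nodup {l : List V} (hl : IsBranchList B k s l) : l.Nodup := by
  obtain ⟨p, hp | ⟨l', rfl, hp⟩⟩ := hl
  · exact hp.block.nodup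
  · exact List.nodup_cons.2 ⟨fun h => B.loopless.irrefl _ (hp.block.mem p h).2, hp.block.nodup⟩

theorem IsBranchList.mem {l : List V} (hl : IsBranchList B k s l) : ∀ u ∈ l, u ∈ s.C := by
  obtain ⟨p, hp | ⟨l', rfl, hp⟩⟩ := hl
  · exact fun u hu => (hp.block.mem u hu).1
  · intro u hu
    rcases List.mem_cons.1 hu with rfl | hu
    · exact hp.mem
    · exact (hp.block.mem u hu).1

theorem IsBranchList.thin_step {l : List V} (hl : IsBranchList B k s l) (hs : Refined B k s)
    (ht : Thin B k s) {γ n : ℝ} {P : SearchState V → ℝ → Prop} (hP : ThinBound B k γ n P)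
    (ha : Admissible k γ n) (hB : ∀ a b c, B.Adj a b → B.Adj b c → ¬ B.Adj a c) :
    ∃ xs, List.Forall₂ P (childStates B k s [] l) xs ∧ xs.sum ≤ 100 * potential B k γ n s := by
  obtain ⟨p, hp | ⟨l', rfl, hp⟩⟩ := hl
  · exact thin_step_kept hP ha hs ht hp
  · exact thin_step_open hp hs ht hP ha hB

/-- Lists of at most `k + 1` entries use only part of the equation for `γ`. A longer one belongs to
an open pivot without kept neighbours; if its degree is `k + 1`, its maximality makes the state
thin, and the potential is at most `γ ^ |C|`. -/
theorem IsBranchList.coarse_step {l : List V} (hl : IsBranchList B k s l) (hs : Refined B k s)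
    {γ n : ℝ} {P : SearchState V → ℝ → Prop} (hP : ThinBound B k γ n P)
    (ha : Admissible k γ n) (hB : ∀ a b c, B.Adj a b → B.Adj b c → ¬ B.Adj a c)
    (hcoarse : ∀ s, Refined B k s → P s (100 * γ ^ s.C.card))
    (hgeo : geo γ⁻¹ (k + 1) + γ⁻¹ ^ (k + 3) = 1) :
    ∃ xs, List.Forall₂ P (childStates B k s [] l) xs ∧ xs.sum ≤ 100 * γ ^ s.C.card := by
  have hγ := ha.le_γ
  have hγ0 : (0 : ℝ) ≤ γ⁻¹ := by positivity
  have hshort : l.length ≤ k + 1 →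
      ∃ xs, List.Forall₂ P (childStates B k s [] l) xs ∧ xs.sum ≤ 100 * γ ^ s.C.card := by
    intro h
    refine _root_.coarse_step (by linarith) (by norm_num) hP.mono hcoarse hs hl.nodup hl.mem ?_
    have h1 := geo_mono hγ0 h
    have h2 := pow_nonneg hγ0 (k + 3)
    linarith
  have hl' := hl
  obtain ⟨p, hp | ⟨l', rfl, hp⟩⟩ := hl'
  · exact hshort (by have := hp.block.len; omega)
  · have hlen := hp.block.len
    rcases Nat.eq_zero_or_pos (mis B s.S p) with h0 | h0
    · by_cases hover : k + 2 ≤ mis B s.U p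
      · exact coarse_step_last (by linarith) (by norm_num) hP.mono hcoarse hs hp h0 hover hgeo.le
      · have ht : Thin B k s := by
          constructor
          · intro v hv
            rcases Finset.mem_union.1 hv with hv | hv
            · exact (hp.kept_le v hv).trans (Nat.le_succ k)
            · have := hp.open_le v hv; omega
          · intro v hv hv'
            exact absurd (hp.kept_le v hv) (not_le.2 hv')
        obtain ⟨xs, h1, h2⟩ := hl.thin_step hs ht hP ha hB
        have h3 := potential_le_pow (B := B) (k := k) ha.le_n ha.n_le s
        exact ⟨xs, h1, by linarith⟩
    · exact hshort (by rw [List.length_cons]; omega)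

end BranchLists

/-! ### The three outcomes of a call -/

section Cases

open Timed

variable {V : Type} [Fintype V] [DecidableEq V] {I : Input V}
  {scan : Branch V → Best V → List V} {G : SimpleGraph V} [DecidableRel G.Adj]

theorem selectPivot_val {scan : List V} (hscan : ∀ v, v ∈ scan) (b : Branch V) (miss : V → ℕ)
    (h : ∃ v ∈ b.state.U, I.k < miss v) :
    ∃ p, (selectPivot I scan b miss).val = some p ∧ I.k < miss p ∧
      (p ∈ b.state.S ∨ p ∈ b.state.C ∧ (∀ v ∈ b.state.S, miss v ≤ I.k) ∧
        ∀ v ∈ b.state.C, miss v ≤ miss p) := by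
  have h1 := selectMax_val (I := I) scan hscan b.S miss
  have h2 := selectMax_val (I := I) scan hscan b.C miss
  simp only [selectPivot, bind_val]
  rcases h3 : (selectMax I scan b.S miss).val with _ | p
  · rw [h3] at h1
    rcases h4 : (selectMax I scan b.C miss).val with _ | p
    · rw [h4] at h2
      obtain ⟨v, hv, hv'⟩ := h
      rcases Finset.mem_union.1 hv with hv | hv
      · exact absurd (h1 v trivial (mem_vertexSet.1 hv)) (not_le.2 hv')
      · exact absurd (h2 v trivial (mem_vertexSet.1 hv)) (not_le.2 hv')
    · rw [h4] at h2
      exact ⟨p, rfl, h2.2.1, .inr ⟨mem_vertexSet.2 h2.1,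
        fun v hv => h1 v trivial (mem_vertexSet.1 hv),
        fun v hv => h2.2.2 v trivial (mem_vertexSet.1 hv)⟩⟩
  · rw [h3] at h1
    exact ⟨p, rfl, h1.2.1, .inl (mem_vertexSet.2 h1.1)⟩

theorem firstBlock_length {scan : List V} (hscan : scan.Perm I.verts) (hI : I.Models G)
    (b : Branch V) (p : V) :
    (firstBlock I G scan b p).length = mis (coGraph I G) b.state.C p := by
  rw [firstBlock, List.length_reverse,
    ← List.toFinset_card_of_nodup ((hscan.nodup_iff.2 hI.verts_nodup).filter _), mis]
  congr 1
  ext u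
  simp [hscan.mem_iff, hI.mem_verts u]

theorem isBlock_take {scan : List V} (hscan : scan.Perm I.verts) (hI : I.Models G)
    {b : Branch V} (hb : Disjoint b.state.S b.state.C) {p : V}
    (hS : mis (coGraph I G) b.state.S p ≤ I.k) (hU : I.k < mis (coGraph I G) b.state.U p) :
    IsBlock (coGraph I G) I.k b.state p
      ((firstBlock I G scan b p).take (I.k - mis (coGraph I G) b.state.S p + 1)) := by
  refine ⟨?_, fun u hu => ?_, ?_⟩
  · exact (List.nodup_reverse.2 ((hscan.nodup_iff.2 hI.verts_nodup).filter _)).sublist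
      (List.take_sublist _ _)
  · have := List.mem_of_mem_take hu
    simp only [firstBlock, List.mem_reverse, List.mem_filter, decide_eq_true_eq] at this
    exact this.2
  · rw [SearchState.U, mis_union hb] at hU
    rw [List.length_take, firstBlock_length hscan hI]
    omega

theorem testPrune_eq_false (hI : I.Models G) {b : Branch V} {best : Best V} {degSC : V → ℕ}
    (h : ¬ (testPrune I b best (mis (coGraph I G) b.state.S) degSC
      (mis (coGraph I G) b.state.U)).val = true) :
    (∀ v ∈ b.state.S, mis (coGraph I G) b.state.S v ≤ I.k) ∧
      ¬ Extendable (coGraph I G) I.k b.state := by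
  rw [← testExtendable_val hI]
  have h1 := testBiplex_val hI b.S (mis (coGraph I G) b.state.S)
  simp only [testPrune, bind_val, op_val, Bool.or_eq_true, not_or, Bool.not_eq_true',
    Bool.not_eq_false] at h
  exact ⟨h1.1 h.1.1.1, h.2⟩

/-- Values and step counts are recorded together, so that correctness and running time both rest on
the same trichotomy. -/
theorem fastBBRec_cases (hI : I.Models G) {N d : ℕ} (hN : I.Size N d)
    (hscan : ∀ b best, (scan b best).Perm I.verts) (fuel : ℕ) (b : Branch V) (best : Best V) :
    ((∀ v ∈ b.state.U, mis (coGraph I G) b.state.U v ≤ I.k) ∧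
      (fastBBRec I scan (fuel + 1) b best).val =
        (updateBest I b best (countEdges I b.SC (degrees I b.SC).val).val).val ∧
      (fastBBRec I scan (fuel + 1) b best).steps ≤ 61 * N) ∨
    ((testPrune I b best (mis (coGraph I G) b.state.S) (degrees I b.SC).val
        (mis (coGraph I G) b.state.U)).val = true ∧
      (fastBBRec I scan (fuel + 1) b best).val = best ∧
      (fastBBRec I scan (fuel + 1) b best).steps ≤ 71 * N) ∨
    ((∀ v ∈ b.state.S, mis (coGraph I G) b.state.S v ≤ I.k) ∧
      ¬ Extendable (coGraph I G) I.k b.state ∧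
      (Refined (coGraph I G) I.k b.state → ∃ l, IsBranchList (coGraph I G) I.k b.state l ∧
        (fastBBRec I scan (fuel + 1) b best).val =
          (branchLoop I scan fuel (b, best) l).val.2 ∧
        (fastBBRec I scan (fuel + 1) b best).steps ≤
          93 * N + (branchLoop I scan fuel (b, best) l).steps)) := by
  have h0 := hN.one_le
  have h1 := degrees_steps hN b.S
  have h2 := degrees_steps hN b.SC
  have h3 := missing_steps hN b.S (degrees I b.S).val
  have h4 := missing_steps hN b.SC (degrees I b.SC).val
  have h5 := testBiplex_steps hN b.SC (mis (coGraph I G) b.state.U)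
  have hU := testBiplex_val hI b.SC (mis (coGraph I G) b.state.U)
  rw [vertexSet_SC] at hU
  simp only [fastBBRec, bind_val, bind_steps, missing_val hI, vertexSet_SC]
  have hS : vertexSet b.S = b.state.S := rfl
  rw [hS]
  by_cases hbip : (testBiplex I b.SC (mis (coGraph I G) b.state.U)).val = true
  · left
    simp only [hbip, if_true, bind_val, bind_steps]
    have h6 := countEdges_steps hN b.SC (degrees I b.SC).val
    have h7 := updateBest_steps hN b best (countEdges I b.SC (degrees I b.SC).val).val
    exact ⟨hU.1 hbip, trivial, by omega⟩
  right
  simp only [if_neg hbip, bind_val, bind_steps]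
  have h6 := testPrune_steps hN b best (mis (coGraph I G) b.state.S) (degrees I b.SC).val
    (mis (coGraph I G) b.state.U)
  by_cases hpr : (testPrune I b best (mis (coGraph I G) b.state.S) (degrees I b.SC).val
    (mis (coGraph I G) b.state.U)).val = true
  · left
    simp only [hpr, if_true, op_val, op_steps]
    exact ⟨trivial, trivial, by omega⟩
  right
  simp only [if_neg hpr, bind_val, bind_steps]
  obtain ⟨hSk, hext⟩ := testPrune_eq_false hI hpr
  refine ⟨hSk, hext, fun hs => ?_⟩
  have hex : ∃ v ∈ b.state.U, I.k < mis (coGraph I G) b.state.U v := by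
    by_contra hcon
    push Not at hcon
    exact hbip (hU.2 hcon)
  have hperm := hscan b best
  obtain ⟨p, hp, hpk, hp'⟩ := selectPivot_val
    (fun v => hperm.mem_iff.2 (hI.mem_verts v)) b _ hex
  have h7 := selectPivot_steps hN hperm.length_eq b (mis (coGraph I G) b.state.U)
  have h8 := branchOrder_steps hN hperm.length_eq b p
  obtain ⟨rest, hrest⟩ := branchOrder_val hI (scan b best) b p
  rw [hp]
  simp only [bind_val, bind_steps, op_val, op_steps, hrest]
  rcases hp' with hpS | ⟨hpC, hkept, hopen⟩
  · have hblock := isBlock_take hperm hI hs.disj (hSk p hpS) hpk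
    have hlen := hblock.len
    refine ⟨_, ⟨p, .inl ⟨hpS, hpk, hblock⟩⟩, ?_⟩
    have hS' : b.S p = true := mem_vertexSet.1 hpS
    have hC' : ¬ b.C p = true := fun h =>
      Finset.disjoint_left.1 hs.disj hpS (mem_vertexSet.2 h)
    simp only [hS', if_true, if_neg hC', List.nil_append]
    rw [List.length_take] at hlen
    -- As the pivot exceeds `k`, the first block has at least `t` entries, so the cut never reaches
    -- the rest of the ordering.
    rw [List.take_append_of_le_length (by have := hSk p hpS; omega)]
    exact ⟨rfl, by unfold branchLoop; omega⟩
  · have hadd := (hs.add p hpC).1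
    have hblock := isBlock_take hperm hI hs.disj hadd hpk
    have hlen := hblock.len
    refine ⟨_, ⟨p, .inr ⟨_, rfl, hpC, hpk, hkept, hopen, hblock⟩⟩, ?_⟩
    have hC' : b.C p = true := mem_vertexSet.1 hpC
    have hS' : ¬ b.S p = true := fun h =>
      Finset.disjoint_left.1 hs.disj (mem_vertexSet.2 h) hpC
    simp only [if_neg hS', hC', if_true, List.singleton_append]
    rw [List.length_take] at hlen
    rw [List.take_succ_cons, List.take_append_of_le_length (by omega)]
    exact ⟨rfl, by unfold branchLoop; omega⟩

end Cases

/-! ### The time bound -/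

section Time

open Timed

variable {V : Type} [Fintype V] [DecidableEq V]

variable {I : Input V} {scan : Branch V → Best V → List V} {G : SimpleGraph V}
  [DecidableRel G.Adj]

/-- Every call in the state `s` takes at most `200 * N * (2 * x - 1)` steps. -/
def StepBound (I : Input V) (scan : Branch V → Best V → List V) (N fuel : ℕ)
    (s : SearchState V) (x : ℝ) : Prop :=
  ∀ b best, b.state = s → ((fastBBRec I scan fuel b best).steps : ℝ) ≤ 200 * N * (2 * x - 1)

theorem StepBound.mono {N fuel : ℕ} {s : SearchState V} {x y : ℝ} (hxy : x ≤ y)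
    (h : StepBound I scan N fuel s x) : StepBound I scan N fuel s y := by
  intro b best hb
  refine (h b best hb).trans ?_
  have : (0 : ℝ) ≤ N := Nat.cast_nonneg N
  gcongr

theorem fastBBRec_zero_steps {N : ℕ} (hN : 1 ≤ N) (s : SearchState V) {x : ℝ} (hx : 1 ≤ x) :
    StepBound I scan N 0 s x := by
  intro b best _
  have h1 : (fastBBRec I scan 0 b best).steps = 1 := rfl
  have h2 : (1 : ℝ) ≤ N := by exact_mod_cast hN
  rw [h1]
  push_cast
  nlinarith

theorem stepBound_of_le {N m : ℕ} {t : ℕ} (ht : t ≤ m * N) (hm : m ≤ 200) {x : ℝ} (hx : 1 ≤ x) :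
    (t : ℝ) ≤ 200 * N * (2 * x - 1) := by
  have h1 : (t : ℝ) ≤ 200 * N := by
    exact_mod_cast ht.trans (Nat.mul_le_mul_right N hm)
  have h2 : (0 : ℝ) ≤ N := Nat.cast_nonneg N
  nlinarith

theorem stepBound_leaf (hI : I.Models G) {N d : ℕ} (hN : I.Size N d)
    (hscan : ∀ b best, (scan b best).Perm I.verts) (fuel : ℕ) {s : SearchState V}
    (hs : Extendable (coGraph I G) I.k s) : StepBound I scan N fuel s 1 := by
  cases fuel with
  | zero => exact fastBBRec_zero_steps hN.one_le s le_rfl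
  | succ fuel =>
    rintro b best rfl
    obtain ⟨_, _, h⟩ | ⟨_, _, h⟩ | ⟨_, h, _⟩ := fastBBRec_cases hI hN hscan fuel b best
    · exact stepBound_of_le h (by norm_num) le_rfl
    · exact stepBound_of_le h (by norm_num) le_rfl
    · exact absurd hs h

/-- With `m ≥ 2` children the bound leaves `200 * N * (m - 1)` steps, enough for the `46 * N * m +
94 * N` spent by the call itself. -/
theorem stepBound_succ (hI : I.Models G) {N d : ℕ} (hN : I.Size N d)
    (hscan : ∀ b best, (scan b best).Perm I.verts) {fuel : ℕ} {s : SearchState V}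
    (hs : Refined (coGraph I G) I.k s) {x : ℝ} (hx : 1 ≤ x)
    (h : ∀ l, IsBranchList (coGraph I G) I.k s l →
      ∃ xs, List.Forall₂ (StepBound I scan N fuel) (childStates (coGraph I G) I.k s [] l) xs ∧
        xs.sum ≤ x) : StepBound I scan N (fuel + 1) s x := by
  rintro b best rfl
  obtain ⟨_, _, h1⟩ | ⟨_, _, h1⟩ | ⟨hS, _, hrec⟩ := fastBBRec_cases hI hN hscan fuel b best
  · exact stepBound_of_le h1 (by norm_num) hx
  · exact stepBound_of_le h1 (by norm_num) hx
  obtain ⟨l, hl, -, h1⟩ := hrec hs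
  obtain ⟨xs, h2, h3⟩ := h l hl
  have h4 := branchLoop_steps hI hN fuel (fun _ _ h => h) l [] xs b best (hasState_nil b) h2
  have h5 : (2 : ℝ) ≤ l.length := by exact_mod_cast hl.two_le_length hs hS
  have h6 : ((fastBBRec I scan (fuel + 1) b best).steps : ℝ) ≤
      93 * N + (branchLoop I scan fuel (b, best) l).steps := by exact_mod_cast h1
  have h7 : (0 : ℝ) ≤ N := Nat.cast_nonneg N
  nlinarith [mul_le_mul_of_nonneg_left h3 h7, mul_le_mul_of_nonneg_left h5 h7]

/-- A joint induction, because the coarse bound falls back on the thin recurrence when an open pivot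
without kept neighbours has degree `k + 1`. -/
theorem stepBound_potential (hI : I.Models G) {N d : ℕ} (hN : I.Size N d)
    (hscan : ∀ b best, (scan b best).Perm I.verts) {γ n : ℝ} (ha : Admissible I.k γ n)
    (hgeo : geo γ⁻¹ (I.k + 1) + γ⁻¹ ^ (I.k + 3) = 1) (fuel : ℕ) :
    (∀ s, Refined (coGraph I G) I.k s → StepBound I scan N fuel s (100 * γ ^ s.C.card)) ∧
      ThinBound (coGraph I G) I.k γ n (StepBound I scan N fuel) := by
  have hpot : ∀ s : SearchState V, 1 ≤ 100 * potential (coGraph I G) I.k γ n s := fun s => by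
    have := potential_ge_one (B := coGraph I G) (k := I.k) ha.le_n ha.n_le s List.nodup_nil
      (by simp)
    simp only [List.map_nil, List.prod_nil, mul_one] at this
    linarith
  have hpow : ∀ s : SearchState V, 1 ≤ 100 * γ ^ s.C.card := fun s => by
    have := one_le_pow₀ (M₀ := ℝ) (a := γ) (n := s.C.card) (by linarith [ha.le_γ])
    linarith
  induction fuel with
  | zero =>
    exact ⟨fun s _ => fastBBRec_zero_steps hN.one_le s (hpow s),
      ⟨fun _ _ _ => StepBound.mono, fun s hs => stepBound_leaf hI hN hscan 0 hs,
      fun s _ _ => fastBBRec_zero_steps hN.one_le s (hpot s)⟩⟩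
  | succ fuel ih =>
    obtain ⟨ih1, ih2⟩ := ih
    refine ⟨fun s hs => ?_, fun _ _ _ => StepBound.mono,
      fun s hs => stepBound_leaf hI hN hscan _ hs, fun s hs ht => ?_⟩
    · exact stepBound_succ hI hN hscan hs (hpow s) fun l hl =>
        hl.coarse_step hs ih2 ha coGraph_triangle_free ih1 hgeo
    · exact stepBound_succ hI hN hscan hs (hpot s) fun l hl =>
        hl.thin_step hs ht ih2 ha coGraph_triangle_free

/-- The branch `(∅, V, ∅)`. -/
def rootBranch (V : Type) : Branch V := ⟨fun _ => false, fun _ => true, fun _ => false⟩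

theorem rootBranch_state : (rootBranch V).state = ⟨∅, Finset.univ, ∅⟩ := by
  simp [rootBranch, Branch.state, vertexSet]

theorem rootBranch_refined (B : SimpleGraph V) [DecidableRel B.Adj] (k : ℕ) :
    Refined B k (rootBranch V).state := by
  rw [rootBranch_state]
  exact ⟨by simp, fun v _ => ⟨by simp [mis], by simp⟩⟩

theorem fastBB_val (hI : I.Models G) :
    (fastBB I scan).val =
      (fastBBRec I scan (Fintype.card V + 1) (rootBranch V) ⟨fun _ => false, 0⟩).val := by
  have h : (vertexSet fun _ : V => true).card = Fintype.card V := by simp [vertexSet]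
  simp only [fastBB, bind_val, countVerts_val hI, newArray_val, h, rootBranch]

theorem fastBB_steps (hI : I.Models G) {N d : ℕ} (hN : I.Size N d)
    (hscan : ∀ b best, (scan b best).Perm I.verts) (hk : 1 ≤ I.k) :
    ((fastBB I scan).steps : ℝ) ≤ 40015 * (N * gammaK I.k ^ Fintype.card V) := by
  obtain ⟨n, ha⟩ := exists_admissible hk
  have h1 := (stepBound_potential hI hN hscan ha (geo_gammaK hk) (Fintype.card V + 1)).1 _
    (rootBranch_refined _ _) (rootBranch V) ⟨fun _ => false, 0⟩ rfl
  have h2 : (fastBB I scan).steps ≤ 15 * N +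
      (fastBBRec I scan (Fintype.card V + 1) (rootBranch V) ⟨fun _ => false, 0⟩).steps := by
    have h : (vertexSet fun _ : V => true).card = Fintype.card V := by simp [vertexSet]
    have h3 := countVerts_steps hN fun _ => true
    have h4 := newArray_steps hN false
    have h5 := newArray_steps hN true
    simp only [fastBB, bind_steps, countVerts_val hI, newArray_val, h, rootBranch]
    omega
  have h3 : ((fastBB I scan).steps : ℝ) ≤ 15 * N +
      (fastBBRec I scan (Fintype.card V + 1) (rootBranch V) ⟨fun _ => false, 0⟩).steps := by
    exact_mod_cast h2
  have h4 : (rootBranch V).state.C.card = Fintype.card V := by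
    rw [rootBranch_state, Finset.card_univ]
  rw [h4] at h1
  have h5 := one_le_pow₀ (M₀ := ℝ) (a := gammaK I.k) (n := Fintype.card V)
    (by linarith [ha.le_γ])
  have h6 : (0 : ℝ) ≤ N := Nat.cast_nonneg N
  -- The constant is `200 * 2 * 100` for the recursion plus 15 for the initialization.
  nlinarith [mul_le_mul_of_nonneg_left h5 h6]

end Time

/-! ### Every biplex survives in some child -/

section Covering

variable {V : Type} [DecidableEq V] {B : SimpleGraph V} [DecidableRel B.Adj] {k : ℕ}
  {s : SearchState V}

/-- `H` has degrees at most `k` in `B`. -/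
def Bounded (B : SimpleGraph V) [DecidableRel B.Adj] (k : ℕ) (H : Finset V) : Prop :=
  ∀ v ∈ H, mis B H v ≤ k

theorem Bounded.mono {H H' : Finset V} (h : Bounded B k H') (hH : H ⊆ H') : Bounded B k H :=
  fun v hv => (mis_mono hH v).trans (h v (hH hv))

theorem Bounded.addable {A H : Finset V} (h : Bounded B k H) (hA : A ⊆ H) {v : V} (hv : v ∈ H)
    (hvA : v ∉ A) : Addable B k A v :=
  ⟨(mis_mono hA v).trans (h v hv), fun w hw hvw =>
    (mis_lt_mis hA hv hvA hvw.symm).trans_le (h w (hA hw))⟩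

theorem Bounded.insert {H : Finset V} (h : Bounded B k H) {v : V} (hv : Addable B k H v) :
    Bounded B k (insert v H) := by
  intro w hw
  rw [mis, Finset.filter_insert]
  rcases Finset.mem_insert.1 hw with rfl | hw
  · rw [if_neg (B.loopless.irrefl _)]
    exact hv.1
  · split_ifs with hwv
    · exact (Finset.card_insert_le _ _).trans (hv.2 w hw hwv.symm)
    · exact h w hw

theorem mem_childStates_iff {c : SearchState V} : ∀ {l pre : List V},
    c ∈ childStates B k s pre l ↔
      ∃ l₁ v l₂, l = l₁ ++ v :: l₂ ∧ c = childState B k s (pre ++ l₁) v := by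
  intro l
  induction l with
  | nil => simp [childStates]
  | cons u l ih =>
    intro pre
    rw [childStates, List.mem_cons, ih]
    constructor
    · rintro (rfl | ⟨l₁, v, l₂, rfl, rfl⟩)
      · exact ⟨[], u, l, rfl, by simp⟩
      · exact ⟨u :: l₁, v, l₂, rfl, by simp⟩
    · rintro ⟨_ | ⟨w, l₁⟩, v, l₂, h, rfl⟩
      · simp only [List.nil_append, List.cons.injEq] at h
        exact .inl (by simp [h.1])
      · simp only [List.cons_append, List.cons.injEq] at h
        exact .inr ⟨l₁, v, l₂, h.2, by simp [h.1]⟩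

theorem List.exists_first_not_mem {H : Finset V} {l : List V} (h : ∃ v ∈ l, v ∉ H) :
    ∃ l₁ v l₂, l = l₁ ++ v :: l₂ ∧ v ∉ H ∧ ∀ u ∈ l₁, u ∈ H := by
  induction l with
  | nil => simp at h
  | cons u l ih =>
    by_cases hu : u ∈ H
    · obtain ⟨l₁, v, l₂, rfl, h1, h2⟩ := ih (by simpa [hu] using h)
      exact ⟨u :: l₁, v, l₂, rfl, h1, by simpa [hu] using h2⟩
    · exact ⟨[], u, l, rfl, hu, by simp⟩

/-- Otherwise the listed neighbours and those in `S` would give `p` degree at least `k + 1` in `H`.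
-/
theorem IsBlock.exists_notMem {p : V} {l : List V} (hl : IsBlock B k s p l)
    (hs : Disjoint s.S s.C) {H : Finset V} (hH : Bounded B k H) (hSH : s.S ⊆ H) (hp : p ∈ H) :
    ∃ v ∈ l, v ∉ H := by
  by_contra hcon
  push Not at hcon
  have h1 : s.S.filter (B.Adj p) ∪ l.toFinset ⊆ H.filter (B.Adj p) := by
    intro u hu
    simp only [Finset.mem_union, Finset.mem_filter, List.mem_toFinset] at hu ⊢
    rcases hu with hu | hu
    · exact ⟨hSH hu.1, hu.2⟩
    · exact ⟨hcon u hu, (hl.mem u hu).2⟩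
  have h2 := Finset.card_le_card h1
  rw [Finset.card_union_of_disjoint, List.toFinset_card_of_nodup hl.nodup] at h2
  · have h3 := hl.len
    have h4 := hH p hp
    unfold mis at h3 h4
    omega
  · rw [Finset.disjoint_left]
    intro u hu hu'
    exact Finset.disjoint_left.1 hs (Finset.mem_filter.1 hu).1
      (hl.mem u (List.mem_toFinset.1 hu')).1

theorem IsBranchList.exists_notMem {l : List V} (hl : IsBranchList B k s l)
    (hs : Disjoint s.S s.C) {H : Finset V} (hH : Bounded B k H) (hSH : s.S ⊆ H) :
    ∃ v ∈ l, v ∉ H := by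
  obtain ⟨p, hp | ⟨l', rfl, hp⟩⟩ := hl
  · exact hp.block.exists_notMem hs hH hSH (hSH hp.mem)
  · by_cases hpH : p ∈ H
    · obtain ⟨v, hv, hv'⟩ := hp.block.exists_notMem hs hH hSH hpH
      exact ⟨v, List.mem_cons_of_mem _ hv, hv'⟩
    · exact ⟨p, List.mem_cons_self, hpH⟩

/-- Every bounded set between `S` and `S ∪ C` lies below some child. -/
theorem IsBranchList.exists_child {l : List V} (hl : IsBranchList B k s l)
    (hs : Disjoint s.S s.C) {H : Finset V} (hH : Bounded B k H) (hSH : s.S ⊆ H)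
    (hHU : H ⊆ s.U) :
    ∃ c ∈ childStates B k s [] l, c.S ⊆ H ∧ H ⊆ c.U := by
  obtain ⟨l₁, v, l₂, rfl, hv, hl₁⟩ :=
    List.exists_first_not_mem (hl.exists_notMem hs hH hSH)
  refine ⟨_, mem_childStates_iff.2 ⟨l₁, v, l₂, rfl, rfl⟩, ?_⟩
  have hsub : s.S ∪ l₁.toFinset ⊆ H :=
    Finset.union_subset hSH fun u hu => hl₁ u (List.mem_toFinset.1 hu)
  refine ⟨hsub, fun u hu => ?_⟩
  simp only [SearchState.U, childState, List.nil_append]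
  by_cases huS : u ∈ s.S ∪ l₁.toFinset
  · exact Finset.mem_union_left _ huS
  · classical
    rw [Finset.mem_union, Finset.mem_filter]
    refine .inr ⟨?_, hH.addable hsub hu huS⟩
    simp only [Finset.mem_union, not_or] at huS
    have := hHU hu
    simp only [SearchState.U, Finset.mem_union, huS.1, false_or] at this
    exact Finset.mem_erase.2 ⟨by rintro rfl; exact hv hu, Finset.mem_sdiff.2 ⟨this, huS.2⟩⟩

/-- Disjointness of `D` from `S ∪ C` makes rule (4) sound, and the shrinking candidate set bounds
the depth of the recursion. -/
theorem childStates_invariant {l : List V} (hl : IsBranchList B k s l) (hs : Refined B k s)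
    (hD : Disjoint s.D s.U) {c : SearchState V} (hc : c ∈ childStates B k s [] l) :
    Refined B k c ∧ Disjoint c.D c.U ∧ c.C.card < s.C.card := by
  obtain ⟨l₁, v, l₂, rfl, rfl⟩ := mem_childStates_iff.1 hc
  have hnd := hl.nodup
  have hmem := hl.mem
  rw [List.nil_append]
  refine ⟨childState_refined hs.disj _ _, ?_, ?_⟩
  · rw [Finset.disjoint_left]
    intro u hu hu'
    have hsub := childState_U_subset (B := B) (k := k) (s := s) (pre := l₁) (v := v)
      (fun u hu => hmem u (by simp [hu]))
    simp only [childState, Finset.mem_filter, Finset.mem_insert] at hu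
    rcases hu.1 with rfl | hu
    · refine notMem_childState_U hs.disj (hmem u (by simp)) ?_ hu'
      intro h
      rw [List.nodup_append] at hnd
      exact hnd.2.2 u h u (by simp) rfl
    · exact Finset.disjoint_left.1 hD hu (hsub hu')
  · have := card_childState_C (B := B) (k := k) (s := s) (pre := l₁) (v := v)
      (hnd.sublist (by simp)) (fun u hu => hmem u (by simp at hu ⊢; tauto))
    omega

end Covering

/-! ### Correctness of the search -/

section Correctness

open Timed

variable {V : Type} [Fintype V] [DecidableEq V] (I : Input V)
  {scan : Branch V → Best V → List V} (G : SimpleGraph V) [DecidableRel G.Adj]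

/-- The number of edges of `G[H]`. -/
def numEdges (H : Finset V) : ℕ :=
  ∑ v ∈ H.filter (fun v => I.left v = true), (H.filter (G.Adj v)).card

/-- `H` is a `k`-biplex that satisfies the size constraints. -/
structure Large (H : Finset V) : Prop where
  bounded : Bounded (coGraph I G) I.k H
  left_le : I.θL ≤ (H.filter fun v => I.left v = true).card
  right_le : I.θR ≤ (H.filter fun v => I.left v = false).card

/-- `H` is a maximal `k`-biplex that satisfies the size constraints. -/
structure MaximalLarge (H : Finset V) : Prop extends Large I G H where
  eq_of_subset : ∀ H', Bounded (coGraph I G) I.k H' → H ⊆ H' → H' = H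

/-- The stored best solution is consistent. -/
def Best.Valid (best : Best V) : Prop :=
  numEdges I G (vertexSet best.mem) = best.edges ∧
    (vertexSet best.mem = ∅ ∨ Large I G (vertexSet best.mem))

/-- `best'` is at least as good as `best`. -/
def Best.Improves (best best' : Best V) : Prop :=
  best.edges ≤ best'.edges ∧ (best.Valid I G → best'.Valid I G)

/-- No solution below `s` has more edges than `best`. -/
def Covered (s : SearchState V) (best : Best V) : Prop :=
  ∀ H, MaximalLarge I G H → s.S ⊆ H → H ⊆ s.U → numEdges I G H ≤ best.edges

variable {I G}

theorem numEdges_mono {H H' : Finset V} (h : H ⊆ H') : numEdges I G H ≤ numEdges I G H' :=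
  (Finset.sum_le_sum fun _ _ => Finset.card_le_card (Finset.filter_subset_filter _ h)).trans
    (Finset.sum_le_sum_of_subset (Finset.filter_subset_filter _ h))

theorem numEdges_le_mul (hI : I.Models G) (H : Finset V) :
    numEdges I G H ≤ (H.filter fun v => I.left v = true).card *
      (H.filter fun v => I.left v = false).card := by
  rw [numEdges, ← smul_eq_mul]
  refine Finset.sum_le_card_nsmul _ _ _ fun v hv => Finset.card_le_card fun u hu => ?_
  have h1 := (Finset.mem_filter.1 hv).2
  obtain ⟨h2, h3⟩ := Finset.mem_filter.1 hu
  have h4 := hI.left_ne v u h3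
  refine Finset.mem_filter.2 ⟨h2, ?_⟩
  rw [h1] at h4
  simpa using h4.symm

theorem updateBest_val (hI : I.Models G) (b : Branch V) (best : Best V) (e : ℕ) :
    (updateBest I b best e).val =
      if I.θL ≤ (b.state.U.filter fun v => I.left v = true).card ∧
        I.θR ≤ (b.state.U.filter fun v => I.left v = false).card ∧ best.edges < e
      then ⟨b.SC, e⟩ else best := by
  have h1 : vertexSet (fun v => b.SC v && I.left v) =
      b.state.U.filter fun v => I.left v = true := by
    rw [← vertexSet_SC]; ext v; simp [mem_vertexSet]
  have h2 : vertexSet (fun v => b.SC v && !I.left v) =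
      b.state.U.filter fun v => I.left v = false := by
    rw [← vertexSet_SC]; ext v; simp [mem_vertexSet]
  simp only [updateBest, bind_val, countVerts_val hI, h1, h2]
  by_cases h : I.θL ≤ (b.state.U.filter fun v => I.left v = true).card ∧
      I.θR ≤ (b.state.U.filter fun v => I.left v = false).card ∧ best.edges < e
  · rw [if_pos h, if_pos (by simp [h.1, h.2.1, h.2.2])]
    simp only [bind_val, op_val, loop_val]
    rw [foldl_update]
    simp [hI.mem_verts]
  · rw [if_neg h, if_neg (by simpa [and_assoc] using h)]
    rfl

theorem updateBest_improves (hI : I.Models G) {b : Branch V}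
    (hb : Bounded (coGraph I G) I.k b.state.U) (best : Best V) :
    best.Improves I G (updateBest I b best (numEdges I G b.state.U)).val ∧
      Covered I G b.state (updateBest I b best (numEdges I G b.state.U)).val := by
  rw [updateBest_val hI]
  split_ifs with h
  · refine ⟨⟨h.2.2.le, fun _ => ?_⟩, fun H _ _ hU => numEdges_mono hU⟩
    simp only [Best.Valid, vertexSet_SC]
    exact ⟨trivial, .inr ⟨hb, h.1, h.2.1⟩⟩
  · refine ⟨⟨le_rfl, id⟩, fun H hH _ hU => ?_⟩
    have h1 := hH.left_le.trans (Finset.card_le_card (Finset.filter_subset_filter _ hU))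
    have h2 := hH.right_le.trans (Finset.card_le_card (Finset.filter_subset_filter _ hU))
    exact (numEdges_mono hU).trans (not_lt.1 fun h3 => h ⟨h1, h2, h3⟩)

theorem card_side_le_tau (hI : I.Models G) {b : Branch V} {H : Finset V}
    (hH : Bounded (coGraph I G) I.k H) (hS : b.state.S ⊆ H) (hU : H ⊆ b.state.U)
    {side : Bool} {t : ℕ} (ht : (tau I b (degrees I b.SC).val side).val = some t) :
    (H.filter fun v => I.left v = side).card ≤ t := by
  obtain ⟨u, hu, hside, rfl⟩ := tau_attained b _ side ht
  have h1 := card_nbrs_add_mis hI H u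
  have h2 := hH u (hS hu)
  have h3 : (H.filter (G.Adj u)).card ≤ (b.state.U.filter (G.Adj u)).card :=
    Finset.card_le_card (Finset.filter_subset_filter _ hU)
  have h4 : (H.filter fun v => I.left v = side) = H.filter fun v => I.left u ≠ I.left v := by
    refine Finset.filter_congr fun v _ => ?_
    revert hside
    cases I.left u <;> cases I.left v <;> cases side <;> simp
  rw [degrees_val hI, vertexSet_SC, h4]
  omega

/-- The excluded vertex extends every biplex inside `S ∪ C`, so none of these is maximal. This is
why `Covered` speaks of maximal sets only. -/
theorem covered_of_extendable {s : SearchState V} (hD : Disjoint s.D s.U)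
    (h : Extendable (coGraph I G) I.k s) (best : Best V) : Covered I G s best := by
  intro H hH _ hU
  obtain ⟨v, hv, hadd⟩ := h
  have h1 := hH.eq_of_subset _ (hH.bounded.insert (hadd.mono hU)) (Finset.subset_insert v H)
  exact absurd (hU (h1 ▸ Finset.mem_insert_self v H)) (Finset.disjoint_left.1 hD hv)

theorem covered_of_testPrune (hI : I.Models G) {b : Branch V} {best : Best V}
    (hD : Disjoint b.state.D b.state.U)
    (h : (testPrune I b best (mis (coGraph I G) b.state.S) (degrees I b.SC).val
      (mis (coGraph I G) b.state.U)).val = true) : Covered I G b.state best := by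
  simp only [testPrune, bind_val, op_val, Bool.or_eq_true] at h
  obtain ((h | h) | h) | h := h
  · intro H hH hS _
    have h1 := (testBiplex_val hI b.S (mis (coGraph I G) b.state.S)).2
      (hH.bounded.mono hS)
    simp [h1] at h
  · intro H hH hS hU
    rcases h with h | h
    · rcases ht : (tau I b (degrees I b.SC).val true).val with _ | t
      · simp [ht, tauLT] at h
      · have h1 := card_side_le_tau hI hH.bounded hS hU ht
        have h2 := hH.left_le
        simp only [ht, tauLT, decide_eq_true_eq] at h
        omega
    · rcases ht : (tau I b (degrees I b.SC).val false).val with _ | t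
      · simp [ht, tauLT] at h
      · have h1 := card_side_le_tau hI hH.bounded hS hU ht
        have h2 := hH.right_le
        simp only [ht, tauLT, decide_eq_true_eq] at h
        omega
  · intro H hH hS hU
    rcases h with h | h
    · rw [decide_eq_true_eq, countEdges_val hI, vertexSet_SC] at h
      exact (numEdges_mono hU).trans h
    · rcases ht : (tau I b (degrees I b.SC).val true).val with _ | t
      · simp [ht, tauMulLE] at h
      rcases ht' : (tau I b (degrees I b.SC).val false).val with _ | t'
      · simp [ht, ht', tauMulLE] at h
      simp only [ht, ht', tauMulLE, decide_eq_true_eq] at h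
      exact (numEdges_le_mul hI H).trans ((Nat.mul_le_mul
        (card_side_le_tau hI hH.bounded hS hU ht)
        (card_side_le_tau hI hH.bounded hS hU ht')).trans h)
  · exact covered_of_extendable hD ((testExtendable_val hI b).1 h) best

/-- Correctness goes through `fastBBRec_cases`, which asks for some size bound; the added ones cover
empty and edgeless inputs. -/
theorem Input.Models.exists_size (hI : I.Models G) : ∃ N d, I.Size N d := by
  refine ⟨(I.verts.length + 1) * (G.maxDegree + 1), G.maxDegree + 1, ?_, ?_, ?_, ?_, ?_⟩
  · exact Nat.mul_pos (Nat.succ_pos _) (Nat.succ_pos _)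
  · exact Nat.succ_pos _
  · exact Nat.mul_le_mul_right _ (Nat.le_succ _)
  · intro v
    have h1 : (I.adj v).toFinset = G.neighborFinset v := by ext u; simp [hI.mem_adj]
    rw [← List.toFinset_card_of_nodup (hI.adj_nodup v), h1, G.card_neighborFinset_eq_degree]
    exact (G.degree_le_maxDegree v).trans (Nat.le_succ _)
  · exact Nat.le_mul_of_pos_left _ (Nat.succ_pos _)

theorem fastBBRec_covered (hI : I.Models G) (hscan : ∀ b best, (scan b best).Perm I.verts)
    (fuel : ℕ) : ∀ (b : Branch V) (best : Best V), Refined (coGraph I G) I.k b.state →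
      Disjoint b.state.D b.state.U → b.state.C.card < fuel →
      best.Improves I G (fastBBRec I scan fuel b best).val ∧
        Covered I G b.state (fastBBRec I scan fuel b best).val := by
  obtain ⟨N, d, hN⟩ := hI.exists_size
  induction fuel with
  | zero => intro b best _ _ h; exact absurd h (Nat.not_lt_zero _)
  | succ fuel ih =>
    intro b best hs hD hfuel
    obtain ⟨h1, h2, _⟩ | ⟨h1, h2, _⟩ | ⟨_, _, hrec⟩ :=
      fastBBRec_cases hI hN hscan fuel b best
    · rw [h2, countEdges_val hI, vertexSet_SC]
      exact updateBest_improves hI h1 best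
    · rw [h2]
      exact ⟨⟨le_rfl, id⟩, covered_of_testPrune hI hD h1⟩
    · obtain ⟨l, hl, h1, _⟩ := hrec hs
      rw [h1]
      obtain ⟨h2, h3⟩ := branchLoop_val (scan := scan) hI fuel (Q := Best.Improves I G)
        (fun _ => ⟨le_rfl, id⟩)
        (fun _ _ _ h h' => ⟨h.1.trans h'.1, fun hx => h'.2 (h.2 hx)⟩)
        (R := Covered I G) (fun _ _ _ hxy hx H hH hS hU => (hx H hH hS hU).trans hxy.1)
        l [] b best (hasState_nil b) (by
          rintro c hc b' best' rfl
          obtain ⟨h4, h5, h6⟩ := childStates_invariant hl hs hD hc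
          exact ih b' best' h4 h5 (by omega))
      refine ⟨h2, fun H hH hS hU => ?_⟩
      obtain ⟨c, hc, hcS, hcU⟩ := hl.exists_child hs.disj hH.bounded hS hU
      exact h3 c hc H hH hcS hcU

/-- The other side has more than `k` vertices, and `v` misses at most `k` of them. -/
theorem Large.nbrs_pos (hI : I.Models G) (hL : I.k < I.θL) (hR : I.k < I.θR) {H : Finset V}
    (hH : Large I G H) {v : V} (hv : v ∈ H) : ∃ u ∈ H, G.Adj v u := by
  have h1 := card_nbrs_add_mis hI H v
  have h2 := hH.bounded v hv
  have h3 := hH.left_le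
  have h4 := hH.right_le
  have h5 : 0 < (H.filter (G.Adj v)).card := by
    have h6 : ∀ c, (H.filter fun u => I.left v ≠ I.left u) =
        H.filter (fun u => I.left u = c) ∨ I.left v = c := by
      intro c
      by_cases h : I.left v = c
      · exact .inr h
      · refine .inl (Finset.filter_congr fun u _ => ?_)
        revert h
        cases I.left v <;> cases I.left u <;> cases c <;> simp
    rcases h6 true with h | h
    · rw [h] at h1; omega
    · rcases h6 false with h' | h'
      · rw [h'] at h1; omega
      · simp [h] at h'
  obtain ⟨u, hu⟩ := Finset.card_pos.1 h5
  exact ⟨u, Finset.mem_filter.1 hu⟩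

theorem numEdges_pos_of_adj (hI : I.Models G) {H : Finset V} {v u : V} (hv : v ∈ H) (hu : u ∈ H)
    (h : G.Adj v u) : 0 < numEdges I G H := by
  have hne := hI.left_ne v u h
  have key : ∀ {v u : V}, v ∈ H → u ∈ H → G.Adj v u → I.left v = true → 0 < numEdges I G H := by
    intro v u hv hu h hl
    exact Finset.sum_pos' (fun _ _ => Nat.zero_le _)
      ⟨v, Finset.mem_filter.2 ⟨hv, hl⟩, Finset.card_pos.2 ⟨u, Finset.mem_filter.2 ⟨hu, h⟩⟩⟩
  cases hl : I.left v with
  | true => exact key hv hu h hl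
  | false =>
    refine key hu hv h.symm ?_
    rw [hl] at hne
    simpa using hne.symm

theorem numEdges_lt_of_adj (hI : I.Models G) {H H' : Finset V} (hHH' : H ⊆ H') {v u : V}
    (hv : v ∈ H') (hvH : v ∉ H) (hu : u ∈ H') (h : G.Adj v u) :
    numEdges I G H < numEdges I G H' := by
  have hne := hI.left_ne v u h
  cases hl : I.left v with
  | true =>
    refine (Finset.sum_le_sum fun _ _ => Finset.card_le_card
      (Finset.filter_subset_filter _ hHH')).trans_lt (Finset.sum_lt_sum_of_subset
      (Finset.filter_subset_filter _ hHH') (i := v) (Finset.mem_filter.2 ⟨hv, hl⟩)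
      (fun h' => hvH (Finset.mem_filter.1 h').1)
      (Finset.card_pos.2 ⟨u, Finset.mem_filter.2 ⟨hu, h⟩⟩) fun _ _ _ => Nat.zero_le _)
  | false =>
    have hlu : I.left u = true := by rw [hl] at hne; simpa using hne.symm
    refine (Finset.sum_le_sum_of_subset (f := fun w => (H.filter (G.Adj w)).card)
      (Finset.filter_subset_filter _ hHH')).trans_lt
      (Finset.sum_lt_sum (fun w _ => Finset.card_le_card (Finset.filter_subset_filter _ hHH'))
        ⟨u, Finset.mem_filter.2 ⟨hu, hlu⟩, ?_⟩)
    exact Finset.card_lt_card ⟨Finset.filter_subset_filter _ hHH', fun h' =>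
      hvH (Finset.mem_filter.1 (h' (Finset.mem_filter.2 ⟨hv, h.symm⟩))).1⟩

theorem Large.of_subset {H H' : Finset V} (hH : Large I G H)
    (hH' : Bounded (coGraph I G) I.k H') (h : H ⊆ H') : Large I G H' :=
  ⟨hH', hH.left_le.trans (Finset.card_le_card (Finset.filter_subset_filter _ h)),
    hH.right_le.trans (Finset.card_le_card (Finset.filter_subset_filter _ h))⟩

theorem Large.numEdges_lt (hI : I.Models G) (hL : I.k < I.θL) (hR : I.k < I.θR)
    {H H' : Finset V} (hH' : Large I G H') (h : H ⊂ H') : numEdges I G H < numEdges I G H' := by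
  obtain ⟨v, hv, hvH⟩ := Finset.exists_of_ssubset h
  obtain ⟨u, hu, hvu⟩ := hH'.nbrs_pos hI hL hR hv
  exact numEdges_lt_of_adj hI h.1 hv hvH hu hvu

theorem Large.exists_maximal {H : Finset V} (hH : Large I G H) :
    ∃ H', MaximalLarge I G H' ∧ H ⊆ H' := by
  obtain ⟨H', hHH', hmax⟩ :=
    (Set.toFinite {H' | Bounded (coGraph I G) I.k H'}).exists_le_maximal hH.bounded
  exact ⟨H', ⟨hH.of_subset hmax.prop hHH', fun H'' h h' =>
    (hmax.eq_of_le h h').symm⟩, hHH'⟩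

theorem fastBB_spec (hI : I.Models G) (hscan : ∀ b best, (scan b best).Perm I.verts)
    (hL : I.k < I.θL) (hR : I.k < I.θR) :
    ((∃ H, MaximalLarge I G H) →
      MaximalLarge I G (vertexSet (fastBB I scan).val.mem) ∧
        ∀ H, MaximalLarge I G H →
          numEdges I G H ≤ numEdges I G (vertexSet (fastBB I scan).val.mem)) ∧
      ((¬ ∃ H, MaximalLarge I G H) → vertexSet (fastBB I scan).val.mem = ∅) := by
  obtain ⟨⟨_, h1⟩, h2⟩ := fastBBRec_covered hI hscan (Fintype.card V + 1) (rootBranch V)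
    ⟨fun _ => false, 0⟩ (rootBranch_refined _ _) (by simp [rootBranch_state])
    (by rw [rootBranch_state, Finset.card_univ]; exact Nat.lt_succ_self _)
  rw [← fastBB_val hI] at h1 h2
  have hempty : vertexSet (fun _ : V => false) = ∅ := by simp [vertexSet]
  obtain ⟨h3, h4⟩ := h1 ⟨by simp [hempty, numEdges], .inl hempty⟩
  have h5 : ∀ H, MaximalLarge I G H →
      numEdges I G H ≤ numEdges I G (vertexSet (fastBB I scan).val.mem) := by
    intro H hH
    rw [h3]
    exact h2 H hH (by simp [rootBranch_state]) (by simp [rootBranch_state, SearchState.U])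
  constructor
  · rintro ⟨H, hH⟩
    refine ⟨?_, h5⟩
    -- `H*` cannot still be empty: the given feasible set has an edge, and `H*` has at least as
    -- many.
    have hlarge : Large I G (vertexSet (fastBB I scan).val.mem) := by
      refine h4.resolve_left fun h => ?_
      have h6 := h5 H hH
      have h7 := hH.left_le
      obtain ⟨v, hv⟩ : (H.filter fun v => I.left v = true).Nonempty :=
        Finset.card_pos.1 (by omega)
      have hv' := (Finset.mem_filter.1 hv).1
      obtain ⟨u, hu, hvu⟩ := hH.nbrs_pos hI hL hR hv'
      have h8 := numEdges_pos_of_adj hI hv' hu hvu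
      rw [h] at h6
      simp only [numEdges, Finset.filter_empty, Finset.sum_empty] at h6
      unfold numEdges at h8
      omega
    refine ⟨hlarge, fun H' hH' hsub => ?_⟩
    -- A strictly larger biplex would extend to a feasible one with more edges than `H*`.
    by_contra hne
    obtain ⟨H'', hmax, hsub'⟩ := (hlarge.of_subset hH' hsub).exists_maximal
    have h6 : vertexSet (fastBB I scan).val.mem ⊂ H'' :=
      (hsub.ssubset_of_ne (Ne.symm hne)).trans_subset hsub'
    exact absurd (h5 _ hmax) (not_le.2 (hmax.toLarge.numEdges_lt hI hL hR h6))
  · intro h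
    refine h4.resolve_right fun hlarge => h ?_
    obtain ⟨H, hH, _⟩ := hlarge.exists_maximal
    exact ⟨H, hH⟩

/-! ### Translation to the sides `L` and `R` -/

section Encoding

variable {L R : Finset V} (hbip : G.IsBipartiteWith (L : Set V) (R : Set V))
  (hLR : L ∪ R = Finset.univ) {k θL θR : ℕ} (he : I.Encodes G L k θL θR)

include hbip hLR he

theorem Input.Encodes.mem_right_iff (v : V) : v ∈ R ↔ I.left v = false := by
  have h1 := he.left_iff v
  have h2 : v ∈ L ∪ R := hLR ▸ Finset.mem_univ v
  have h3 : v ∈ L → v ∉ R := fun h =>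
    Finset.disjoint_left.1 (Finset.disjoint_coe.1 hbip.disjoint) h
  rw [Finset.mem_union] at h2
  rw [← Bool.not_eq_true, h1]
  tauto

theorem Input.Encodes.inter_left (H : Finset V) : H ∩ L = H.filter fun v => I.left v = true := by
  ext v; simp [he.left_iff]

theorem Input.Encodes.inter_right (H : Finset V) :
    H ∩ R = H.filter fun v => I.left v = false := by
  ext v; simp [he.mem_right_iff hbip hLR]

theorem Input.Encodes.models : I.Models G where
  verts_nodup := he.verts_nodup
  mem_verts := he.mem_verts
  adj_nodup := he.adj_nodup
  mem_adj := he.mem_adj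
  left_ne v u h := by
    have h1 := he.mem_right_iff hbip hLR
    have h2 := he.left_iff
    rcases hbip.mem_of_adj h with ⟨h3, h4⟩ | ⟨h3, h4⟩
    · rw [(h2 v).2 h3, (h1 u).1 h4]; simp
    · rw [(h1 v).1 h3, (h2 u).2 h4]; simp

theorem Input.Encodes.isBiplex_iff (H : Finset V) :
    IsBiplex G L R k H ↔ Bounded (coGraph I G) I.k H := by
  have key : ∀ v c, I.left v = c →
      disconnections G v (H.filter fun u => I.left u = !c) = mis (coGraph I G) H v := by
    rintro v c rfl
    rw [disconnections, mis, Finset.filter_filter]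
    congr 1
    refine Finset.filter_congr fun u _ => ?_
    rw [coGraph_adj]
    cases I.left v <;> cases I.left u <;> simp
  rw [IsBiplex, he.inter_left hbip hLR, he.inter_right hbip hLR, he.k_eq]
  constructor
  · rintro ⟨h1, h2⟩ v hv
    cases hl : I.left v with
    | true => rw [← key v true hl]; exact h1 v (Finset.mem_filter.2 ⟨hv, hl⟩)
    | false => rw [← key v false hl]; exact h2 v (Finset.mem_filter.2 ⟨hv, hl⟩)
  · intro h
    refine ⟨fun v hv => ?_, fun v hv => ?_⟩ <;> obtain ⟨hv, hl⟩ := Finset.mem_filter.1 hv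
    · exact (key v true hl).trans_le (h v hv)
    · exact (key v false hl).trans_le (h v hv)

theorem Input.Encodes.isFeasible_iff (H : Finset V) :
    IsFeasible G L R k θL θR H ↔ MaximalLarge I G H := by
  simp only [IsFeasible, IsMaximalBiplex, he.isBiplex_iff hbip hLR, he.inter_left hbip hLR,
    he.inter_right hbip hLR, ← he.θL_eq, ← he.θR_eq]
  exact ⟨fun h => ⟨⟨h.1.1, h.2.1, h.2.2⟩, h.1.2⟩,
    fun h => ⟨⟨h.bounded, h.eq_of_subset⟩, h.left_le, h.right_le⟩⟩

theorem Input.Encodes.inducedEdges_eq (H : Finset V) :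
    inducedEdges G L R H = numEdges I G H := by
  rw [inducedEdges, he.inter_left hbip hLR, he.inter_right hbip hLR, numEdges, Finset.card_filter,
    Finset.sum_product]
  refine Finset.sum_congr rfl fun v hv => ?_
  rw [← Finset.card_filter, Finset.filter_filter]
  congr 1
  refine Finset.filter_congr fun u _ => ?_
  have h1 := (Finset.mem_filter.1 hv).2
  have h2 := (he.models hbip hLR).left_ne v u
  rw [h1] at h2
  constructor
  · exact fun h => h.2
  · exact fun h => ⟨by simpa using (h2 h).symm, h⟩

/-- With an edge present, `|V| * d` dominates `|V|`, `d` and 1, so it absorbs all lower-order terms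
of the step counts. -/
theorem Input.Encodes.size (hd : 1 ≤ G.maxDegree) :
    I.Size (Fintype.card V * G.maxDegree) G.maxDegree := by
  have hlen : I.verts.length = Fintype.card V := by
    rw [← List.toFinset_card_of_nodup he.verts_nodup, verts_toFinset (he.models hbip hLR),
      Finset.card_univ]
  have hV : 1 ≤ Fintype.card V := by
    by_contra hcon
    have : IsEmpty V := Fintype.card_eq_zero_iff.1 (by omega)
    have h0 : G.maxDegree = 0 := by
      apply Nat.le_zero.1
      exact G.maxDegree_le_of_forall_degree_le 0 fun v => isEmptyElim v
    omega
  refine ⟨Nat.mul_pos hV hd, hd, by rw [hlen], fun v => ?_, Nat.le_mul_of_pos_left _ hV⟩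
  have h1 : (I.adj v).toFinset = G.neighborFinset v := by ext u; simp [he.mem_adj]
  rw [← List.toFinset_card_of_nodup (he.adj_nodup v), h1, G.card_neighborFinset_eq_degree]
  exact G.degree_le_maxDegree v

end Encoding

end Correctness

theorem mainTheorem2 :
    (∀ k : ℕ, 1 ≤ k → IsGreatest (gammaRoots k) (gammaK k) ∧ gammaK k < 2) ∧
    gammaK 1 ∈ Set.Ico (1.754 : ℝ) 1.755 ∧
    gammaK 2 ∈ Set.Ico (1.888 : ℝ) 1.889 ∧
    gammaK 3 ∈ Set.Ico (1.947 : ℝ) 1.948 ∧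
    ∃ c : ℝ, 0 < c ∧
      ∀ (V : Type) [Fintype V] [DecidableEq V] (G : SimpleGraph V) [DecidableRel G.Adj]
        (L R : Finset V) (k θL θR : ℕ) (I : Input V) (scan : Branch V → Best V → List V),
        G.IsBipartiteWith (L : Set V) (R : Set V) → L ∪ R = Finset.univ →
        1 ≤ k → 2 * k + 1 ≤ θL → 2 * k + 1 ≤ θR →
        I.Encodes G L k θL θR →
        (∀ b best, (scan b best).Perm I.verts) →
        -- correctness
        ((∃ H, IsFeasible G L R k θL θR H) →
          IsMaxBP G L R k θL θR
            (Finset.univ.filter (fun v => (fastBB I scan).val.mem v = true))) ∧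
        ((¬ ∃ H, IsFeasible G L R k θL θR H) → ∀ v, (fastBB I scan).val.mem v = false) ∧
        -- running time
        (1 ≤ G.maxDegree →
          ((fastBB I scan).steps : ℝ) ≤
            c * (Fintype.card V * G.maxDegree * gammaK k ^ Fintype.card V)) := by
  refine ⟨fun k _ => ⟨isGreatest_gammaK k, gammaK_lt_two k⟩, gammaK_one_mem, gammaK_two_mem,
    gammaK_three_mem, 40015, by norm_num, ?_⟩
  intro V _ _ G _ L R k θL θR I scan hbip hLR hk hθL hθR he hscan
  have hI := he.models hbip hLR
  have hk' := he.k_eq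
  have hL : I.k < I.θL := by rw [he.k_eq, he.θL_eq]; omega
  have hR : I.k < I.θR := by rw [he.k_eq, he.θR_eq]; omega
  obtain ⟨h1, h2⟩ := fastBB_spec hI hscan hL hR
  simp only [IsMaxBP, he.isFeasible_iff hbip hLR, he.inducedEdges_eq hbip hLR]
  refine ⟨h1, fun h v => ?_, fun hd => ?_⟩
  · rw [← Bool.not_eq_true, ← mem_vertexSet, h2 h]
    exact Finset.notMem_empty v
  · have h3 := fastBB_steps hI (he.size hbip hLR hd) hscan (hk.trans_eq hk'.symm)
    rw [he.k_eq] at h3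
    push_cast at h3
    exact h3
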